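/- Let $\mathcal R$ be the set of positive integers of the form $c^2+d^2$ with integers $c\ge 0$, $d\ge 1$. For $n\ge 1$ let $$r^*_{\mathcal R}(n)=\#\{(a,b)\in\mathbb Z_{\ge 0}\times\mathcal R:\ a^2+b^2=n,\ \gcd(a,b)=1\},$$ and let $\omega^*(n)$ be the number of distinct odd prime factors of $n$. Write $L=\log\log x$. For every integer $\ell\ge 1$ there are constants $A>0$ and $K>0$, depending only on $\ell$, such that for every $C>0$ there is an $x_0$ (depending on $\ell$ and $C$) such that for all real $x>x_0$ and all integers $0\le k\le CL$, $$\sum_{\substack{1\le n\le x\\ \omega^*(n)=k}}\binom{r^*_{\mathcal R}(n)}{\ell}\ \le\ K\,\frac{x\,L^{A}}{(\sqrt{\log x})^{\ell+1}}\cdot\frac{(2^{\ell-1}L)^k}{k!}.$$ That is, for fixed $\ell\ge1$ and integers $k\ll L$ the sum is $\ll_\ell \dfrac{xL^{O_\ell(1)}}{(\sqrt{\log x})^{\ell+1}}\dfrac{(2^{\ell-1}L)^k}{k!}$. -/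

import Mathlib

/-- The pairs `(a, b)` of natural numbers with `b ∈ S` and `a ^ 2 + b ^ 2 = n`. -/
def repPairs (S : Set ℕ) (n : ℕ) : Set (ℕ × ℕ) :=
  {q | q.2 ∈ S ∧ q.1 ^ 2 + q.2 ^ 2 = n}

/-- There are only finitely many such pairs, so that `Set.ncard` below is the true count. -/
theorem repPairs_finite (S : Set ℕ) (n : ℕ) : (repPairs S n).Finite := by
  refine (Set.finite_Iic ((n, n) : ℕ × ℕ)).subset ?_
  rintro ⟨a, b⟩ ⟨-, h⟩
  simp only at h
  refine Set.mem_Iic.2 (Prod.mk_le_mk.2 ⟨?_, ?_⟩) <;> nlinarith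

/-- `r₀(n)`: the number of `(a, b)` with `a ≥ 0`, `b ≥ 1` and `a ^ 2 + b ^ 2 = n`. -/
noncomputable def r0 (n : ℕ) : ℕ := (repPairs {b | 1 ≤ b} n).ncard

/-- The set `𝓡` of sums of two squares, `{k : r₀(k) ≥ 1}`. -/
def sumTwoSquares : Set ℕ := {k | 1 ≤ r0 k}

/-- `r*_S(n)`: the number of `(a, b)` with `a ≥ 0`, `b ∈ S`, `a ^ 2 + b ^ 2 = n`
and `gcd(a, b) = 1`. -/
noncomputable def rStar (S : Set ℕ) (n : ℕ) : ℕ :=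
  {q ∈ repPairs S n | Nat.gcd q.1 q.2 = 1}.ncard

/-- `ω*(n)`: the number of distinct odd prime factors of `n`. -/
def omegaStar (n : ℕ) : ℕ := {p ∈ n.primeFactors | Odd p}.card

/-! Write r(m) for the number of primitive Gaussian integers of norm m (`primitiveOfNorm`), so that
r*(n) ≤ r(n). If r(n) > 0, then the odd primes dividing n are 1 mod 4 and 4 does not divide n. If
moreover n > √x has only k ≤ CL odd prime factors, then some exact prime power q of n is at least
x^(1/L²). Write n = mq. Every representation a + bi of n is wα or w̄α, with w a fixed Gaussian
integer of norm q and α primitive of norm m, so the sets of ℓ representations are encoded by at most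
(2r(m))^ℓ tuples (`choose_rStar_le`).

Fix m and the tuple, and put X = x/m; then log X agrees with log x up to powers of L. With w = u +
iv, the numbers b_j are linear forms in (u, v), pairwise non-proportional because the
representations are distinct. On a line v = const, primality of q = u² + v² excludes two classes of
u modulo a prime p ≡ 1 mod 4. That b_j is a sum of two squares excludes, apart from the u with p² ∣
b_j, the root of each form modulo p ≡ 3 mod 4. At most one form is constant along the line and has
to be dropped. Brun's pure sieve, with Mertens' theorem modulo 4 for the densities, bounds the
number of prime q by X (log X)^(-(ℓ+1)/2) up to powers of L (`exists_sieve_bound`). Proper prime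
powers q number only O(√X).

Summing over m leaves the sum of r(m)^ℓ / m over ω*(m) = k - 1. Each prime power at most doubles r,
and the reciprocals of the powers of primes 1 mod 4 sum to L/2 + O(1), so this sum is about (2^(ℓ-1)
L)^(k-1) / (k-1)! (`normSum_le`). The O(1) and the shift from k - 1 to k cost powers of L. The n ≤
√x are bounded trivially by the same kind of sum. -/

/-! ### Partial summation and the character modulo 4 -/

open Finset in
/-- Abel's inequality. -/
theorem abel_sum_mem_Icc {e f : ℕ → ℝ} {m : ℕ} {a b : ℝ}
    (hE : ∀ n, m ≤ n → a ≤ ∑ i ∈ Ico m n, e i ∧ ∑ i ∈ Ico m n, e i ≤ b)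
    (hf : ∀ n, m ≤ n → f (n + 1) ≤ f n) (hf0 : ∀ n, m ≤ n → 0 ≤ f n) {n : ℕ} (hn : m ≤ n) :
    a * f m ≤ ∑ i ∈ Ico m n, e i * f i ∧ ∑ i ∈ Ico m n, e i * f i ≤ b * f m := by
  -- The induction needs the boundary term of the partial summation split off.
  have key : ∀ n, m ≤ n →
      a * (f m - f n) ≤ ∑ i ∈ Ico m n, e i * f i - (∑ i ∈ Ico m n, e i) * f n ∧
      ∑ i ∈ Ico m n, e i * f i - (∑ i ∈ Ico m n, e i) * f n ≤ b * (f m - f n) := by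
    intro n hn
    induction n, hn using Nat.le_induction with
    | base => simp
    | succ n hn ih =>
      have h1 := hE (n + 1) (by omega)
      have h2 := hf n hn
      rw [sum_Ico_succ_top hn] at h1 ⊢
      rw [sum_Ico_succ_top hn]
      constructor <;> nlinarith
  have h1 := key n hn
  have h2 := hE n hn
  have h3 := hf0 n hn
  constructor <;> nlinarith

open Finset in
theorem abel_sum_abs_le {e f : ℕ → ℝ} {m : ℕ} {b : ℝ}
    (hE : ∀ n, m ≤ n → |∑ i ∈ Ico m n, e i| ≤ b)
    (hf : ∀ n, m ≤ n → f (n + 1) ≤ f n) (hf0 : ∀ n, m ≤ n → 0 ≤ f n) {n : ℕ} (hn : m ≤ n) :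
    |∑ i ∈ Ico m n, e i * f i| ≤ b * f m := by
  have := abel_sum_mem_Icc (a := -b) (b := b) (fun n hn => abs_le.1 (hE n hn)) hf hf0 hn
  rw [abs_le]
  constructor <;> linarith

/-- The nontrivial character modulo `4`, with real values. -/
noncomputable def chi (n : ℕ) : ℝ := ((ZMod.χ₄ (n : ZMod 4) : ℤ) : ℝ)

theorem chi_mul (m n : ℕ) : chi (m * n) = chi m * chi n := by
  simp only [chi, Nat.cast_mul, map_mul, Int.cast_mul]

theorem chi_eq (n : ℕ) : chi n = if n % 2 = 0 then 0 else if n % 4 = 1 then 1 else -1 := by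
  rw [chi, ZMod.χ₄_nat_eq_if_mod_four]
  split_ifs <;> simp

theorem abs_chi_le_one (n : ℕ) : |chi n| ≤ 1 := by
  rw [chi_eq]; split_ifs <;> simp

open Finset in
theorem sum_range_chi (n : ℕ) :
    ∑ i ∈ range n, chi i = if n % 4 = 2 ∨ n % 4 = 3 then 1 else 0 := by
  induction n with
  | zero => simp
  | succ n ih =>
    rw [sum_range_succ, ih, chi_eq]
    have h4 : n % 4 < 4 := Nat.mod_lt _ (by norm_num)
    have : n % 2 = (n % 4) % 2 := by omega
    have h5 : (n + 1) % 4 = (n % 4 + 1) % 4 := by omega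
    rw [this, h5]
    generalize n % 4 = r at h4 ⊢
    interval_cases r <;> norm_num

open Finset in
theorem sum_Ico_chi_abs_le (m n : ℕ) (hmn : m ≤ n) : |∑ i ∈ Ico m n, chi i| ≤ 1 := by
  rw [sum_Ico_eq_sub _ hmn, sum_range_chi, sum_range_chi]
  split_ifs <;> norm_num

open Finset in
/-- The partial sums of the series of `L(1, χ₄)`. -/
theorem sum_chi_div_sub_abs_le {M N : ℕ} (hMN : M ≤ N) :
    |∑ n ∈ Ioc 0 N, chi n / n - ∑ n ∈ Ioc 0 M, chi n / n| ≤ 1 / (M + 1) := by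
  have h : ∑ n ∈ Ioc 0 N, chi n / n - ∑ n ∈ Ioc 0 M, chi n / n
      = ∑ n ∈ Ico (M + 1) (N + 1), chi n * (1 / (n : ℝ)) := by
    rw [← sum_Ioc_consecutive _ (Nat.zero_le M) hMN, add_sub_cancel_left]
    exact sum_congr (by ext; simp) fun n _ => by ring
  rw [h]
  have := abel_sum_abs_le (e := chi) (f := fun n : ℕ => 1 / (n : ℝ)) (m := M + 1) (b := 1)
    (fun n hn => sum_Ico_chi_abs_le _ _ hn) (fun n hn => ?_) (fun n _ => by positivity)
    (n := N + 1) (by omega)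
  · simpa using this
  · have : (0 : ℝ) < n := by exact_mod_cast (by omega : 0 < n)
    push_cast
    gcongr
    linarith

-- The terms up to 4 give 1 - 1/3, and from 5 ≡ 1 mod 4 onwards the partial sums of `chi` are 0 or
-- 1, so the tail is nonnegative. This elementary lower bound for L(1, χ₄) is what later permits
-- division by it.
open Finset in
theorem sum_chi_div_ge {N : ℕ} (hN : 4 ≤ N) : 2 / 3 ≤ ∑ n ∈ Ioc 0 N, chi n / n := by
  have h : ∑ n ∈ Ioc 0 N, chi n / n
      = 2 / 3 + ∑ n ∈ Ico 5 (N + 1), chi n * (1 / (n : ℝ)) := by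
    rw [← sum_Ioc_consecutive _ (Nat.zero_le 4) hN]
    congr 1
    · simp only [chi_eq]
      rw [show Ioc 0 4 = {1, 2, 3, 4} by rfl]
      norm_num
    · exact sum_congr (by ext; simp; omega) fun n _ => by ring
  rw [h]
  have := abel_sum_mem_Icc (e := chi) (f := fun n : ℕ => 1 / (n : ℝ)) (m := 5) (a := 0) (b := 1)
    (fun n hn => ?_) (fun n hn => ?_) (fun n _ => by positivity)
    (n := N + 1) (by omega)
  · linarith [this.1]
  · rw [sum_Ico_eq_sub _ hn, sum_range_chi, sum_range_chi]
    split_ifs <;> simp_all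
  · have : (0 : ℝ) < n := by exact_mod_cast (by omega : 0 < n)
    push_cast
    gcongr
    linarith

/-! ### Mertens' theorems in the residue classes modulo 4 -/

open ArithmeticFunction Finset in
theorem sum_vonMangoldt_le (N : ℕ) : ∑ n ∈ Ioc 0 N, vonMangoldt n ≤ 6 * N := by
  have h := Chebyshev.psi_le_const_mul_self (x := N) (by positivity)
  rw [Chebyshev.psi, Nat.floor_natCast] at h
  have h4 : Real.log 4 ≤ 2 := by
    rw [show (4 : ℝ) = 2 ^ 2 by norm_num, Real.log_pow]
    have := Real.log_two_lt_d9
    push_cast; linarith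
  nlinarith [Nat.cast_nonneg (α := ℝ) N]

open Finset in
theorem sum_log_le (N : ℕ) : ∑ n ∈ Ioc 0 N, Real.log n ≤ N * Real.log N := by
  calc ∑ n ∈ Ioc 0 N, Real.log n ≤ ∑ n ∈ Ioc 0 N, Real.log N := by
        refine sum_le_sum fun n hn => ?_
        rw [mem_Ioc] at hn
        have : (0 : ℝ) < n := by exact_mod_cast hn.1
        exact Real.log_le_log this (by exact_mod_cast hn.2)
    _ = _ := by simp

open Finset in
theorem le_sum_log (N : ℕ) : N * Real.log N - N ≤ ∑ n ∈ Ioc 0 N, Real.log n := by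
  induction N with
  | zero => simp
  | succ N ih =>
    rw [sum_Ioc_succ_top (Nat.zero_le N)]
    rcases Nat.eq_zero_or_pos N with rfl | hN
    · simp
    have hN0 : (0 : ℝ) < N := by exact_mod_cast hN
    have h1 : Real.log ((N + 1 : ℕ) : ℝ) - Real.log N ≤ 1 / N := by
      push_cast
      rw [← Real.log_div (by positivity) (by positivity)]
      have := Real.log_le_sub_one_of_pos (x := ((N : ℝ) + 1) / N) (by positivity)
      have h : ((N : ℝ) + 1) / N - 1 = 1 / N := by field_simp; ring
      linarith
    have h2 : N * (Real.log ((N + 1 : ℕ) : ℝ) - Real.log N) ≤ 1 := by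
      calc _ ≤ N * (1 / (N : ℝ)) := mul_le_mul_of_nonneg_left h1 hN0.le
        _ = 1 := by field_simp
    push_cast at h2 ⊢
    nlinarith

open ArithmeticFunction Finset in
/-- Mertens' first theorem for `Λ`. -/
theorem sum_vonMangoldt_div_sub_log_abs_le {N : ℕ} (hN : 1 ≤ N) :
    |∑ n ∈ Ioc 0 N, vonMangoldt n / n - Real.log N| ≤ 6 := by
  -- The sum log N! in two ways: replacing ⌊N/n⌋ by N/n costs at most ψ(N) ≤ 6N.
  have h1 : ∑ n ∈ Ioc 0 N, Real.log n = ∑ n ∈ Ioc 0 N, vonMangoldt n * ((N / n : ℕ) : ℝ) := by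
    rw [← sum_Ioc_mul_zeta_eq_sum, vonMangoldt_mul_zeta]
    rfl
  have hN0 : (0 : ℝ) < N := by exact_mod_cast hN
  have h2 : ∑ n ∈ Ioc 0 N, vonMangoldt n * ((N / n : ℕ) : ℝ) ≤
      N * ∑ n ∈ Ioc 0 N, vonMangoldt n / n := by
    rw [mul_sum]
    refine sum_le_sum fun n _ => ?_
    calc vonMangoldt n * ((N / n : ℕ) : ℝ) ≤ vonMangoldt n * ((N : ℝ) / n) :=
          mul_le_mul_of_nonneg_left Nat.cast_div_le vonMangoldt_nonneg
      _ = _ := by ring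
  have h3 : N * ∑ n ∈ Ioc 0 N, vonMangoldt n / n - ∑ n ∈ Ioc 0 N, vonMangoldt n ≤
      ∑ n ∈ Ioc 0 N, vonMangoldt n * ((N / n : ℕ) : ℝ) := by
    rw [mul_sum, ← sum_sub_distrib]
    refine sum_le_sum fun n hn => ?_
    rw [mem_Ioc] at hn
    have hn0 : (0 : ℝ) < n := by exact_mod_cast hn.1
    have h : (N : ℝ) / n - 1 ≤ ((N / n : ℕ) : ℝ) := by
      rw [sub_le_iff_le_add, div_le_iff₀ hn0]
      have := Nat.lt_mul_div_succ N hn.1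
      have h' : (N : ℝ) < n * ((N / n : ℕ) + 1) := by exact_mod_cast this
      linarith
    calc _ = vonMangoldt n * ((N : ℝ) / n - 1) := by ring
      _ ≤ _ := mul_le_mul_of_nonneg_left h vonMangoldt_nonneg
  have h4 := sum_vonMangoldt_le N
  have h5 := sum_log_le N
  have h6 := le_sum_log N
  rw [abs_le]
  constructor
  · have : N * (Real.log N - 6) ≤ N * ∑ n ∈ Ioc 0 N, vonMangoldt n / n := by linarith
    have := le_of_mul_le_mul_left this hN0
    linarith
  · have : N * ∑ n ∈ Ioc 0 N, vonMangoldt n / n ≤ N * (Real.log N + 6) := by linarith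
    have := le_of_mul_le_mul_left this hN0
    linarith

-- log n / n decreases only from e onwards, so Abel's inequality starts at 3; the terms at 1 and 2
-- vanish because log 1 = 0 and χ(2) = 0.
open Finset in
theorem sum_chi_mul_log_div_abs_le (N : ℕ) : |∑ n ∈ Ioc 0 N, chi n * (Real.log n / n)| ≤ 2 := by
  rcases lt_or_ge N 3 with hN | hN
  · interval_cases N
    · simp
    · simp
    · rw [show Ioc 0 2 = {1, 2} by rfl]
      simp [chi_eq]
  have h : ∑ n ∈ Ioc 0 N, chi n * (Real.log n / n)
      = ∑ n ∈ Ico 3 (N + 1), chi n * (Real.log n / n) := by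
    rw [← sum_Ioc_consecutive _ (Nat.zero_le 2) (by omega : 2 ≤ N),
      show Ioc 0 2 = {1, 2} by rfl]
    simp only [chi_eq, sum_pair (by norm_num : (1 : ℕ) ≠ 2)]
    norm_num
    exact sum_congr (by ext; simp; omega) fun n _ => rfl
  have he : Real.exp 1 ≤ 3 := by linarith [Real.exp_one_lt_d9]
  rw [h]
  refine (abel_sum_abs_le (e := chi) (f := fun n : ℕ => Real.log n / n) (m := 3) (b := 1)
    (fun n hn => sum_Ico_chi_abs_le _ _ hn) (fun n hn => ?_) (fun n _ => ?_)
    (n := N + 1) (by omega)).trans ?_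
  · have hn' : (3 : ℝ) ≤ n := by exact_mod_cast hn
    exact Real.log_div_self_antitoneOn (he.trans hn') (by push_cast; simp; linarith)
      (by push_cast; linarith)
  · positivity
  · have := Real.log_le_sub_one_of_pos (x := 3) (by norm_num)
    push_cast
    linarith

/-- `n ↦ chi n / n` as an arithmetic function. -/
noncomputable def chiDiv : ArithmeticFunction ℝ := ⟨fun n => chi n / n, by simp⟩

/-- `n ↦ Λ n * chi n / n` as an arithmetic function. -/
noncomputable def vonMangoldtChiDiv : ArithmeticFunction ℝ :=
  ⟨fun n => ArithmeticFunction.vonMangoldt n * (chi n / n), by simp⟩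

-- The identity Λ * 1 = log, twisted by the completely multiplicative function χ(n)/n.
open ArithmeticFunction Finset in
theorem vonMangoldtChiDiv_mul_chiDiv (n : ℕ) :
    (vonMangoldtChiDiv * chiDiv) n = chi n * (Real.log n / n) := by
  rw [mul_apply, ← vonMangoldt_sum, sum_div, mul_sum,
    ← Nat.sum_divisorsAntidiagonal (fun i _ => chi n * (vonMangoldt i / (n : ℝ)))]
  refine sum_congr rfl fun x hx => ?_
  have h := (Nat.mem_divisorsAntidiagonal.1 hx).1
  simp only [vonMangoldtChiDiv, chiDiv, coe_mk]
  rw [← h, chi_mul]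
  push_cast
  simp only [div_eq_mul_inv, mul_inv]
  ring

-- In the convolution identity the inner sums of χ(m)/m stop at N/n. Extending them all to N changes
-- the total by at most ψ(N)/N ≤ 6. So the sum times H is at most 6 + 2 in absolute value, and H ≥
-- 2/3 gives 12.
open ArithmeticFunction Finset in
theorem sum_vonMangoldt_chi_div_abs_le {N : ℕ} (hN : 4 ≤ N) :
    |∑ n ∈ Ioc 0 N, vonMangoldt n * (chi n / n)| ≤ 12 := by
  have hN0 : (0 : ℝ) < N := by exact_mod_cast (by omega : 0 < N)
  have h1 : ∑ n ∈ Ioc 0 N, chi n * (Real.log n / n) =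
      ∑ n ∈ Ioc 0 N, vonMangoldt n * (chi n / n) * ∑ m ∈ Ioc 0 (N / n), chi m / m := by
    rw [← sum_congr rfl fun n _ => vonMangoldtChiDiv_mul_chiDiv n, sum_Ioc_mul_eq_sum_sum]
    rfl
  set H := ∑ n ∈ Ioc 0 N, chi n / n with hH
  have h2 : |H * ∑ n ∈ Ioc 0 N, vonMangoldt n * (chi n / n)
      - ∑ n ∈ Ioc 0 N, chi n * (Real.log n / n)| ≤ 6 := by
    rw [h1, mul_sum, ← sum_sub_distrib]
    calc |∑ n ∈ Ioc 0 N, (H * (vonMangoldt n * (chi n / n)) -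
          vonMangoldt n * (chi n / n) * ∑ m ∈ Ioc 0 (N / n), chi m / m)|
        ≤ ∑ n ∈ Ioc 0 N, vonMangoldt n * (1 / N) := by
          refine (abs_sum_le_sum_abs _ _).trans (sum_le_sum fun n hn => ?_)
          rw [mem_Ioc] at hn
          have hn0 : (0 : ℝ) < n := by exact_mod_cast hn.1
          rw [show H * (vonMangoldt n * (chi n / n)) -
            vonMangoldt n * (chi n / n) * ∑ m ∈ Ioc 0 (N / n), chi m / m =
            vonMangoldt n * ((chi n / n) * (H - ∑ m ∈ Ioc 0 (N / n), chi m / m)) by ring,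
            abs_mul, abs_of_nonneg vonMangoldt_nonneg, abs_mul, abs_div, Nat.abs_cast]
          refine mul_le_mul_of_nonneg_left ?_ vonMangoldt_nonneg
          have h3 := sum_chi_div_sub_abs_le (Nat.div_le_self N n)
          have h4 : (N : ℝ) ≤ n * ((N / n : ℕ) + 1) := by
            exact_mod_cast (Nat.lt_mul_div_succ N hn.1).le
          calc |chi n| / n * |H - ∑ m ∈ Ioc 0 (N / n), chi m / m|
              ≤ 1 / n * (1 / ((N / n : ℕ) + 1)) := by
                gcongr
                exact abs_chi_le_one n
            _ = 1 / (n * ((N / n : ℕ) + 1)) := by rw [one_div_mul_one_div]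
            _ ≤ 1 / N := one_div_le_one_div_of_le hN0 h4
      _ ≤ 6 * N * (1 / N) := by
          rw [← sum_mul]
          gcongr
          exact sum_vonMangoldt_le N
      _ = 6 := by field_simp
  have h3 := sum_chi_mul_log_div_abs_le N
  have h4 := sum_chi_div_ge hN
  have h5 : |H * ∑ n ∈ Ioc 0 N, vonMangoldt n * (chi n / n)| ≤ 8 := by
    rw [abs_le] at h2 h3 ⊢
    constructor <;> linarith [h2.1, h2.2, h3.1, h3.2]
  rw [abs_mul, abs_of_nonneg (by linarith)] at h5
  nlinarith [abs_nonneg (∑ n ∈ Ioc 0 N, vonMangoldt n * (chi n / n))]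

open ArithmeticFunction Finset in
theorem exists_sum_vonMangoldt_not_prime_div_le :
    ∃ c : ℝ, 0 ≤ c ∧ ∀ N : ℕ, ∑ n ∈ Ioc 0 N with ¬ n.Prime, vonMangoldt n / n ≤ c := by
  obtain ⟨C, hC⟩ := Chebyshev.psi_sub_theta_le_mul_sqrt
  have hC' : ∀ N : ℕ, ∑ n ∈ Ioc 0 N with ¬ n.Prime, vonMangoldt n ≤ C * √N := by
    intro N
    have := hC N
    rwa [Chebyshev.psi_sub_theta_eq_sum_not_prime, Nat.floor_natCast] at this
  have hC0 : 0 ≤ C := by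
    have := hC' 1
    rw [show {n ∈ Ioc 0 1 | ¬ n.Prime} = {1} by rfl] at this
    simpa using this
  refine ⟨3 * C, by positivity, fun N => ?_⟩
  -- Partial summation in inductive form. With D(N) = ψ(N) - θ(N) ≤ C√N, the loss D(N)(1/N -
  -- 1/(N+1)) is paid for by the growth of -2C/√N.
  have key : ∀ N : ℕ, 1 ≤ N → ∑ n ∈ Ioc 0 N with ¬ n.Prime, vonMangoldt n / n ≤
      (∑ n ∈ Ioc 0 N with ¬ n.Prime, vonMangoldt n) / N + (2 * C - 2 * C / √N) := by
    intro N hN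
    induction N, hN using Nat.le_induction with
    | base =>
      rw [show {n ∈ Ioc 0 1 | ¬ n.Prime} = {1} by rfl]
      simp
    | succ N hN ih =>
      have hN0 : (0 : ℝ) < N := by exact_mod_cast hN
      have h1 := hC' N
      rw [sum_filter, sum_Ioc_succ_top (Nat.zero_le N), sum_filter,
        sum_Ioc_succ_top (Nat.zero_le N)]
      rw [sum_filter] at ih h1
      rw [sum_filter] at ih
      set D := ∑ n ∈ Ioc 0 N, if ¬ n.Prime then vonMangoldt n else 0 with hD
      have h2 : D / N ≤ D / (N + 1 : ℕ) + (2 * C / √N - 2 * C / √(N + 1 : ℕ)) := by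
        push_cast
        have hs : 0 < √(N : ℝ) := Real.sqrt_pos.2 hN0
        have ht : 0 < √((N : ℝ) + 1) := Real.sqrt_pos.2 (by positivity)
        have hs2 : √(N : ℝ) ^ 2 = N := Real.sq_sqrt hN0.le
        have ht2 : √((N : ℝ) + 1) ^ 2 = N + 1 := Real.sq_sqrt (by positivity)
        have hst : √(N : ℝ) ≤ √((N : ℝ) + 1) := Real.sqrt_le_sqrt (by linarith)
        generalize √(N : ℝ) = s at *
        generalize √((N : ℝ) + 1) = t at *
        have e1 : D / (N : ℝ) - D / ((N : ℝ) + 1) = D * (1 / (s ^ 2 * t ^ 2)) := by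
          rw [hs2, ht2]; field_simp; ring
        have e2 : 2 * C / s - 2 * C / t = C * s * (2 * (t - s) * (s + t) * (t / ((s + t)))
            * (1 / (s ^ 2 * t ^ 2))) := by
          field_simp
        have e3 : 2 * (t - s) * (s + t) * (t / (s + t)) ≥ 1 := by
          have : (t - s) * (s + t) = 1 := by nlinarith
          rw [mul_assoc 2, this, mul_one, ← mul_div_assoc, ge_iff_le, le_div_iff₀ (by positivity)]
          linarith
        have e4 : D * (1 / (s ^ 2 * t ^ 2)) ≤ C * s * (1 / (s ^ 2 * t ^ 2)) := by gcongr
        have e5 : C * s * (1 / (s ^ 2 * t ^ 2)) ≤ C * s * (2 * (t - s) * (s + t) * (t / ((s + t)))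
            * (1 / (s ^ 2 * t ^ 2))) := by
          gcongr
          exact le_mul_of_one_le_left (by positivity) e3
        linarith
      rw [add_div]
      split_ifs <;> simp <;> simp at ih h2 <;> linarith
  rcases Nat.eq_zero_or_pos N with rfl | hN
  · simpa using hC0
  have hN0 : (0 : ℝ) < N := by exact_mod_cast hN
  refine (key N hN).trans ?_
  have h1 : (∑ n ∈ Ioc 0 N with ¬ n.Prime, vonMangoldt n) / N ≤ C := by
    rw [div_le_iff₀ hN0]
    refine (hC' N).trans (mul_le_mul_of_nonneg_left ?_ hC0)
    rw [Real.sqrt_le_left hN0.le]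
    have : (1 : ℝ) ≤ N := by exact_mod_cast hN
    nlinarith
  have : 0 ≤ 2 * C / √N := by positivity
  linarith

-- A Riemann sum of dy/y with y = log n. The increments of y are at most 1, so the errors telescope
-- to 1/log 4 - 1/log N.
open Finset in
theorem sum_log_sub_div_log_abs_le {N : ℕ} (hN : 4 ≤ N) :
    |∑ n ∈ Ico 5 (N + 1), (Real.log n - Real.log (n - 1 : ℕ)) * (1 / Real.log n)
      - (Real.log (Real.log N) - Real.log (Real.log 4))| ≤ 1 / Real.log 4 := by
  have key : 0 ≤ (Real.log (Real.log N) - Real.log (Real.log 4)) -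
        ∑ n ∈ Ico 5 (N + 1), (Real.log n - Real.log (n - 1 : ℕ)) * (1 / Real.log n) ∧
      (Real.log (Real.log N) - Real.log (Real.log 4)) -
        ∑ n ∈ Ico 5 (N + 1), (Real.log n - Real.log (n - 1 : ℕ)) * (1 / Real.log n) ≤
      1 / Real.log 4 - 1 / Real.log N := by
    induction N, hN using Nat.le_induction with
    | base => simp
    | succ N hN ih =>
      rw [sum_Ico_succ_top (by omega)]
      have hN0 : (4 : ℝ) ≤ N := by exact_mod_cast hN
      have hl : 0 < Real.log N := Real.log_pos (by linarith)
      have hl' : Real.log N ≤ Real.log (N + 1 : ℕ) :=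
        Real.log_le_log (by linarith) (by push_cast; linarith)
      have h1 : Real.log (N + 1 : ℕ) - Real.log N ≤ 1 := by
        push_cast
        rw [← Real.log_div (by positivity) (by positivity)]
        have := Real.log_le_sub_one_of_pos (x := ((N : ℝ) + 1) / N) (by positivity)
        have h : ((N : ℝ) + 1) / N - 1 = 1 / N := by field_simp; ring
        have h' : 1 / (N : ℝ) ≤ 1 := by
          rw [div_le_one (by positivity)]; linarith
        linarith
      simp only [Nat.add_sub_cancel]
      generalize Real.log (N + 1 : ℕ) = b at *
      generalize Real.log N = a at *
      have hb : 0 < b := hl.trans_le hl'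
      have h2 : (b - a) * (1 / b) ≤ Real.log b - Real.log a := by
        have := Real.log_le_sub_one_of_pos (x := a / b) (by positivity)
        rw [Real.log_div hl.ne' hb.ne'] at this
        have h : (b - a) * (1 / b) = 1 - a / b := by field_simp
        linarith
      have h3 : Real.log b - Real.log a ≤ (b - a) * (1 / a) := by
        have := Real.log_le_sub_one_of_pos (x := b / a) (by positivity)
        rw [Real.log_div hb.ne' hl.ne'] at this
        have h : (b - a) * (1 / a) = b / a - 1 := by field_simp
        linarith
      have h4 : (b - a) * (1 / a - 1 / b) ≤ 1 * (1 / a - 1 / b) :=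
        mul_le_mul_of_nonneg_right h1 (sub_nonneg.2 (one_div_le_one_div_of_le hl hl'))
      constructor <;> linarith [ih.1, ih.2]
  have h4 : 0 ≤ 1 / Real.log N := by positivity
  have h5 : 0 ≤ 1 / Real.log 4 := by positivity
  rw [abs_le]
  constructor <;> linarith [key.1, key.2]

open Finset in
/-- Partial summation from Mertens' first theorem to Mertens' second theorem. -/
theorem exists_sum_div_log_abs_le {a : ℕ → ℝ} {κ c : ℝ} (hκ : 0 ≤ κ)
    (h : ∀ n : ℕ, 4 ≤ n → |∑ i ∈ Ioc 0 n, a i - κ * Real.log n| ≤ c) :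
    ∃ c' : ℝ, ∀ N : ℕ, 4 ≤ N →
      |∑ n ∈ Ico 5 (N + 1), a n * (1 / Real.log n) - κ * Real.log (Real.log N)| ≤ c' := by
  refine ⟨2 * c * (1 / Real.log 5) + κ * (1 / Real.log 4) + κ * |Real.log (Real.log 4)|,
    fun N hN => ?_⟩
  -- The increments of log telescope, so these partial sums are a difference of two values of the
  -- error in the hypothesis.
  have hE : ∀ n : ℕ, 5 ≤ n →
      |∑ i ∈ Ico 5 n, (a i - κ * (Real.log i - Real.log (i - 1 : ℕ)))| ≤ 2 * c := by
    intro n hn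
    obtain ⟨m, rfl⟩ : ∃ m, n = m + 1 := ⟨n - 1, by omega⟩
    have e1 : ∀ m : ℕ, 4 ≤ m →
        ∑ i ∈ Ico 5 (m + 1), (a i - κ * (Real.log i - Real.log (i - 1 : ℕ))) =
        (∑ i ∈ Ioc 0 m, a i - κ * Real.log m) - (∑ i ∈ Ioc 0 4, a i - κ * Real.log (4 : ℕ)) := by
      intro m hm
      induction m, hm using Nat.le_induction with
      | base => simp
      | succ m hm ih =>
        rw [sum_Ico_succ_top (by omega), ih, sum_Ioc_succ_top (Nat.zero_le m)]
        simp only [Nat.add_sub_cancel]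
        ring
    rw [e1 m (by omega)]
    have h1 := abs_le.1 (h m (by omega))
    have h2 := abs_le.1 (h 4 le_rfl)
    rw [abs_le]
    constructor <;> linarith [h1.1, h1.2, h2.1, h2.2]
  have h1 := abel_sum_abs_le (f := fun n : ℕ => 1 / Real.log n) hE (fun n hn => by
      have : (5 : ℝ) ≤ n := by exact_mod_cast hn
      exact one_div_le_one_div_of_le (Real.log_pos (by linarith))
        (Real.log_le_log (by linarith) (by push_cast; linarith)))
    (fun n _ => by positivity) (n := N + 1) (by omega)
  have h2 := sum_log_sub_div_log_abs_le hN
  have e2 : ∑ i ∈ Ico 5 (N + 1), (a i - κ * (Real.log i - Real.log (i - 1 : ℕ))) *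
      (1 / Real.log i) = ∑ n ∈ Ico 5 (N + 1), a n * (1 / Real.log n) - κ *
      ∑ n ∈ Ico 5 (N + 1), (Real.log n - Real.log (n - 1 : ℕ)) * (1 / Real.log n) := by
    rw [mul_sum, ← sum_sub_distrib]
    exact sum_congr rfl fun _ _ => by ring
  rw [e2] at h1
  set T := ∑ n ∈ Ico 5 (N + 1), (Real.log n - Real.log (n - 1 : ℕ)) * (1 / Real.log n)
  have h3 : |κ * (T - (Real.log (Real.log N) - Real.log (Real.log 4)))| ≤
      κ * (1 / Real.log 4) := by
    rw [abs_mul, abs_of_nonneg hκ]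
    exact mul_le_mul_of_nonneg_left h2 hκ
  have h4 : |κ * Real.log (Real.log 4)| ≤ κ * |Real.log (Real.log 4)| := by
    rw [abs_mul, abs_of_nonneg hκ]
  push_cast at h1
  rw [abs_le] at *
  constructor <;> linarith [h1.1, h1.2, h3.1, h3.2, h4.1, h4.2]

-- Orthogonality of characters: on primes the indicator of the class b is (1 ± χ)/2, corrected at 2.
-- The main term comes from Λ(n)/n, the twisted sum is bounded, and proper prime powers contribute
-- O(1).
open ArithmeticFunction Finset in
theorem exists_sum_log_div_prime_mod_four_abs_le {b : ℕ} (hb : b = 1 ∨ b = 3) :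
    ∃ c : ℝ, ∀ N : ℕ, 4 ≤ N →
      |∑ n ∈ Ioc 0 N, (if n.Prime ∧ n % 4 = b then Real.log n / n else 0)
        - 1 / 2 * Real.log N| ≤ c := by
  obtain ⟨c, hc0, hc⟩ := exists_sum_vonMangoldt_not_prime_div_le
  obtain ⟨s, hs, hsb⟩ : ∃ s : ℝ, |s| = 1 ∧ ∀ n : ℕ, n.Prime →
      2 * (if n % 4 = b then (1 : ℝ) else 0) = 1 + s * chi n - if n = 2 then 1 else 0 := by
    have h2 : ∀ n : ℕ, n.Prime → n = 2 ∨ (n ≠ 2 ∧ n % 2 = 1 ∧ (n % 4 = 1 ∨ n % 4 = 3)) := by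
      intro n hn
      rcases hn.eq_two_or_odd with h | h
      · exact Or.inl h
      · exact Or.inr ⟨by rintro rfl; simp at h, h, by omega⟩
    rcases hb with rfl | rfl
    · refine ⟨1, by simp, fun n hn => ?_⟩
      rcases h2 n hn with rfl | ⟨h1, h2, h3 | h3⟩ <;> (simp [chi_eq, *]; try norm_num)
    · refine ⟨-1, by simp, fun n hn => ?_⟩
      rcases h2 n hn with rfl | ⟨h1, h2, h3 | h3⟩ <;> (simp [chi_eq, *]; try norm_num)
  refine ⟨6 + 12 + 2 * c + 1, fun N hN => ?_⟩
  have h1 := sum_vonMangoldt_div_sub_log_abs_le (N := N) (by omega)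
  have h2 := sum_vonMangoldt_chi_div_abs_le hN
  have e1 : 2 * ∑ n ∈ Ioc 0 N, (if n.Prime ∧ n % 4 = b then Real.log n / n else 0) =
      ∑ n ∈ Ioc 0 N, vonMangoldt n / n + s * ∑ n ∈ Ioc 0 N, vonMangoldt n * (chi n / n)
      - ∑ n ∈ Ioc 0 N with ¬ n.Prime, (vonMangoldt n / n + s * (vonMangoldt n * (chi n / n)))
      - ∑ n ∈ Ioc 0 N, if n = 2 then Real.log 2 / 2 else 0 := by
    rw [sum_filter, mul_sum, mul_sum, ← sum_add_distrib, ← sum_sub_distrib, ← sum_sub_distrib]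
    refine sum_congr rfl fun n _ => ?_
    by_cases hn : n.Prime
    · have := hsb n hn
      rw [vonMangoldt_apply_prime hn]
      calc 2 * (if n.Prime ∧ n % 4 = b then Real.log n / n else 0)
          = 2 * (if n % 4 = b then (1 : ℝ) else 0) * (Real.log n / n) := by simp [hn]
        _ = (1 + s * chi n - if n = 2 then 1 else 0) * (Real.log n / n) := by rw [this]
        _ = _ := by
          by_cases h2 : n = 2
          · subst h2; simp [hn]; ring
          · simp [hn, h2]; ring
    · have : n ≠ 2 := by rintro rfl; exact hn Nat.prime_two
      simp [hn, this]
  have h3 : |∑ n ∈ Ioc 0 N with ¬ n.Prime,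
      (vonMangoldt n / n + s * (vonMangoldt n * (chi n / n)))| ≤ 2 * c := by
    calc _ ≤ ∑ n ∈ Ioc 0 N with ¬ n.Prime, 2 * (vonMangoldt n / n) := by
          refine (abs_sum_le_sum_abs _ _).trans (sum_le_sum fun n _ => ?_)
          rw [show vonMangoldt n / n + s * (vonMangoldt n * (chi n / n)) =
            (vonMangoldt n / n) * (1 + s * chi n) by ring, abs_mul,
            abs_of_nonneg (div_nonneg vonMangoldt_nonneg (Nat.cast_nonneg n)), mul_comm]
          refine mul_le_mul_of_nonneg_right ?_ (div_nonneg vonMangoldt_nonneg (Nat.cast_nonneg n))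
          calc |1 + s * chi n| ≤ |1| + |s * chi n| := abs_add_le _ _
            _ ≤ 2 := by
              rw [abs_mul, hs, abs_one]; linarith [abs_chi_le_one n]
      _ ≤ 2 * c := by rw [← mul_sum]; linarith [hc N]
  have h4 : |∑ n ∈ Ioc 0 N, if n = 2 then Real.log 2 / 2 else 0| ≤ 1 := by
    rw [sum_ite_eq' (Ioc 0 N) 2 (fun _ => Real.log 2 / 2), if_pos (by simp; omega), abs_of_nonneg
      (by positivity)]
    have := Real.log_two_lt_d9
    linarith
  have h5 : |s * ∑ n ∈ Ioc 0 N, vonMangoldt n * (chi n / n)| ≤ 12 := by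
    rw [abs_mul, hs, one_mul]; exact h2
  rw [abs_le] at *
  constructor <;> linarith [h1.1, h1.2, h3.1, h3.2, h4.1, h4.2, h5.1, h5.2]

open Finset in
/-- Mertens' second theorem for the residue classes `1` and `3` modulo `4`. -/
theorem exists_sum_one_div_prime_mod_four_abs_le {b : ℕ} (hb : b = 1 ∨ b = 3) :
    ∃ c : ℝ, ∀ N : ℕ, 4 ≤ N →
      |∑ p ∈ Ioc 0 N with p.Prime ∧ p % 4 = b, 1 / (p : ℝ)
        - 1 / 2 * Real.log (Real.log N)| ≤ c := by
  obtain ⟨c, hc⟩ := exists_sum_log_div_prime_mod_four_abs_le hb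
  obtain ⟨c', hc'⟩ := exists_sum_div_log_abs_le (by norm_num) hc
  refine ⟨c' + |∑ p ∈ Ioc 0 4 with p.Prime ∧ p % 4 = b, 1 / (p : ℝ)|, fun N hN => ?_⟩
  have e : ∑ p ∈ Ioc 0 N with p.Prime ∧ p % 4 = b, 1 / (p : ℝ) =
      ∑ p ∈ Ioc 0 4 with p.Prime ∧ p % 4 = b, 1 / (p : ℝ) +
      ∑ n ∈ Ico 5 (N + 1), (if n.Prime ∧ n % 4 = b then Real.log n / n else 0) *
        (1 / Real.log n) := by
    rw [sum_filter, sum_filter, ← sum_Ioc_consecutive _ (Nat.zero_le 4) hN]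
    congr 1
    refine sum_congr (by ext; simp; omega) fun n hn => ?_
    rw [mem_Ico] at hn
    have : (5 : ℝ) ≤ n := by exact_mod_cast hn.1
    have h0 : Real.log n ≠ 0 := (Real.log_pos (by linarith)).ne'
    split_ifs
    · field_simp
    · simp
  rw [e, add_sub_assoc, add_comm]
  exact (abs_add_le _ _).trans (by linarith [hc' N hN])

-- Proper prime powers add only O(1), since Λ(q) ≥ log 2 > 1/2 gives 1/q ≤ 2Λ(q)/q.
open ArithmeticFunction Finset in
theorem exists_sum_one_div_primePow_le :
    ∃ c : ℝ, ∀ N : ℕ, 4 ≤ N →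
      ∑ q ∈ Ioc 0 N with IsPrimePow q ∧ q.minFac % 4 = 1, 1 / (q : ℝ) ≤
        1 / 2 * Real.log (Real.log N) + c := by
  obtain ⟨c, hc⟩ := exists_sum_one_div_prime_mod_four_abs_le (b := 1) (Or.inl rfl)
  obtain ⟨c', hc'0, hc'⟩ := exists_sum_vonMangoldt_not_prime_div_le
  refine ⟨c + 2 * c', fun N hN => ?_⟩
  have h1 : ∑ q ∈ Ioc 0 N with IsPrimePow q ∧ q.minFac % 4 = 1, 1 / (q : ℝ) ≤
      ∑ p ∈ Ioc 0 N with p.Prime ∧ p % 4 = 1, 1 / (p : ℝ) +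
      2 * ∑ n ∈ Ioc 0 N with ¬ n.Prime, vonMangoldt n / n := by
    rw [mul_sum, sum_filter, sum_filter, sum_filter, ← sum_add_distrib]
    refine sum_le_sum fun n _ => ?_
    by_cases hn : n.Prime
    · simp [hn, hn.isPrimePow]
    · by_cases hn' : IsPrimePow n
      · have h2 : (2 : ℝ) ≤ n.minFac := by
          exact_mod_cast (Nat.minFac_prime hn'.ne_one).two_le
        have h3 : Real.log 2 ≤ vonMangoldt n := by
          rw [vonMangoldt_apply, if_pos hn']
          exact Real.log_le_log (by norm_num) h2
        have h4 := Real.log_two_gt_d9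
        have h5 : 1 / (n : ℝ) ≤ 2 * (vonMangoldt n / n) := by
          rw [← mul_div_assoc]
          gcongr
          linarith
        have h6 : 0 ≤ 1 / (n : ℝ) := by positivity
        have h7 := div_nonneg (vonMangoldt_nonneg (n := n)) (Nat.cast_nonneg (α := ℝ) n)
        by_cases hm : n.minFac % 4 = 1
        · simp only [hn, hn', hm, and_self, false_and, not_false_eq_true, if_true, if_false]
          linarith
        · simp only [hn, hm, and_false, false_and, not_false_eq_true, if_true, if_false]
          linarith
      · have := div_nonneg (vonMangoldt_nonneg (n := n)) (Nat.cast_nonneg n)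
        simp [hn, hn']
        exact this
  have h2 := (abs_le.1 (hc N hN)).2
  have h3 := hc' N
  linarith

/-! ### Bonferroni's inequalities and Brun's pure sieve -/

open Finset in
/-- Elementary symmetric function of the values of `ρ` on `s`. -/
noncomputable def elemSymm {ι : Type*} (s : Finset ι) (ρ : ι → ℝ) (j : ℕ) : ℝ :=
  ∑ T ∈ s.powersetCard j, ∏ i ∈ T, ρ i

theorem elemSymm_zero {ι : Type*} (s : Finset ι) (ρ : ι → ℝ) : elemSymm s ρ 0 = 1 := by
  simp [elemSymm]

theorem elemSymm_empty_succ {ι : Type*} (ρ : ι → ℝ) (j : ℕ) : elemSymm ∅ ρ (j + 1) = 0 := by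
  rw [elemSymm, Finset.powersetCard_eq_empty.2 (by simp), Finset.sum_empty]

open Finset in
theorem elemSymm_insert {ι : Type*} [DecidableEq ι] {s : Finset ι} {a : ι} (ha : a ∉ s)
    (ρ : ι → ℝ) (j : ℕ) :
    elemSymm (insert a s) ρ (j + 1) = elemSymm s ρ (j + 1) + ρ a * elemSymm s ρ j := by
  have hT : ∀ T ∈ powersetCard j s, a ∉ T := fun T hT h => ha ((mem_powersetCard.1 hT).1 h)
  rw [elemSymm, powersetCard_succ_insert ha, sum_union, sum_image, elemSymm, elemSymm, mul_sum]
  · congr 1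
    exact sum_congr rfl fun T h => prod_insert (hT T h)
  · intro T h T' h' e
    rw [← erase_insert (hT T h), ← erase_insert (hT T' h'), e]
  · rw [disjoint_left]
    intro T h h'
    obtain ⟨T', -, rfl⟩ := mem_image.1 h'
    exact ha ((mem_powersetCard.1 h).1 (mem_insert_self _ _))

theorem pow_succ_add_le {a b : ℝ} (ha : 0 ≤ a) (hb : 0 ≤ b) (n : ℕ) :
    a ^ (n + 1) + (n + 1) * b * a ^ n ≤ (a + b) ^ (n + 1) := by
  induction n with
  | zero => simp
  | succ n ih =>
    have h1 : 0 ≤ (n + 1) * b * a ^ n * b := by positivity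
    calc a ^ (n + 1 + 1) + ((n + 1 : ℕ) + 1) * b * a ^ (n + 1)
        ≤ (a ^ (n + 1) + (n + 1) * b * a ^ n) * (a + b) := by
          push_cast; ring_nf; ring_nf at h1; linarith
      _ ≤ (a + b) ^ (n + 1) * (a + b) := mul_le_mul_of_nonneg_right ih (by positivity)
      _ = _ := by ring

/-- Each squarefree monomial of degree j occurs j! times in the expanded power. -/
theorem elemSymm_le {ι : Type*} {s : Finset ι} {ρ : ι → ℝ} (h0 : ∀ i ∈ s, 0 ≤ ρ i) (j : ℕ) :
    elemSymm s ρ j ≤ (∑ i ∈ s, ρ i) ^ j / (j.factorial : ℝ) := by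
  classical
  induction s using Finset.induction_on generalizing j with
  | empty =>
    cases j with
    | zero => simp [elemSymm]
    | succ j => simp [elemSymm_empty_succ]
  | insert a s ha ih =>
    have h0' : ∀ i ∈ s, 0 ≤ ρ i := fun i hi => h0 i (Finset.mem_insert_of_mem hi)
    have hρ := h0 a (Finset.mem_insert_self _ _)
    cases j with
    | zero => simp [elemSymm]
    | succ j =>
      rw [elemSymm_insert ha, Finset.sum_insert ha]
      have h1 := ih h0' (j + 1)
      have h2 := mul_le_mul_of_nonneg_left (ih h0' j) hρ
      have h3 := pow_succ_add_le (Finset.sum_nonneg h0') hρ j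
      have hj : (0 : ℝ) < j.factorial := by positivity
      calc _ ≤ (∑ i ∈ s, ρ i) ^ (j + 1) / ((j + 1).factorial : ℝ) +
            ρ a * ((∑ i ∈ s, ρ i) ^ j / (j.factorial : ℝ)) := add_le_add h1 h2
        _ = ((∑ i ∈ s, ρ i) ^ (j + 1) + (j + 1) * ρ a * (∑ i ∈ s, ρ i) ^ j) /
            ((j + 1).factorial : ℝ) := by
          rw [Nat.factorial_succ]; push_cast; field_simp
        _ ≤ _ := by
          rw [add_comm (ρ a)]
          gcongr

-- Bounds the accumulated remainder terms of the sieve.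
open Finset in
theorem sum_elemSymm_le {ι : Type*} {s : Finset ι} {ρ : ι → ℝ} (h0 : ∀ i ∈ s, 0 ≤ ρ i) (r : ℕ) :
    ∑ j ∈ range (r + 1), elemSymm s ρ j ≤ (1 + ∑ i ∈ s, ρ i) ^ r := by
  rw [add_comm 1, add_pow]
  refine sum_le_sum fun j hj => (elemSymm_le h0 j).trans ?_
  have h1 : (1 : ℝ) ≤ r.choose j := by
    exact_mod_cast Nat.choose_pos (by simpa [Nat.lt_succ_iff] using hj)
  have h2 : (1 : ℝ) ≤ j.factorial := by exact_mod_cast Nat.factorial_pos j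
  have h3 : 0 ≤ (∑ i ∈ s, ρ i) ^ j := pow_nonneg (sum_nonneg h0) _
  calc _ ≤ (∑ i ∈ s, ρ i) ^ j := div_le_self h3 h2
    _ ≤ _ := by rw [one_pow, mul_one]; exact le_mul_of_one_le_right h3 h1

open Finset in
/-- Bonferroni's inequalities. -/
theorem bonferroni {ι : Type*} {s : Finset ι} {ρ : ι → ℝ}
    (h0 : ∀ i ∈ s, 0 ≤ ρ i) (h1 : ∀ i ∈ s, ρ i ≤ 1) (r : ℕ) :
    0 ≤ (-1) ^ r * (∏ i ∈ s, (1 - ρ i) - ∑ j ∈ range r, (-1) ^ j * elemSymm s ρ j) ∧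
    (-1) ^ r * (∏ i ∈ s, (1 - ρ i) - ∑ j ∈ range r, (-1) ^ j * elemSymm s ρ j) ≤
      elemSymm s ρ r := by
  classical
  induction s using Finset.induction_on generalizing r with
  | empty =>
    cases r with
    | zero => simp [elemSymm]
    | succ r =>
      rw [sum_range_succ']
      simp [elemSymm_empty_succ, elemSymm_zero]
  | insert a s ha ih =>
    have h0' : ∀ i ∈ s, 0 ≤ ρ i := fun i hi => h0 i (Finset.mem_insert_of_mem hi)
    have h1' : ∀ i ∈ s, ρ i ≤ 1 := fun i hi => h1 i (Finset.mem_insert_of_mem hi)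
    have hρ := h0 a (Finset.mem_insert_self _ _)
    cases r with
    | zero =>
      simp only [pow_zero, range_zero, sum_empty, sub_zero, one_mul, elemSymm_zero]
      exact ⟨prod_nonneg fun i hi => sub_nonneg.2 (h1 i hi),
        prod_le_one (fun i hi => sub_nonneg.2 (h1 i hi)) fun i hi => by linarith [h0 i hi]⟩
    | succ r =>
      have e : ∑ j ∈ range (r + 1), (-1) ^ j * elemSymm (insert a s) ρ j =
          ∑ j ∈ range (r + 1), (-1) ^ j * elemSymm s ρ j -
          ρ a * ∑ j ∈ range r, (-1) ^ j * elemSymm s ρ j := by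
        rw [sum_range_succ', sum_range_succ', mul_sum, elemSymm_zero, elemSymm_zero,
          add_sub_right_comm, ← sum_sub_distrib]
        congr 1
        refine sum_congr rfl fun j _ => ?_
        rw [elemSymm_insert ha]
        ring
      have h2 := ih h0' h1' (r + 1)
      have h3 := ih h0' h1' r
      -- The signed remainder of order r + 1 on `insert a s` is that on `s` plus ρ(a) times the one
      -- of order r on `s`, so both inequalities are inherited. Weights in [0, 1] suffice: the sieve
      -- uses indicators and also densities.
      have e2 : (-1) ^ (r + 1) * (∏ i ∈ insert a s, (1 - ρ i) -
          ∑ j ∈ range (r + 1), (-1) ^ j * elemSymm (insert a s) ρ j) =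
          (-1) ^ (r + 1) * (∏ i ∈ s, (1 - ρ i) -
            ∑ j ∈ range (r + 1), (-1) ^ j * elemSymm s ρ j) + ρ a *
          ((-1) ^ r * (∏ i ∈ s, (1 - ρ i) - ∑ j ∈ range r, (-1) ^ j * elemSymm s ρ j)) := by
        rw [e, prod_insert ha]
        ring
      rw [e2, elemSymm_insert ha]
      exact ⟨add_nonneg h2.1 (mul_nonneg hρ h3.1),
        add_le_add h2.2 (mul_le_mul_of_nonneg_left h3.2 hρ)⟩

open Finset in
theorem card_Ico_modEq_abs_le (a : ℤ) (N : ℕ) {d : ℕ} (hd : 0 < d) (c : ℤ) :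
    |(#{u ∈ Ico a (a + N) | u ≡ c [ZMOD d]} : ℝ) - N / d| ≤ 1 := by
  have h := Int.Ico_filter_modEq_card a (a + N) (r := d) (by exact_mod_cast hd) c
  have hd' : (0 : ℝ) < d := by exact_mod_cast hd
  have hdq : (0 : ℚ) < d := by exact_mod_cast hd
  have hle : ⌈((a : ℚ) - c) / (d : ℤ)⌉ ≤ ⌈(((a + N : ℤ) : ℚ) - c) / (d : ℤ)⌉ := by
    apply Int.ceil_le_ceil
    push_cast
    gcongr
    simp
  rw [max_eq_left (by simpa using hle)] at h
  have h1 := Int.le_ceil (((a : ℚ) - c) / (d : ℤ))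
  have h2 := Int.ceil_lt_add_one (((a : ℚ) - c) / (d : ℤ))
  have h3 := Int.le_ceil ((((a + N : ℤ) : ℚ) - c) / (d : ℤ))
  have h4 := Int.ceil_lt_add_one ((((a + N : ℤ) : ℚ) - c) / (d : ℤ))
  have h5 : (((a + N : ℤ) : ℚ) - c) / (d : ℤ) = ((a : ℚ) - c) / (d : ℤ) + N / d := by
    push_cast; ring
  have h' : ((#{u ∈ Ico a (a + N) | u ≡ c [ZMOD d]} : ℤ) : ℚ) =
      (⌈(((a + N : ℤ) : ℚ) - c) / (d : ℤ)⌉ : ℚ) - ⌈((a : ℚ) - c) / (d : ℤ)⌉ := by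
    rw [h]; push_cast; rfl
  have key : |((#{u ∈ Ico a (a + N) | u ≡ c [ZMOD d]} : ℕ) : ℚ) - N / d| ≤ 1 := by
    rw [abs_le]
    push_cast at h' h1 h2 h3 h4 h5
    constructor <;> linarith
  have key' := (Rat.cast_le (K := ℝ)).2 key
  push_cast at key'
  exact key'

open Finset in
/-- Counting in an interval with prescribed sets of residues modulo several primes. -/
theorem card_residues_abs_le (T : Finset ℕ) (hT : ∀ p ∈ T, p.Prime) (Ω : ℕ → Finset ℤ)
    (hΩ : ∀ p ∈ T, ∀ w ∈ Ω p, ∀ w' ∈ Ω p, w ≡ w' [ZMOD p] → w = w')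
    (a : ℤ) (N : ℕ) {d : ℕ} (hd : 0 < d) (hdT : ∀ p ∈ T, d.Coprime p) (c : ℤ) :
    |(#{u ∈ Ico a (a + N) | u ≡ c [ZMOD d] ∧ ∀ p ∈ T, ∃ w ∈ Ω p, u ≡ w [ZMOD p]} : ℝ)
      - N / d * ∏ p ∈ T, ((#(Ω p) : ℝ) / p)| ≤ ∏ p ∈ T, (#(Ω p) : ℝ) := by
  induction T using Finset.induction_on generalizing d c with
  | empty => simpa using card_Ico_modEq_abs_le a N hd c
  | insert p T hp ih =>
    have hpp := hT p (mem_insert_self _ _)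
    have hdp := hdT p (mem_insert_self _ _)
    obtain ⟨s, t, hst⟩ : IsCoprime (d : ℤ) (p : ℤ) := Nat.isCoprime_iff_coprime.2 hdp
    -- Chinese remainder theorem, with an explicit solution from the Bézout relation. The modulus d
    -- and class c are there to collect the primes already treated.
    have hcrt : ∀ w u : ℤ, u ≡ c + (w - c) * (s * d) [ZMOD ((d * p : ℕ) : ℤ)] ↔
        u ≡ c [ZMOD d] ∧ u ≡ w [ZMOD p] := by
      intro w u
      push_cast
      rw [← Int.modEq_and_modEq_iff_modEq_mul (by simpa using hdp)]
      have e1 : c + (w - c) * (s * d) ≡ c [ZMOD d] := by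
        rw [Int.modEq_comm, Int.modEq_iff_dvd]
        exact ⟨(w - c) * s, by ring⟩
      have e2 : c + (w - c) * (s * d) ≡ w [ZMOD p] := by
        rw [Int.modEq_iff_dvd]
        refine ⟨(w - c) * t, ?_⟩
        linear_combination (c - w) * hst
      exact ⟨fun h => ⟨h.1.trans e1, h.2.trans e2⟩, fun h => ⟨h.1.trans e1.symm, h.2.trans e2.symm⟩⟩
    have hcard : #{u ∈ Ico a (a + N) | u ≡ c [ZMOD d] ∧
        ∀ q ∈ insert p T, ∃ w ∈ Ω q, u ≡ w [ZMOD q]} =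
        ∑ w ∈ Ω p, #{u ∈ Ico a (a + N) | u ≡ c + (w - c) * (s * d) [ZMOD ((d * p : ℕ) : ℤ)] ∧
          ∀ q ∈ T, ∃ w ∈ Ω q, u ≡ w [ZMOD q]} := by
      rw [← card_biUnion]
      · congr 1
        ext u
        simp only [mem_filter, mem_biUnion, hcrt, mem_insert, forall_eq_or_imp]
        constructor
        · rintro ⟨h1, h2, ⟨w, hw, h3⟩, h4⟩
          exact ⟨w, hw, h1, ⟨h2, h3⟩, h4⟩
        · rintro ⟨w, hw, h1, ⟨h2, h3⟩, h4⟩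
          exact ⟨h1, h2, ⟨w, hw, h3⟩, h4⟩
      · intro w hw w' hw' hne
        rw [Function.onFun, disjoint_left]
        intro u hu hu'
        simp only [mem_filter, hcrt] at hu hu'
        exact hne (hΩ p (mem_insert_self _ _) w hw w' hw' (hu.2.1.2.symm.trans hu'.2.1.2))
    have hp0 : (0 : ℝ) < p := by exact_mod_cast hpp.pos
    have hd0 : (0 : ℝ) < d := by exact_mod_cast hd
    have ih' := fun w => ih (fun q hq => hT q (mem_insert_of_mem hq))
      (fun q hq => hΩ q (mem_insert_of_mem hq)) (d := d * p) (Nat.mul_pos hd hpp.pos)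
      (fun q hq => Nat.Coprime.mul_left (hdT q (mem_insert_of_mem hq))
        ((Nat.coprime_primes hpp (hT q (mem_insert_of_mem hq))).2 (by rintro rfl; exact hp hq)))
      (c + (w - c) * (s * d))
    rw [hcard, prod_insert hp, prod_insert hp]
    have e : (N : ℝ) / d * ((#(Ω p) : ℝ) / p * ∏ q ∈ T, ((#(Ω q) : ℝ) / q)) =
        ∑ w ∈ Ω p, (N : ℝ) / (d * p : ℕ) * ∏ q ∈ T, ((#(Ω q) : ℝ) / q) := by
      rw [sum_const, nsmul_eq_mul]
      push_cast
      generalize ∏ q ∈ T, ((#(Ω q) : ℝ) / q) = X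
      rw [← div_div]
      ring
    rw [e, Nat.cast_sum, ← sum_sub_distrib]
    refine (abs_sum_le_sum_abs _ _).trans ((sum_le_sum fun w _ => ih' w).trans ?_)
    rw [sum_const, nsmul_eq_mul]

open Finset in
/-- Brun's pure sieve. -/
theorem brun_sieve (P : Finset ℕ) (hP : ∀ p ∈ P, p.Prime) (Ω : ℕ → Finset ℤ)
    (hΩ : ∀ p ∈ P, ∀ w ∈ Ω p, ∀ w' ∈ Ω p, w ≡ w' [ZMOD p] → w = w')
    (hΩp : ∀ p ∈ P, #(Ω p) ≤ p) (a : ℤ) (N : ℕ) {r : ℕ} (hr : Even r) :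
    (#{u ∈ Ico a (a + N) | ∀ p ∈ P, ∀ w ∈ Ω p, ¬ u ≡ w [ZMOD p]} : ℝ) ≤
      N * (∏ p ∈ P, (1 - (#(Ω p) : ℝ) / p) +
        (∑ p ∈ P, (#(Ω p) : ℝ) / p) ^ (r + 1) / ((r + 1).factorial : ℝ)) +
      (1 + ∑ p ∈ P, (#(Ω p) : ℝ)) ^ r := by
  classical
  set ρ : ℤ → ℕ → ℝ := fun u p => if ∃ w ∈ Ω p, u ≡ w [ZMOD p] then 1 else 0 with hρ
  set h : ℕ → ℝ := fun p => #(Ω p)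
  have hr1 : (-1 : ℝ) ^ (r + 1) = -1 := hr.add_one.neg_one_pow
  have h1 : ∀ u, (if ∀ p ∈ P, ∀ w ∈ Ω p, ¬ u ≡ w [ZMOD p] then (1 : ℝ) else 0) ≤
      ∑ j ∈ range (r + 1), (-1) ^ j * elemSymm P (ρ u) j := by
    intro u
    have hb := (bonferroni (s := P) (ρ := ρ u) (fun p _ => by simp only [hρ]; split_ifs <;> simp)
      (fun p _ => by simp only [hρ]; split_ifs <;> simp) (r + 1)).1
    have he : (if ∀ p ∈ P, ∀ w ∈ Ω p, ¬ u ≡ w [ZMOD p] then (1 : ℝ) else 0) =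
        ∏ p ∈ P, (1 - ρ u p) := by
      split_ifs with hu
      · refine (prod_eq_one fun p hp => ?_).symm
        simp only [hρ]
        rw [if_neg (by push Not; exact hu p hp), sub_zero]
      · push Not at hu
        obtain ⟨p, hp, hw⟩ := hu
        refine (prod_eq_zero hp ?_).symm
        simp only [hρ]
        rw [if_pos hw, sub_self]
    rw [he]
    rw [hr1] at hb
    linarith
  -- Each set T of j primes contributes an error of at most the number of its combined residue
  -- classes, the product of #Ω(p) over T.
  have h2 : ∀ j, |∑ u ∈ Ico a (a + N), elemSymm P (ρ u) j - N * elemSymm P (fun p => h p / p) j| ≤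
      elemSymm P h j := by
    intro j
    simp only [elemSymm]
    rw [sum_comm, mul_sum, ← sum_sub_distrib]
    refine (abs_sum_le_sum_abs _ _).trans (sum_le_sum fun T hT => ?_)
    have hTP := (mem_powersetCard.1 hT).1
    have := card_residues_abs_le T (fun p hp => hP p (hTP hp)) Ω (fun p hp => hΩ p (hTP hp)) a N
      (d := 1) one_pos (fun p _ => Nat.coprime_one_left p) 0
    have e1 : (#{u ∈ Ico a (a + N) | u ≡ 0 [ZMOD (1 : ℕ)] ∧ ∀ p ∈ T, ∃ w ∈ Ω p, u ≡ w [ZMOD p]} : ℝ) =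
        ∑ u ∈ Ico a (a + N), ∏ p ∈ T, ρ u p := by
      rw [card_filter, Nat.cast_sum]
      refine sum_congr rfl fun u _ => ?_
      simp only [hρ]
      rw [prod_ite_zero]
      simp [Int.modEq_one]
    rw [e1, Nat.cast_one, div_one] at this
    exact this
  -- A second use of Bonferroni, now for the densities, turns the truncated sum back into the Euler
  -- product at the cost of one symmetric function.
  have h3 : ∑ j ∈ range (r + 1), (-1) ^ j * elemSymm P (fun p => h p / p) j ≤
      ∏ p ∈ P, (1 - h p / p) + elemSymm P (fun p => h p / p) (r + 1) := by
    have hb := (bonferroni (s := P) (ρ := fun p => h p / p) (fun p _ => by positivity)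
      (fun p hp => by
        have : (0 : ℝ) < p := by exact_mod_cast (hP p hp).pos
        rw [div_le_one this]
        exact Nat.cast_le.2 (hΩp p hp)) (r + 1)).2
    rw [hr1] at hb
    linarith
  have h4 := elemSymm_le (s := P) (ρ := fun p => h p / p) (fun p _ => by positivity) (r + 1)
  have h5 := sum_elemSymm_le (s := P) (ρ := h) (fun p _ => by positivity) r
  calc (#{u ∈ Ico a (a + N) | ∀ p ∈ P, ∀ w ∈ Ω p, ¬ u ≡ w [ZMOD p]} : ℝ)
      = ∑ u ∈ Ico a (a + N), (if ∀ p ∈ P, ∀ w ∈ Ω p, ¬ u ≡ w [ZMOD p] then (1 : ℝ) else 0) := by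
        rw [card_filter]; push_cast; rfl
    _ ≤ ∑ u ∈ Ico a (a + N), ∑ j ∈ range (r + 1), (-1) ^ j * elemSymm P (ρ u) j :=
        sum_le_sum fun u _ => h1 u
    _ = ∑ j ∈ range (r + 1), (-1) ^ j * ∑ u ∈ Ico a (a + N), elemSymm P (ρ u) j := by
        rw [sum_comm]; exact sum_congr rfl fun j _ => by rw [mul_sum]
    _ ≤ ∑ j ∈ range (r + 1), ((-1) ^ j * (N * elemSymm P (fun p => h p / p) j) +
          elemSymm P h j) := by
        refine sum_le_sum fun j _ => ?_
        have := abs_le.1 (h2 j)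
        rcases neg_one_pow_eq_or ℝ j with e | e <;> rw [e] <;> linarith [this.1, this.2]
    _ = N * ∑ j ∈ range (r + 1), (-1) ^ j * elemSymm P (fun p => h p / p) j +
          ∑ j ∈ range (r + 1), elemSymm P h j := by
        rw [sum_add_distrib, mul_sum]
        congr 1
        exact sum_congr rfl fun _ _ => by ring
    _ ≤ _ := by gcongr; exact h3.trans (by linarith)

/-! ### Excluded residue classes and the sieve on a line -/

open Finset in
theorem card_le_of_incongruent {p : ℕ} (hp : 0 < p) {Ω : Finset ℤ}
    (hΩ : ∀ w ∈ Ω, ∀ w' ∈ Ω, w ≡ w' [ZMOD p] → w = w') : #Ω ≤ p := by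
  have h : #Ω ≤ #(Ico (0 : ℤ) p) := by
    refine card_le_card_of_injOn (fun w => w % p) (fun w _ => ?_) fun w hw w' hw' e => ?_
    · have hp' : (0 : ℤ) < p := by exact_mod_cast hp
      simp [Int.emod_nonneg _ hp'.ne', Int.emod_lt_of_pos _ hp']
    · exact hΩ w hw w' hw' e
  simpa using h

open Finset in
theorem exists_residues_sq_add_sq {p : ℕ} (hp : p.Prime) (h4 : p % 4 = 1) {v : ℤ}
    (hv : ¬ (p : ℤ) ∣ v) :
    ∃ Ω : Finset ℤ, #Ω = 2 ∧ (∀ w ∈ Ω, ∀ w' ∈ Ω, w ≡ w' [ZMOD p] → w = w') ∧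
      ∀ w ∈ Ω, ∀ u : ℤ, u ≡ w [ZMOD p] → (p : ℤ) ∣ u ^ 2 + v ^ 2 := by
  have := Fact.mk hp
  obtain ⟨y, hy⟩ := (ZMod.exists_sq_eq_neg_one_iff (p := p)).2 (by omega)
  obtain ⟨s, rfl⟩ := ZMod.intCast_surjective y
  have hs : (p : ℤ) ∣ s ^ 2 + 1 := by
    rw [← ZMod.intCast_zmod_eq_zero_iff_dvd]
    push_cast
    rw [pow_two, ← hy]; ring
  have hpp : Prime (p : ℤ) := Nat.prime_iff_prime_int.1 hp
  have hps : ¬ (p : ℤ) ∣ s := fun h => by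
    have : (p : ℤ) ∣ 1 := by
      have := dvd_sub hs (dvd_pow h (two_ne_zero))
      simpa using this
    exact hpp.not_isUnit (isUnit_of_dvd_one this)
  have hp2 : ¬ (p : ℤ) ∣ 2 := fun h => by
    have h' : p ∣ 2 := by exact_mod_cast h
    have := (Nat.prime_dvd_prime_iff_eq hp Nat.prime_two).1 h'
    omega
  have key : ¬ (s * v ≡ -(s * v) [ZMOD p]) := fun h => by
    have h1 : (p : ℤ) ∣ 2 * (s * v) := by
      have := (Int.modEq_iff_dvd.1 h.symm)
      convert this using 1; ring
    rcases hpp.dvd_or_dvd h1 with h1 | h1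
    · exact hp2 h1
    · rcases hpp.dvd_or_dvd h1 with h1 | h1
      · exact hps h1
      · exact hv h1
  refine ⟨{s * v, -(s * v)}, card_pair fun h => key (by rw [← h]), ?_, ?_⟩
  · intro w hw w' hw' h
    simp only [mem_insert, mem_singleton] at hw hw'
    rcases hw with rfl | rfl <;> rcases hw' with rfl | rfl
    · rfl
    · exact absurd h key
    · exact absurd h.symm key
    · rfl
  · intro w hw u hu
    have hw2 : w ^ 2 = s ^ 2 * v ^ 2 := by
      simp only [mem_insert, mem_singleton] at hw
      rcases hw with rfl | rfl <;> ring
    have h1 : (p : ℤ) ∣ u ^ 2 - w ^ 2 := Int.modEq_iff_dvd.1 (hu.pow 2).symm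
    have h2 : u ^ 2 + v ^ 2 = (u ^ 2 - w ^ 2) + (s ^ 2 + 1) * v ^ 2 := by rw [hw2]; ring
    rw [h2]
    exact dvd_add h1 (Dvd.dvd.mul_right hs _)

/-- Exponent 1 gives the sieved classes; exponent 2 counts the u for which p² divides a form. -/
theorem exists_modEq_of_not_dvd {p : ℕ} (hp : p.Prime) (k : ℕ) {c : ℤ} (hc : ¬ (p : ℤ) ∣ c)
    (b : ℤ) : ∃ w : ℤ, ∀ u : ℤ, ((p ^ k : ℕ) : ℤ) ∣ c * u + b ↔ u ≡ w [ZMOD (p ^ k : ℕ)] := by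
  have hcop : IsCoprime ((p ^ k : ℕ) : ℤ) c := by
    push_cast
    exact IsCoprime.pow_left ((Nat.prime_iff_prime_int.1 hp).coprime_iff_not_dvd.2 hc)
  obtain ⟨s, t, hst⟩ := hcop
  refine ⟨-(t * b), fun u => ?_⟩
  rw [Int.modEq_comm, Int.modEq_iff_dvd]
  constructor
  · rintro ⟨x, hx⟩
    exact ⟨s * u + t * x, by linear_combination t * hx - u * hst⟩
  · rintro ⟨x, hx⟩
    exact ⟨s * b + c * x, by linear_combination c * hx - b * hst⟩

-- Each form has one root in u modulo p. A common root of two of them would make p divide their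
-- determinant times v.
open Finset in
theorem exists_residues_forms {ι : Type*} {p : ℕ} (hp : p.Prime) {v : ℤ}
    (hv : ¬ (p : ℤ) ∣ v) {J : Finset ι} {c d : ι → ℤ} (hc : ∀ j ∈ J, ¬ (p : ℤ) ∣ c j)
    (hdet : ∀ i ∈ J, ∀ j ∈ J, i ≠ j → ¬ (p : ℤ) ∣ c i * d j - c j * d i) :
    ∃ Ω : Finset ℤ, #Ω = #J ∧ (∀ w ∈ Ω, ∀ w' ∈ Ω, w ≡ w' [ZMOD p] → w = w') ∧
      ∀ w ∈ Ω, ∀ u : ℤ, u ≡ w [ZMOD p] → ∃ j ∈ J, (p : ℤ) ∣ c j * u + d j * v := by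
  classical
  have hpp : Prime (p : ℤ) := Nat.prime_iff_prime_int.1 hp
  have : ∀ j : ι, ∃ w : ℤ, j ∈ J → ∀ u : ℤ, (p : ℤ) ∣ c j * u + d j * v ↔ u ≡ w [ZMOD p] := by
    intro j
    by_cases hj : j ∈ J
    · obtain ⟨w, hw⟩ := exists_modEq_of_not_dvd hp 1 (hc j hj) (d j * v)
      exact ⟨w, fun _ => by simpa using hw⟩
    · exact ⟨0, fun h => absurd h hj⟩
  choose f hf using this
  have key : ∀ i ∈ J, ∀ j ∈ J, f i ≡ f j [ZMOD p] → i = j := by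
    intro i hi j hj h
    by_contra hij
    have h1 := (hf i hi (f i)).2 (Int.ModEq.refl _)
    have h2 := (hf j hj (f i)).2 h
    have h3 : (p : ℤ) ∣ (c i * d j - c j * d i) * v := by
      have e : (c i * d j - c j * d i) * v =
          c i * (c j * f i + d j * v) - c j * (c i * f i + d i * v) := by ring
      rw [e]
      exact dvd_sub (Dvd.dvd.mul_left h2 (c i)) (Dvd.dvd.mul_left h1 (c j))
    exact (hpp.dvd_or_dvd h3).elim (hdet i hi j hj hij) hv
  refine ⟨J.image f, card_image_of_injOn fun i hi j hj h => key i hi j hj (by rw [h]), ?_, ?_⟩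
  · intro w hw w' hw' h
    obtain ⟨i, hi, rfl⟩ := mem_image.1 hw
    obtain ⟨j, hj, rfl⟩ := mem_image.1 hw'
    rw [key i hi j hj h]
  · intro w hw u hu
    obtain ⟨i, hi, rfl⟩ := mem_image.1 hw
    exact ⟨i, hi, (hf i hi u).2 hu⟩

/-- A prime 3 mod 4 has even exponent in a sum of two squares. So the class p ∣ b_j is excluded up
to the sparse event p² ∣ b_j. -/
theorem sq_dvd_of_dvd_of_mem_sumTwoSquares {p k : ℕ} (hp : p.Prime) (h4 : p % 4 = 3)
    (hk : k ∈ sumTwoSquares) (hpk : p ∣ k) : p ^ 2 ∣ k := by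
  have h1 : 1 ≤ (repPairs {b | 1 ≤ b} k).ncard := hk
  obtain ⟨⟨a, b⟩, hb, hab⟩ : (repPairs {b | 1 ≤ b} k).Nonempty := by
    rw [← Set.ncard_pos (repPairs_finite _ _)]; omega
  simp only [Set.mem_ofPred_eq] at hb hab
  have hk0 : k ≠ 0 := by rintro rfl; nlinarith [sq_nonneg a]
  have := Fact.mk hp
  have := (Nat.eq_sq_add_sq_iff (n := k)).1 ⟨a, b, hab.symm⟩ (q := p)
    (Nat.mem_primeFactors.2 ⟨hp, hpk, hk0⟩) h4
  have h2 : 1 ≤ padicValNat p k := one_le_padicValNat_of_dvd hk0 hpk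
  obtain ⟨m, hm⟩ := this
  exact (padicValNat_dvd_iff_le hk0).2 (by omega)

open Finset in
/-- The sieve bound on a line `v = const`. -/
theorem card_slice_le {ι : Type*} {v : ℤ} {J : Finset ι} {c d : ι → ℤ}
    {Y Z z₀ r : ℕ} (hz₀ : 0 < z₀) (hr : Even r) {P : Finset ℕ}
    (hP : ∀ p ∈ P, p.Prime ∧ (p % 4 = 1 ∨ p % 4 = 3) ∧ z₀ < p ∧ p ≤ Z ∧ ¬ (p : ℤ) ∣ v ∧
      (∀ j ∈ J, ¬ (p : ℤ) ∣ c j) ∧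
      ∀ i ∈ J, ∀ j ∈ J, i ≠ j → ¬ (p : ℤ) ∣ c i * d j - c j * d i)
    {U : Finset ℤ} (hUY : ∀ u ∈ U, |u| ≤ Y) (hUp : ∀ u ∈ U, (u ^ 2 + v ^ 2).natAbs.Prime)
    (hUR : ∀ u ∈ U, ∀ j ∈ J, (c j * u + d j * v).natAbs ∈ sumTwoSquares)
    {h : ℕ → ℝ} (hh : ∀ p ∈ P, h p = if p % 4 = 1 then 2 else (#J : ℝ)) :
    (#U : ℝ) ≤ (2 * Z + 1) + #J * ((2 * Y + 1) / z₀ + Z) +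
      ((2 * Y + 1) * (∏ p ∈ P, (1 - h p / p) +
        (∑ p ∈ P, h p / p) ^ (r + 1) / ((r + 1).factorial : ℝ)) + (1 + ∑ p ∈ P, h p) ^ r) := by
  classical
  have hΩex : ∀ p : ℕ, ∃ Ω : Finset ℤ, p ∈ P → ((#Ω : ℝ) = h p ∧
      (∀ w ∈ Ω, ∀ w' ∈ Ω, w ≡ w' [ZMOD p] → w = w') ∧
      ∀ w ∈ Ω, ∀ u : ℤ, u ≡ w [ZMOD p] → (p : ℤ) ∣ u ^ 2 + v ^ 2 ∨
        (p % 4 = 3 ∧ ∃ j ∈ J, (p : ℤ) ∣ c j * u + d j * v)) := by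
    intro p
    by_cases hp : p ∈ P
    · obtain ⟨hpp, h4, -, -, hpv, hpc, hpd⟩ := hP p hp
      rcases h4 with h4 | h4
      · obtain ⟨Ω, h1, h2, h3⟩ := exists_residues_sq_add_sq hpp h4 hpv
        exact ⟨Ω, fun _ => ⟨by rw [hh p hp, if_pos h4, h1]; norm_num, h2,
          fun w hw u hu => Or.inl (h3 w hw u hu)⟩⟩
      · obtain ⟨Ω, h1, h2, h3⟩ := exists_residues_forms hpp hpv hpc hpd
        exact ⟨Ω, fun _ => ⟨by rw [hh p hp, if_neg (by omega), h1], h2,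
          fun w hw u hu => Or.inr ⟨h4, h3 w hw u hu⟩⟩⟩
    · exact ⟨∅, fun h => absurd h hp⟩
  choose Ω hΩ using hΩex
  set I : Finset ℤ := Ico (-(Y : ℤ)) (-(Y : ℤ) + (2 * Y + 1 : ℕ)) with hI
  have hUI : ∀ u ∈ U, u ∈ I := by
    intro u hu
    have := abs_le.1 (hUY u hu)
    rw [hI, mem_Ico]
    push_cast
    constructor <;> linarith
  -- Three ways for u to occur. In `A`, the prime u² + v² may itself be a sieving prime, which
  -- forces |u| ≤ Z. In `B`, some p² divides a form, which is rare because p > z₀. In `S`, u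
  -- survives the sieve.
  set A : Finset ℤ := Icc (-(Z : ℤ)) Z
  set B : Finset ℤ := J.biUnion fun j => P.biUnion fun p =>
    {u ∈ I | ((p ^ 2 : ℕ) : ℤ) ∣ c j * u + d j * v}
  set S : Finset ℤ := {u ∈ I | ∀ p ∈ P, ∀ w ∈ Ω p, ¬ u ≡ w [ZMOD p]}
  have hsub : U ⊆ A ∪ B ∪ S := by
    intro u hu
    by_cases hS : u ∈ S
    · exact mem_union_right _ hS
    refine mem_union_left _ ?_
    simp only [S, mem_filter, hUI u hu, true_and] at hS
    push Not at hS
    obtain ⟨p, hp, w, hw, hpw⟩ := hS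
    obtain ⟨hpp, -, -, hpZ, -⟩ := hP p hp
    rcases (hΩ p hp).2.2 w hw u hpw with h1 | ⟨h4, j, hj, h1⟩
    · refine mem_union_left _ ?_
      have h2 : p ∣ (u ^ 2 + v ^ 2).natAbs := Int.natCast_dvd.1 h1
      have h3 := (Nat.prime_dvd_prime_iff_eq hpp (hUp u hu)).1 h2
      have h4 : u ^ 2 + v ^ 2 = p := by
        rw [h3, Int.natCast_natAbs, abs_of_nonneg (by positivity)]
      have h5 : |u| ≤ Z := by
        have h6 : |u| ≤ |u| ^ 2 := by
          rcases eq_or_ne u 0 with rfl | h0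
          · simp
          · have := Int.one_le_abs h0; nlinarith
        rw [sq_abs] at h6
        have h7 : (p : ℤ) ≤ Z := by exact_mod_cast hpZ
        nlinarith [sq_nonneg v]
      exact mem_Icc.2 (abs_le.1 h5)
    · refine mem_union_right _ (mem_biUnion.2 ⟨j, hj, mem_biUnion.2 ⟨p, hp, ?_⟩⟩)
      rw [mem_filter]
      exact ⟨hUI u hu, Int.natCast_dvd.2 (sq_dvd_of_dvd_of_mem_sumTwoSquares hpp h4 (hUR u hu j hj)
        (Int.natCast_dvd.1 h1))⟩
  have hA : (#A : ℝ) = 2 * Z + 1 := by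
    have : #A = 2 * Z + 1 := by simp only [A, Int.card_Icc]; omega
    rw [this]; push_cast; ring
  have hPI : ∀ p ∈ P, p ∈ Ioc z₀ Z := fun p hp => by
    obtain ⟨-, -, h1, h2, -⟩ := hP p hp; exact mem_Ioc.2 ⟨h1, h2⟩
  have hz₀' : (0 : ℝ) < z₀ := by exact_mod_cast hz₀
  have hB : (#B : ℝ) ≤ #J * ((2 * Y + 1) / z₀ + Z) := by
    have h1 : ∀ j ∈ J, ∀ p ∈ P, (#{u ∈ I | ((p ^ 2 : ℕ) : ℤ) ∣ c j * u + d j * v} : ℝ) ≤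
        (2 * Y + 1) * ((p : ℝ) ^ 2)⁻¹ + 1 := by
      intro j hj p hp
      obtain ⟨hpp, -, -, -, -, hpc, -⟩ := hP p hp
      obtain ⟨w, hw⟩ := exists_modEq_of_not_dvd hpp 2 (hpc j hj) (d j * v)
      simp only [hw]
      have := (abs_le.1 (card_Ico_modEq_abs_le (-(Y : ℤ)) (2 * Y + 1)
        (d := p ^ 2) (pow_pos hpp.pos 2) w)).2
      push_cast at this ⊢
      rw [div_eq_mul_inv] at this
      simp only [hI]
      push_cast
      linarith
    have h2 : ∑ p ∈ P, ((p : ℝ) ^ 2)⁻¹ ≤ 1 / z₀ := by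
      rcases le_total z₀ Z with hz | hz
      · calc ∑ p ∈ P, ((p : ℝ) ^ 2)⁻¹ ≤ ∑ p ∈ Ioc z₀ Z, ((p : ℝ) ^ 2)⁻¹ :=
              sum_le_sum_of_subset_of_nonneg hPI fun _ _ _ => by positivity
          _ ≤ (z₀ : ℝ)⁻¹ - (Z : ℝ)⁻¹ := sum_Ioc_inv_sq_le_sub hz₀.ne' hz
          _ ≤ 1 / z₀ := by
            rw [one_div]
            have : (0 : ℝ) ≤ (Z : ℝ)⁻¹ := by positivity
            linarith
      · have : P = ∅ := by
          rw [eq_empty_iff_forall_notMem]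
          intro p hp
          have := mem_Ioc.1 (hPI p hp)
          omega
        rw [this]
        simp
    have h3 : (#P : ℝ) ≤ Z := by
      have : #P ≤ #(Ioc z₀ Z) := card_le_card hPI
      rw [Nat.card_Ioc] at this
      exact_mod_cast this.trans (Nat.sub_le _ _)
    calc (#B : ℝ) ≤ ((∑ j ∈ J, ∑ p ∈ P, #{u ∈ I | ((p ^ 2 : ℕ) : ℤ) ∣ c j * u + d j * v} : ℕ) : ℝ) :=
          Nat.cast_le.2 (card_biUnion_le.trans (sum_le_sum fun j _ => card_biUnion_le))
      _ = ∑ j ∈ J, ∑ p ∈ P, (#{u ∈ I | ((p ^ 2 : ℕ) : ℤ) ∣ c j * u + d j * v} : ℝ) := by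
          push_cast; rfl
      _ ≤ ∑ j ∈ J, ∑ p ∈ P, ((2 * Y + 1) * ((p : ℝ) ^ 2)⁻¹ + 1) :=
          sum_le_sum fun j hj => sum_le_sum fun p hp => h1 j hj p hp
      _ = #J * ((2 * Y + 1) * ∑ p ∈ P, ((p : ℝ) ^ 2)⁻¹ + #P) := by
          rw [sum_const, nsmul_eq_mul, sum_add_distrib, ← mul_sum]
          simp
      _ ≤ #J * ((2 * Y + 1) * (1 / z₀) + Z) := by gcongr
      _ = _ := by ring
  have hS := brun_sieve P (fun p hp => (hP p hp).1) Ω (fun p hp => (hΩ p hp).2.1)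
    (fun p hp => card_le_of_incongruent (hP p hp).1.pos (hΩ p hp).2.1) (-(Y : ℤ)) (2 * Y + 1) hr
  have e1 : ∏ p ∈ P, (1 - (#(Ω p) : ℝ) / p) = ∏ p ∈ P, (1 - h p / p) :=
    prod_congr rfl fun p hp => by rw [(hΩ p hp).1]
  have e2 : ∑ p ∈ P, (#(Ω p) : ℝ) / p = ∑ p ∈ P, h p / p :=
    sum_congr rfl fun p hp => by rw [(hΩ p hp).1]
  have e3 : ∑ p ∈ P, (#(Ω p) : ℝ) = ∑ p ∈ P, h p :=
    sum_congr rfl fun p hp => by rw [(hΩ p hp).1]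
  rw [e1, e2, e3] at hS
  have h1 : (#U : ℝ) ≤ #A + #B + #S := by
    have := (card_le_card hsub).trans ((card_union_le _ _).trans
      (Nat.add_le_add_right (card_union_le _ _) _))
    exact_mod_cast this
  push_cast at hS
  have h2 : (#S : ℝ) ≤ _ := hS
  linarith

/-! ### Choice of the sieve parameters and the two-dimensional bound -/

open Filter in
theorem eventually_mul_pow_le_exp (M : ℝ) (k : ℕ) :
    ∀ᶠ L : ℝ in atTop, M * L ^ k ≤ Real.exp L := by
  have h := (Real.isLittleO_pow_exp_atTop (n := k)).const_mul_left M
  filter_upwards [h.bound one_pos] with L hL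
  rw [one_mul, Real.norm_eq_abs, Real.norm_eq_abs, Real.abs_exp] at hL
  exact (le_abs_self _).trans hL

theorem card_primeFactors_le {n : ℤ} (hn : n ≠ 0) {T : ℝ} (hT : (|n| : ℝ) ≤ Real.exp T) :
    (n.natAbs.primeFactors.card : ℝ) ≤ 2 * T := by
  have hn0 : 0 < n.natAbs := Int.natAbs_pos.2 hn
  have h1 : 2 ^ n.natAbs.primeFactors.card ≤ n.natAbs :=
    (Finset.pow_card_le_prod _ _ _ fun p hp => (Nat.prime_of_mem_primeFactors hp).two_le).trans
      (Nat.le_of_dvd hn0 (Nat.prod_primeFactors_dvd _))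
  have h2 : (2 : ℝ) ^ n.natAbs.primeFactors.card ≤ Real.exp T := by
    refine le_trans ?_ hT
    have : ((2 ^ n.natAbs.primeFactors.card : ℕ) : ℝ) ≤ (n.natAbs : ℝ) := Nat.cast_le.2 h1
    rw [Nat.cast_natAbs] at this
    exact_mod_cast this
  have h3 := Real.log_le_log (by positivity) h2
  rw [Real.log_pow, Real.log_exp] at h3
  have := Real.log_two_gt_d9
  nlinarith [Nat.cast_nonneg (α := ℝ) n.natAbs.primeFactors.card]

-- Weight 2 on one class and n on the other, each of density 1/2, give the coefficient (n + 2)/2.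
-- The exceptional primes in `Bd` cost O(1) for fixed n: at most z₀ of them occur, each with p > z₀
-- and weight at most (n + 2)/z₀.
open Finset in
theorem exists_sum_sieve_bounds : ∃ c : ℝ, 0 ≤ c ∧ ∀ n z₀ Z : ℕ, 4 ≤ z₀ → z₀ ≤ Z →
    ∀ P Bd : Finset ℕ, (∀ p ∈ P, p.Prime ∧ (p % 4 = 1 ∨ p % 4 = 3) ∧ p ≤ Z) →
    (∀ p ∈ Ioc z₀ Z, p.Prime → (p % 4 = 1 ∨ p % 4 = 3) → p ∉ Bd → p ∈ P) →
    (#Bd ≤ z₀) → ∀ h : ℕ → ℝ, (∀ p, h p = if p % 4 = 1 then 2 else (n : ℝ)) →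
    (n + 2) / 2 * (Real.log (Real.log Z) - Real.log (Real.log z₀)) - c * (n + 2) ≤
      ∑ p ∈ P, h p / p ∧
    ∑ p ∈ P, h p / p ≤ (n + 2) * (Real.log (Real.log Z) + c) := by
  obtain ⟨c₁, hc₁⟩ := exists_sum_one_div_prime_mod_four_abs_le (b := 1) (Or.inl rfl)
  obtain ⟨c₃, hc₃⟩ := exists_sum_one_div_prime_mod_four_abs_le (b := 3) (Or.inr rfl)
  have hc₁0 : 0 ≤ c₁ := (abs_nonneg _).trans (hc₁ 4 le_rfl)
  have hc₃0 : 0 ≤ c₃ := (abs_nonneg _).trans (hc₃ 4 le_rfl)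
  refine ⟨2 * c₁ + 2 * c₃ + 1, by positivity, fun n z₀ Z hz₀ hZ P Bd hP hPB hBd h hh => ?_⟩
  have hh0 : ∀ p, 0 ≤ h p / p := fun p => by rw [hh]; split_ifs <;> positivity
  have hhn : ∀ p, h p ≤ n + 2 := fun p => by
    rw [hh]; split_ifs <;> linarith [Nat.cast_nonneg (α := ℝ) n]
  have hsub : ∀ b : ℕ, {p ∈ Ioc 0 z₀ | p.Prime ∧ p % 4 = b} ⊆ {p ∈ Ioc 0 Z | p.Prime ∧ p % 4 = b} :=
    fun b => filter_subset_filter _ (Ioc_subset_Ioc_right hZ)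
  have hsdiff : ∀ b : ℕ, {p ∈ Ioc z₀ Z | p.Prime ∧ p % 4 = b} =
      {p ∈ Ioc 0 Z | p.Prime ∧ p % 4 = b} \ {p ∈ Ioc 0 z₀ | p.Prime ∧ p % 4 = b} := by
    intro b; ext p; simp only [mem_filter, mem_Ioc, mem_sdiff]
    constructor
    · rintro ⟨h1, h2⟩; exact ⟨⟨by omega, h2⟩, fun h => by omega⟩
    · rintro ⟨⟨h1, h2⟩, h3⟩
      refine ⟨⟨?_, h1.2⟩, h2⟩
      by_contra h4
      exact h3 ⟨⟨h1.1, by omega⟩, h2⟩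
  have hdisj : ∀ m M : ℕ, Disjoint {p ∈ Ioc m M | p.Prime ∧ p % 4 = 1}
      {p ∈ Ioc m M | p.Prime ∧ p % 4 = 3} := by
    intro m M
    rw [disjoint_left]
    intro p hp hp'
    have := (mem_filter.1 hp).2.2
    have := (mem_filter.1 hp').2.2
    omega
  have a1 := abs_le.1 (hc₁ z₀ hz₀)
  have a3 := abs_le.1 (hc₃ z₀ hz₀)
  have b1 := abs_le.1 (hc₁ Z (hz₀.trans hZ))
  have b3 := abs_le.1 (hc₃ Z (hz₀.trans hZ))
  have hS : ∀ m M : ℕ, ∑ p ∈ {p ∈ Ioc m M | p.Prime ∧ p % 4 = 1} ∪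
      {p ∈ Ioc m M | p.Prime ∧ p % 4 = 3}, h p / p =
      2 * ∑ p ∈ Ioc m M with p.Prime ∧ p % 4 = 1, 1 / (p : ℝ) +
      n * ∑ p ∈ Ioc m M with p.Prime ∧ p % 4 = 3, 1 / (p : ℝ) := by
    intro m M
    rw [sum_union (hdisj m M), mul_sum, mul_sum]
    congr 1
    · refine sum_congr rfl fun p hp => ?_
      rw [hh, if_pos (mem_filter.1 hp).2.2]; ring
    · refine sum_congr rfl fun p hp => ?_
      rw [hh, if_neg (by have := (mem_filter.1 hp).2.2; omega)]; ring
  have hn0 : (0 : ℝ) ≤ n := Nat.cast_nonneg n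
  constructor
  · set F := {p ∈ Ioc z₀ Z | p.Prime ∧ p % 4 = 1} ∪ {p ∈ Ioc z₀ Z | p.Prime ∧ p % 4 = 3} with hF
    have h1 : ∑ p ∈ F \ Bd, h p / p ≤ ∑ p ∈ P, h p / p := by
      refine sum_le_sum_of_subset_of_nonneg (fun p hp => ?_) fun p _ _ => hh0 p
      rw [mem_sdiff, hF, mem_union, mem_filter, mem_filter] at hp
      rcases hp with ⟨h1 | h1, h2⟩
      · exact hPB p h1.1 h1.2.1 (Or.inl h1.2.2) h2
      · exact hPB p h1.1 h1.2.1 (Or.inr h1.2.2) h2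
    have h2 : ∑ p ∈ F ∩ Bd, h p / p ≤ n + 2 := by
      have hz0 : (0 : ℝ) < z₀ := by exact_mod_cast (by omega : 0 < z₀)
      calc ∑ p ∈ F ∩ Bd, h p / p ≤ ∑ p ∈ F ∩ Bd, ((n : ℝ) + 2) / z₀ := by
            refine sum_le_sum fun p hp => ?_
            have : z₀ ≤ p := by
              rw [mem_inter, hF, mem_union, mem_filter, mem_filter, mem_Ioc] at hp
              rcases hp with ⟨h1 | h1, h2⟩ <;> omega
            have h3 : (z₀ : ℝ) ≤ p := by exact_mod_cast this
            exact div_le_div₀ (by positivity) (hhn p) hz0 h3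
        _ = #(F ∩ Bd) * (((n : ℝ) + 2) / z₀) := by rw [sum_const, nsmul_eq_mul]
        _ ≤ z₀ * (((n : ℝ) + 2) / z₀) := by
            gcongr
            exact (card_le_card inter_subset_right).trans hBd
        _ = n + 2 := by field_simp
    have h3 := sum_inter_add_sum_sdiff F Bd (fun p => h p / (p : ℝ))
    rw [hF, hS] at h3
    rw [← hF, hsdiff, hsdiff] at h3
    have e1 := sum_sdiff (f := fun p : ℕ => 1 / (p : ℝ)) (hsub 1)
    have e3 := sum_sdiff (f := fun p : ℕ => 1 / (p : ℝ)) (hsub 3)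
    set D1 := ∑ p ∈ {p ∈ Ioc 0 Z | p.Prime ∧ p % 4 = 1} \ {p ∈ Ioc 0 z₀ | p.Prime ∧ p % 4 = 1}, 1 / (p : ℝ)
    set D3 := ∑ p ∈ {p ∈ Ioc 0 Z | p.Prime ∧ p % 4 = 3} \ {p ∈ Ioc 0 z₀ | p.Prime ∧ p % 4 = 3}, 1 / (p : ℝ)
    set D := Real.log (Real.log Z) - Real.log (Real.log z₀) with hD
    have f1 : 1 / 2 * D - 2 * c₁ ≤ D1 := by rw [hD]; linarith
    have f3 : n * (1 / 2 * D - 2 * c₃) ≤ n * D3 :=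
      mul_le_mul_of_nonneg_left (by rw [hD]; linarith) hn0
    nlinarith [mul_nonneg hn0 hc₁0]
  · have h1 : ∑ p ∈ P, h p / p ≤ ∑ p ∈ {p ∈ Ioc 0 Z | p.Prime ∧ p % 4 = 1} ∪
        {p ∈ Ioc 0 Z | p.Prime ∧ p % 4 = 3}, h p / p := by
      refine sum_le_sum_of_subset_of_nonneg (fun p hp => ?_) fun p _ _ => hh0 p
      obtain ⟨h1, h2, h3⟩ := hP p hp
      rw [mem_union, mem_filter, mem_filter, mem_Ioc]
      have := h1.pos
      tauto
    rw [hS] at h1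
    set S1 := ∑ p ∈ Ioc 0 Z with p.Prime ∧ p % 4 = 1, 1 / (p : ℝ)
    set S3 := ∑ p ∈ Ioc 0 Z with p.Prime ∧ p % 4 = 3, 1 / (p : ℝ)
    have p1 : 0 ≤ S1 := sum_nonneg fun _ _ => by positivity
    have p3 : 0 ≤ S3 := sum_nonneg fun _ _ => by positivity
    have f : S1 + S3 ≤ Real.log (Real.log Z) + (2 * c₁ + 2 * c₃ + 1) := by linarith
    calc _ ≤ 2 * S1 + n * S3 := h1
      _ ≤ (n + 2) * (S1 + S3) := by nlinarith [mul_nonneg hn0 p1]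
      _ ≤ _ := by gcongr

/-- (8s)^n / n! ≤ e^(8s) ≤ e^n, and 8 ≥ e². This makes the truncation error of the sieve negligible.
-/
theorem pow_div_factorial_le_exp_neg {s : ℝ} (hs : 0 ≤ s) {n : ℕ} (hn : 8 * s ≤ n) :
    s ^ n / (n.factorial : ℝ) ≤ Real.exp (-n) := by
  have h1 := Real.pow_div_factorial_le_exp (x := 8 * s) (by positivity) n
  have he : Real.exp 2 ≤ 8 := by
    rw [show (2 : ℝ) = 1 + 1 by norm_num, Real.exp_add]
    have := Real.exp_one_lt_d9
    have := Real.exp_pos 1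
    nlinarith
  have h2 : Real.exp (2 * n) ≤ 8 ^ n := by
    rw [mul_comm, Real.exp_nat_mul]
    exact pow_le_pow_left₀ (Real.exp_pos 2).le he n
  have h3 : Real.exp (2 * n) * (s ^ n / (n.factorial : ℝ)) ≤ Real.exp n := by
    calc _ ≤ 8 ^ n * (s ^ n / (n.factorial : ℝ)) := by gcongr
      _ = (8 * s) ^ n / (n.factorial : ℝ) := by rw [mul_pow]; ring
      _ ≤ Real.exp (8 * s) := h1
      _ ≤ Real.exp n := Real.exp_le_exp.2 hn
  have h4 : Real.exp (-n) = Real.exp n / Real.exp (2 * n) := by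
    rw [← Real.exp_sub]; congr 1; ring
  rw [h4, le_div_iff₀ (Real.exp_pos _)]
  linarith

set_option maxHeartbeats 2000000 in
open Finset Filter in
/-- The sieve bound on a line `v = const`, with the parameters of the sieve chosen. -/
theorem exists_slice_bound (ℓ : ℕ) (hℓ : 1 ≤ ℓ) : ∃ K : ℝ, 0 < K ∧ ∀ᶠ L : ℝ in atTop,
    ∀ X : ℝ, 0 < X → Real.exp L / L ^ 2 ≤ Real.log X → Real.log X ≤ Real.exp L →
    ∀ c d : Fin ℓ → ℤ, (∀ j, (|c j| : ℝ) ≤ Real.exp (Real.exp L)) →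
      (∀ j, (|d j| : ℝ) ≤ Real.exp (Real.exp L)) →
      (∀ i j, i ≠ j → c i * d j - c j * d i ≠ 0) →
    ∀ v : ℤ, v ≠ 0 → (v : ℝ) ^ 2 ≤ X →
    ∀ U : Finset ℤ, (∀ u ∈ U, (u ^ 2 + v ^ 2).natAbs.Prime ∧ (u : ℝ) ^ 2 ≤ X ∧
      ∀ j, (c j * u + d j * v).natAbs ∈ sumTwoSquares) →
    (#U : ℝ) ≤ K * √X * L ^ (3 * (ℓ + 1)) * Real.exp (-((ℓ + 1) / 2 * L)) := by
  obtain ⟨κ, hκ0, hκ⟩ := exists_sum_sieve_bounds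
  have hℓ1 : (1 : ℝ) ≤ ℓ := by exact_mod_cast hℓ
  refine ⟨3 * Real.exp (κ * (ℓ + 2)) + 5 * ℓ + 8, by positivity, ?_⟩
  filter_upwards [eventually_ge_atTop (10 : ℝ), eventually_ge_atTop (13 * 17 * (ℓ + 2) : ℝ),
    eventually_ge_atTop κ, eventually_mul_pow_le_exp (156 * 17 * (ℓ + 2)) 3,
    eventually_mul_pow_le_exp (ℓ + 3) 5, eventually_mul_pow_le_exp (3 * ((ℓ + 1) / 2)) 3,
    eventually_mul_pow_le_exp (4 * (1 + ℓ + ℓ ^ 2)) 0] with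
    L hL10 hL1 hLκ hE1 hE2 hE3 hE4 X hX0 hXl hXu c d hc hd hdet v hv hvX U hU
  have hL0 : 0 < L := by linarith
  have hexpL := Real.exp_pos L
  have hA : 30 ≤ (ℓ + 2) * L := by nlinarith
  have hℓL : ℓ ≤ ℓ * L := le_mul_of_one_le_right (by linarith) (by linarith)
  have hℓL10 : 10 ≤ ℓ * L := by nlinarith
  -- the parameters
  set z₀ : ℕ := ⌈Real.exp ((ℓ + 2) * L)⌉₊ with hz₀
  -- Even, as the upper-bound sieve requires, and at least 8 times the bound 2(ℓ + 2)L for the sum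
  -- of the densities.
  set r : ℕ := 2 * ⌈8 * (ℓ + 2) * L⌉₊ with hr
  -- Chosen so that e^(2tr) = X^(1/6), which bounds the accumulated error of the sieve.
  set t : ℝ := Real.log X / (12 * r) with ht
  set Z : ℕ := ⌊Real.exp t⌋₊ with hZ
  set Y : ℕ := ⌊√X⌋₊ with hY
  set g : ℝ := Real.exp (-((ℓ + 1) / 2 * L)) with hg
  have hr_lo : 16 * (ℓ + 2) * L ≤ r := by
    have := Nat.le_ceil (8 * (ℓ + 2) * L)
    rw [hr]; push_cast; linarith
  have hr_hi : (r : ℝ) ≤ 17 * (ℓ + 2) * L := by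
    have := Nat.ceil_lt_add_one (a := 8 * (ℓ + 2) * L) (by positivity)
    rw [hr]; push_cast
    linarith
  have hr0 : (0 : ℝ) < r := lt_of_lt_of_le (by positivity) hr_lo
  have hz₀_lo : Real.exp ((ℓ + 2) * L) ≤ z₀ := Nat.le_ceil _
  have hz₀4 : 4 ≤ z₀ := by
    have : (4 : ℝ) ≤ z₀ := by
      refine le_trans ?_ hz₀_lo
      have := Real.add_one_le_exp ((ℓ + 2) * L)
      linarith
    exact_mod_cast this
  have hz₀_log : Real.log z₀ ≤ (ℓ + 3) * L := by
    have h1 := (Nat.ceil_lt_add_one (Real.exp_pos ((ℓ + 2) * L)).le).le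
    have h2 : (1 : ℝ) ≤ Real.exp ((ℓ + 2) * L) := Real.one_le_exp (by positivity)
    have h3 : (2 : ℝ) ≤ Real.exp L := by linarith [Real.add_one_le_exp L]
    rw [Real.log_le_iff_le_exp (by exact_mod_cast (by omega : 0 < z₀))]
    calc (z₀ : ℝ) ≤ 2 * Real.exp ((ℓ + 2) * L) := by linarith
      _ ≤ Real.exp L * Real.exp ((ℓ + 2) * L) := by gcongr
      _ = _ := by rw [← Real.exp_add]; congr 1; ring
  have hz₀_log1 : 1 ≤ Real.log z₀ := by
    rw [Real.le_log_iff_exp_le (by exact_mod_cast (by omega : 0 < z₀))]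
    exact (Real.exp_one_lt_d9.le.trans (by norm_num)).trans
      (by exact_mod_cast hz₀4 : (4 : ℝ) ≤ z₀)
  have hlogX : Real.exp L ≤ Real.log X * L ^ 2 := by rwa [div_le_iff₀ (by positivity)] at hXl
  have hlogX0 : 0 < Real.log X := lt_of_lt_of_le (by positivity) hXl
  have hX_r : 156 * r ≤ Real.log X := by
    have h1 : 156 * (17 * (ℓ + 2) * L) * L ^ 2 ≤ Real.log X * L ^ 2 := by
      calc _ = 156 * 17 * (ℓ + 2) * L ^ 3 := by ring
        _ ≤ _ := hE1.trans hlogX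
    have h2 := le_of_mul_le_mul_right h1 (by positivity)
    linarith
  have ht13 : 13 ≤ t := by rw [ht, le_div_iff₀ (by positivity)]; linarith
  have ht_lo : Real.exp L / L ^ 4 + 1 ≤ t := by
    have h1 : Real.log X / (13 * r) + 1 ≤ t := by
      have : t - Real.log X / (13 * r) = Real.log X / (156 * r) := by
        rw [ht]; field_simp; norm_num
      have h2 : 1 ≤ Real.log X / (156 * r) := by rwa [le_div_iff₀ (by positivity), one_mul]
      linarith
    have h2 : Real.exp L / L ^ 4 ≤ Real.log X / (13 * r) := by
      calc Real.exp L / L ^ 4 = Real.exp L / L ^ 2 / L ^ 2 := by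
            rw [div_div]; congr 1; ring
        _ ≤ Real.log X / (13 * r) := by
          gcongr
          calc 13 * (r : ℝ) ≤ 13 * 17 * (ℓ + 2) * L := by linarith
            _ ≤ L * L := by gcongr
            _ = L ^ 2 := by ring
    linarith
  have hZ_hi : (Z : ℝ) ≤ Real.exp t := Nat.floor_le (Real.exp_pos _).le
  have hZ_log : Real.exp L / L ^ 4 ≤ Real.log Z := by
    have h1 := Nat.sub_one_lt_floor (Real.exp t)
    have h2 : (2 : ℝ) ≤ Real.exp 1 := by linarith [Real.add_one_le_exp (1 : ℝ)]
    have h3 : (1 : ℝ) ≤ Real.exp (t - 1) := Real.one_le_exp (by linarith)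
    have h4 : Real.exp t = Real.exp (t - 1) * Real.exp 1 := by rw [← Real.exp_add]; congr 1; ring
    have h6 := mul_le_mul_of_nonneg_left h2 (Real.exp_pos (t - 1)).le
    have h5 : Real.exp (t - 1) ≤ Z := by linarith
    have := Real.log_le_log (Real.exp_pos _) h5
    rw [Real.log_exp] at this
    linarith
  have hZ_log2 : (ℓ + 3) * L ≤ Real.log Z := by
    refine le_trans ?_ hZ_log
    rw [le_div_iff₀ (by positivity)]
    calc _ = (ℓ + 3) * L ^ 5 := by ring
      _ ≤ _ := hE2
  have hZ0 : (0 : ℝ) < Z := by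
    by_contra h
    have : (Z : ℝ) = 0 := le_antisymm (not_lt.1 h) (Nat.cast_nonneg _)
    rw [this, Real.log_zero] at hZ_log2
    linarith
  have hzZ : z₀ ≤ Z := by
    have := (Real.log_le_log_iff (by exact_mod_cast (by omega : 0 < z₀)) hZ0).1
      (hz₀_log.trans hZ_log2)
    exact_mod_cast this
  have hZl3 : (ℓ : ℝ) + 3 ≤ Z := by
    have := Real.log_le_sub_one_of_pos hZ0
    linarith
  have hX16 : Real.exp (Real.log X / 6) ≤ √X * g := by
    rw [Real.sqrt_eq_rpow, Real.rpow_def_of_pos hX0, hg, ← Real.exp_add, Real.exp_le_exp]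
    have h1 : 3 * ((ℓ + 1) / 2 * L) * L ^ 2 ≤ Real.log X * L ^ 2 := by
      calc _ = 3 * ((ℓ + 1) / 2) * L ^ 3 := by ring
        _ ≤ _ := hE3.trans hlogX
    have h2 := le_of_mul_le_mul_right h1 (by positivity)
    linarith
  have hXZ : (Z : ℝ) ≤ √X * g := by
    refine le_trans (hZ_hi.trans (Real.exp_le_exp.2 ?_)) hX16
    rw [ht]
    refine div_le_div_of_nonneg_left hlogX0.le (by norm_num) ?_
    have : (1 : ℝ) ≤ r := by linarith
    linarith
  have hX1 : 1 ≤ √X := by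
    rw [Real.one_le_sqrt]
    exact ((Real.log_pos_iff hX0.le).1 hlogX0).le
  have hYX : (2 * Y + 1 : ℝ) ≤ 3 * √X := by
    have := Nat.floor_le (Real.sqrt_nonneg X)
    linarith
  -- the set of primes
  set J : Finset (Fin ℓ) := {j | c j ≠ 0} with hJ
  -- Two vanishing c_j would give a zero determinant, so at most one form is constant along the
  -- line. Dropping it leaves the exponent (ℓ - 1 + 2)/2 = (ℓ + 1)/2.
  have hJc : ℓ ≤ #J + 1 := by
    have h1 : #({j | ¬ c j ≠ 0} : Finset (Fin ℓ)) ≤ 1 := by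
      rw [card_le_one]
      intro i hi j hj
      simp only [ne_eq, not_not, mem_filter, mem_univ, true_and] at hi hj
      by_contra hij
      exact hdet i j hij (by rw [hi, hj]; ring)
    have h2 : #J + #({j | ¬ c j ≠ 0} : Finset (Fin ℓ)) = ℓ := by
      rw [hJ, card_filter_add_card_filter_not, card_univ, Fintype.card_fin]
    omega
  have hJl : #J ≤ ℓ := by simpa using card_le_univ J
  set Bd : Finset ℕ := v.natAbs.primeFactors ∪ (J.biUnion fun j => (c j).natAbs.primeFactors) ∪
    ((univ : Finset (Fin ℓ × Fin ℓ)).filter fun q => q.1 ≠ q.2).biUnion fun q =>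
      (c q.1 * d q.2 - c q.2 * d q.1).natAbs.primeFactors with hBd
  set P : Finset ℕ := {p ∈ Ioc z₀ Z | p.Prime ∧ (p % 4 = 1 ∨ p % 4 = 3) ∧ p ∉ Bd} with hPdef
  have hexp2 : 2 ≤ Real.exp L := by linarith [Real.add_one_le_exp L]
  -- v, the nonzero c_j and the determinants are nonzero integers of size exp(O(e^L)), so each has
  -- O(e^L) prime factors, and e^((ℓ+2)L) exceeds the total.
  have hBdc : #Bd ≤ z₀ := by
    have h1 : (#Bd : ℝ) ≤ 2 * Real.exp L + ℓ * (2 * Real.exp L) +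
        ℓ ^ 2 * (2 * (3 * Real.exp L)) := by
      have b1 : (#(v.natAbs.primeFactors) : ℝ) ≤ 2 * Real.exp L := by
        refine card_primeFactors_le hv (T := Real.exp L) ?_
        have h2 : (|v| : ℝ) ≤ √X := Real.abs_le_sqrt hvX
        refine h2.trans ?_
        rw [Real.sqrt_eq_rpow, Real.rpow_def_of_pos hX0, Real.exp_le_exp]
        linarith
      have b2 : (#(J.biUnion fun j => (c j).natAbs.primeFactors) : ℝ) ≤ ℓ * (2 * Real.exp L) := by
        calc _ ≤ ((∑ j ∈ J, #((c j).natAbs.primeFactors) : ℕ) : ℝ) := Nat.cast_le.2 card_biUnion_le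
          _ = ∑ j ∈ J, (#((c j).natAbs.primeFactors) : ℝ) := by push_cast; rfl
          _ ≤ ∑ j ∈ J, 2 * Real.exp L := sum_le_sum fun j hj =>
              card_primeFactors_le (mem_filter.1 hj).2 (hc j)
          _ = #J * (2 * Real.exp L) := by rw [sum_const, nsmul_eq_mul]
          _ ≤ _ := by gcongr
      have b3 : (#(((univ : Finset (Fin ℓ × Fin ℓ)).filter fun q => q.1 ≠ q.2).biUnion fun q =>
          (c q.1 * d q.2 - c q.2 * d q.1).natAbs.primeFactors) : ℝ) ≤
          ℓ ^ 2 * (2 * (3 * Real.exp L)) := by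
        set Q := (univ : Finset (Fin ℓ × Fin ℓ)).filter fun q => q.1 ≠ q.2
        have hQ : #Q ≤ ℓ ^ 2 := by
          refine (card_le_univ Q).trans ?_
          simp [pow_two]
        calc _ ≤ ((∑ q ∈ Q, #((c q.1 * d q.2 - c q.2 * d q.1).natAbs.primeFactors) : ℕ) : ℝ) :=
              Nat.cast_le.2 card_biUnion_le
          _ = ∑ q ∈ Q, (#((c q.1 * d q.2 - c q.2 * d q.1).natAbs.primeFactors) : ℝ) := by
              push_cast; rfl
          _ ≤ ∑ q ∈ Q, 2 * (3 * Real.exp L) := sum_le_sum fun q hq => by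
              refine card_primeFactors_le (hdet _ _ (mem_filter.1 hq).2) ?_
              push_cast
              have e : Real.exp (3 * Real.exp L) = Real.exp (Real.exp L) *
                  (Real.exp (Real.exp L) * Real.exp (Real.exp L)) := by
                rw [← Real.exp_add, ← Real.exp_add]; congr 1; ring
              have e2 : 2 ≤ Real.exp (Real.exp L) := by
                linarith [Real.add_one_le_exp (Real.exp L)]
              have m1 : |(c q.1 : ℝ) * d q.2| ≤ Real.exp (Real.exp L) * Real.exp (Real.exp L) := by
                rw [abs_mul]
                exact mul_le_mul (by exact_mod_cast hc q.1) (by exact_mod_cast hd q.2)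
                  (abs_nonneg _) (Real.exp_pos _).le
              have m2 : |(c q.2 : ℝ) * d q.1| ≤ Real.exp (Real.exp L) * Real.exp (Real.exp L) := by
                rw [abs_mul]
                exact mul_le_mul (by exact_mod_cast hc q.2) (by exact_mod_cast hd q.1)
                  (abs_nonneg _) (Real.exp_pos _).le
              have m3 := abs_sub ((c q.1 : ℝ) * d q.2) ((c q.2 : ℝ) * d q.1)
              have m4 : 0 < Real.exp (Real.exp L) * Real.exp (Real.exp L) := by positivity
              have m5 := mul_le_mul_of_nonneg_right e2 m4.le
              rw [e]
              linarith
          _ = #Q * (2 * (3 * Real.exp L)) := by rw [sum_const, nsmul_eq_mul]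
          _ ≤ _ := by
              gcongr
              exact_mod_cast hQ
      have b4 : (#Bd : ℝ) ≤ _ := Nat.cast_le.2 ((card_union_le _ _).trans
        (Nat.add_le_add_right (card_union_le _ _) _))
      push_cast at b4
      linarith
    have h2 : (#Bd : ℝ) ≤ z₀ := by
      refine (h1.trans ?_).trans hz₀_lo
      have h3 : Real.exp ((ℓ + 2) * L) = Real.exp (ℓ * L) * Real.exp L * Real.exp L := by
        rw [← Real.exp_add, ← Real.exp_add]; congr 1; ring
      have h4 : 2 ≤ Real.exp (ℓ * L) := by
        have := Real.add_one_le_exp (ℓ * L)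
        linarith
      rw [pow_zero, mul_one] at hE4
      have h5 : 4 * (1 + ℓ + ℓ ^ 2) * Real.exp L ≤ Real.exp L * Real.exp L := by gcongr
      rw [h3]
      have h6 := mul_le_mul_of_nonneg_right h4 (mul_pos hexpL hexpL).le
      have h7 : 0 ≤ ℓ * Real.exp L := by positivity
      have h8 : 0 ≤ (ℓ : ℝ) ^ 2 * Real.exp L := by positivity
      linarith
    exact_mod_cast h2
  have hP : ∀ p ∈ P, p.Prime ∧ (p % 4 = 1 ∨ p % 4 = 3) ∧ z₀ < p ∧ p ≤ Z ∧ ¬ (p : ℤ) ∣ v ∧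
      (∀ j ∈ J, ¬ (p : ℤ) ∣ c j) ∧
      ∀ i ∈ J, ∀ j ∈ J, i ≠ j → ¬ (p : ℤ) ∣ c i * d j - c j * d i := by
    intro p hp
    obtain ⟨h1, h2, h3, h4⟩ := mem_filter.1 hp
    rw [mem_Ioc] at h1
    have hmem : ∀ n : ℤ, n ≠ 0 → (p : ℤ) ∣ n → p ∈ n.natAbs.primeFactors := fun n hn h =>
      Nat.mem_primeFactors.2 ⟨h2, Int.natCast_dvd.1 h, Int.natAbs_ne_zero.2 hn⟩
    refine ⟨h2, h3, h1.1, h1.2, fun h => h4 ?_, fun j hj h => h4 ?_, fun i _ j _ hij h => h4 ?_⟩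
    · exact mem_union_left _ (mem_union_left _ (hmem v hv h))
    · exact mem_union_left _ (mem_union_right _
        (mem_biUnion.2 ⟨j, hj, hmem _ (mem_filter.1 hj).2 h⟩))
    · exact mem_union_right _ (mem_biUnion.2 ⟨(i, j), by simpa using hij, hmem _ (hdet i j hij) h⟩)
  set h : ℕ → ℝ := fun p => if p % 4 = 1 then 2 else (#J : ℝ) with hh
  have hUYb : ∀ u ∈ U, |u| ≤ (Y : ℤ) := by
    intro u hu
    have h1 : (|u| : ℝ) ≤ √X := Real.abs_le_sqrt (hU u hu).2.1
    rw [Int.abs_eq_natAbs]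
    have h2 : u.natAbs ≤ Y := Nat.le_floor (by rw [Nat.cast_natAbs]; exact_mod_cast h1)
    exact_mod_cast h2
  have hmain := card_slice_le (v := v) (J := J) (c := c) (d := d) (Y := Y) (Z := Z) (z₀ := z₀) (r := r)
    (by omega) (even_two_mul _) hP hUYb (fun u hu => (hU u hu).1)
    (fun u hu j _ => (hU u hu).2.2 j) (h := h) (fun p _ => rfl)
  obtain ⟨hlo, hhi⟩ := hκ #J z₀ Z hz₀4 hzZ P Bd (fun p hp => ⟨(hP p hp).1, (hP p hp).2.1,
    (hP p hp).2.2.2.1⟩) (fun p hp h1 h2 h3 => mem_filter.2 ⟨hp, h1, h2, h3⟩) hBdc h (fun p => rfl)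
  have hJr : (ℓ : ℝ) ≤ #J + 1 := by exact_mod_cast hJc
  have hJr' : (#J : ℝ) ≤ ℓ := by exact_mod_cast hJl
  have hh0 : ∀ p, 0 ≤ h p := fun p => by simp only [hh]; split_ifs <;> positivity
  have hs0 : 0 ≤ ∑ p ∈ P, h p / p := sum_nonneg fun p _ => div_nonneg (hh0 p) (by positivity)
  have hll : Real.log (Real.log Z) ≤ L := by
    have h1 : Real.log Z ≤ t := by
      have := Real.log_le_log hZ0 hZ_hi
      rwa [Real.log_exp] at this
    have h2 : t ≤ Real.exp L := by
      refine le_trans (div_le_self hlogX0.le ?_) hXu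
      linarith
    rw [← Real.log_exp L]
    exact Real.log_le_log (lt_of_lt_of_le (by positivity) hZ_log) (h1.trans h2)
  have hlL : Real.log L ≤ L := (Real.log_le_sub_one_of_pos hL0).trans (by linarith)
  have hlZ : L - 4 * Real.log L ≤ Real.log (Real.log Z) := by
    have := Real.log_le_log (by positivity) hZ_log
    rw [Real.log_div hexpL.ne' (by positivity), Real.log_exp, Real.log_pow] at this
    push_cast at this
    linarith
  have hlz : Real.log (Real.log z₀) ≤ 2 * Real.log L := by
    have h1 : Real.log z₀ ≤ L ^ 2 := by
      refine hz₀_log.trans ?_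
      rw [pow_two]
      gcongr
      linarith
    have := Real.log_le_log (by linarith) h1
    rwa [Real.log_pow] at this
  have hlzZ : Real.log (Real.log z₀) ≤ Real.log (Real.log Z) :=
    Real.log_le_log (by linarith) (hz₀_log.trans hZ_log2)
  -- the product
  have hE_prod : ∏ p ∈ P, (1 - h p / p) ≤
      Real.exp (κ * (ℓ + 2)) * L ^ (3 * (ℓ + 1)) * g := by
    have h1 : ∏ p ∈ P, (1 - h p / p) ≤ Real.exp (-∑ p ∈ P, h p / p) := by
      rw [← sum_neg_distrib, Real.exp_sum]
      refine prod_le_prod (fun p hp => ?_) fun p _ => ?_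
      · have hp' := hP p hp
        have h2 : (z₀ : ℝ) ≤ p := by exact_mod_cast hp'.2.2.1.le
        have h3 : h p ≤ ℓ + 2 := by simp only [hh]; split_ifs <;> linarith
        have h4 : (ℓ + 2 : ℝ) ≤ z₀ := by
          have := Real.log_le_sub_one_of_pos (x := z₀) (by exact_mod_cast (by omega : 0 < z₀))
          have h5 := Real.add_one_le_exp ((ℓ + 2) * L)
          linarith
        rw [sub_nonneg, div_le_one (by linarith)]
        linarith
      · have := Real.add_one_le_exp (-(h p / p))
        linarith
    refine h1.trans ?_
    have h2 : Real.exp (κ * (ℓ + 2)) * L ^ (3 * (ℓ + 1)) * g =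
        Real.exp (κ * (ℓ + 2) + 3 * (ℓ + 1) * Real.log L - (ℓ + 1) / 2 * L) := by
      rw [sub_eq_add_neg, Real.exp_add, Real.exp_add, hg]
      congr 2
      rw [← Real.exp_log (pow_pos hL0 _), Real.log_pow]
      push_cast; rfl
    rw [h2, Real.exp_le_exp]
    have h3 : ((ℓ : ℝ) + 1) / 2 * (Real.log (Real.log Z) - Real.log (Real.log z₀)) ≤
        (#J + 2) / 2 * (Real.log (Real.log Z) - Real.log (Real.log z₀)) := by
      refine mul_le_mul_of_nonneg_right ?_ (by linarith)
      linarith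
    -- 4 log L is lost because log Z ≥ e^L / L⁴ and 2 log L because log z₀ ≤ L². This is the source
    -- of the factor L^(3(ℓ+1)).
    have h4 : ((ℓ : ℝ) + 1) / 2 * (L - 6 * Real.log L) ≤
        ((ℓ : ℝ) + 1) / 2 * (Real.log (Real.log Z) - Real.log (Real.log z₀)) := by
      refine mul_le_mul_of_nonneg_left ?_ (by positivity)
      linarith
    have h5 : κ * (#J + 2) ≤ κ * (ℓ + 2) := by gcongr
    linarith
  have hE_trunc : (∑ p ∈ P, h p / p) ^ (r + 1) / ((r + 1).factorial : ℝ) ≤ g := by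
    have h1 : ∑ p ∈ P, h p / p ≤ 2 * (ℓ + 2) * L := by
      refine hhi.trans ?_
      calc _ ≤ ((ℓ : ℝ) + 2) * (L + L) := by
            refine mul_le_mul (by linarith) (by linarith) ?_ (by positivity)
            have : 0 ≤ Real.log (Real.log Z) := by
              refine Real.log_nonneg ?_
              linarith
            linarith
        _ = _ := by ring
    refine (pow_div_factorial_le_exp_neg hs0 ?_).trans ?_
    · push_cast; linarith
    · rw [hg, Real.exp_le_exp]
      push_cast
      linarith
  have hE_err : (1 + ∑ p ∈ P, h p) ^ r ≤ √X * g := by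
    have h1 : ∑ p ∈ P, h p ≤ (ℓ + 2) * Z := by
      calc ∑ p ∈ P, h p ≤ ∑ p ∈ P, ((ℓ : ℝ) + 2) := sum_le_sum fun p _ => by
            simp only [hh]; split_ifs <;> linarith
        _ = #P * ((ℓ : ℝ) + 2) := by rw [sum_const, nsmul_eq_mul]
        _ ≤ Z * ((ℓ : ℝ) + 2) := by
            gcongr
            refine (card_le_card (filter_subset _ _)).trans ?_
            rw [Nat.card_Ioc]; exact Nat.sub_le _ _
        _ = _ := by ring
    have h2 : 1 + ∑ p ∈ P, h p ≤ Real.exp (2 * t) := by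
      have : Real.exp (2 * t) = Real.exp t * Real.exp t := by rw [← Real.exp_add]; congr 1; ring
      have m1 : ((ℓ : ℝ) + 2) * Z ≤ (Z - 1) * Z :=
        mul_le_mul_of_nonneg_right (by linarith) hZ0.le
      have m2 := mul_self_le_mul_self hZ0.le hZ_hi
      rw [this]
      linarith
    refine le_trans (pow_le_pow_left₀ (by linarith [sum_nonneg fun p (_ : p ∈ P) => hh0 p]) h2 r) ?_
    rw [← Real.exp_nat_mul]
    refine le_trans (Real.exp_le_exp.2 ?_) hX16
    rw [ht]
    apply le_of_eq
    field_simp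
    norm_num
  have hz₀g : 1 / (z₀ : ℝ) ≤ g := by
    rw [one_div, hg, Real.exp_neg]
    refine inv_anti₀ (Real.exp_pos _) (le_trans (Real.exp_le_exp.2 ?_) hz₀_lo)
    linarith
  have hg0 : 0 < g := Real.exp_pos _
  have hLp : 1 ≤ L ^ (3 * (ℓ + 1)) := one_le_pow₀ (by linarith)
  set W := √X * g with hW
  have hW0 : 0 < W := by positivity
  have f1 : (2 * Y + 1 : ℝ) / z₀ ≤ 3 * W := by
    calc (2 * Y + 1 : ℝ) / z₀ = (2 * Y + 1) * (1 / z₀) := by ring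
      _ ≤ 3 * √X * g := by gcongr
      _ = _ := by rw [hW]; ring
  have f2 : (#J : ℝ) * ((2 * Y + 1) / z₀ + Z) ≤ ℓ * (4 * W) := by
    gcongr
    linarith
  have f3 : (2 * Y + 1 : ℝ) * (∏ p ∈ P, (1 - h p / p) +
      (∑ p ∈ P, h p / p) ^ (r + 1) / ((r + 1).factorial : ℝ)) ≤
      3 * √X * (Real.exp (κ * (ℓ + 2)) * L ^ (3 * (ℓ + 1)) * g + g) := by
    have h1 := add_le_add hE_prod hE_trunc
    calc _ ≤ (2 * Y + 1 : ℝ) * (Real.exp (κ * (ℓ + 2)) * L ^ (3 * (ℓ + 1)) * g + g) :=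
          mul_le_mul_of_nonneg_left h1 (by positivity)
      _ ≤ _ := by gcongr
  have f4 : (1 : ℝ) ≤ W := (Real.one_le_exp (by positivity)).trans hX16
  have f5 : W ≤ W * L ^ (3 * (ℓ + 1)) := le_mul_of_one_le_right hW0.le hLp
  have f6 : ℓ * W ≤ ℓ * (W * L ^ (3 * (ℓ + 1))) := by gcongr
  calc (#U : ℝ) ≤ (2 * W + W) + ℓ * (4 * W) +
        (3 * √X * (Real.exp (κ * (ℓ + 2)) * L ^ (3 * (ℓ + 1)) * g + g) + W) := by linarith
    _ = 3 * Real.exp (κ * (ℓ + 2)) * (W * L ^ (3 * (ℓ + 1))) + 4 * (ℓ * W) + 7 * W := by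
        rw [hW]; ring
    _ ≤ 3 * Real.exp (κ * (ℓ + 2)) * (W * L ^ (3 * (ℓ + 1))) +
        5 * (ℓ * (W * L ^ (3 * (ℓ + 1)))) + 8 * (W * L ^ (3 * (ℓ + 1))) := by
        have : 0 ≤ ℓ * W := by positivity
        linarith
    _ = _ := by rw [hW]; ring

open Finset Filter in
/-- The two-dimensional sieve bound: primes `u ^ 2 + v ^ 2` such that several linear forms in
`u, v` take values that are sums of two squares. -/
theorem exists_sieve_bound (ℓ : ℕ) (hℓ : 1 ≤ ℓ) : ∃ K : ℝ, 0 < K ∧ ∀ᶠ L : ℝ in atTop,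
    ∀ X : ℝ, 0 < X → Real.exp L / L ^ 2 ≤ Real.log X → Real.log X ≤ Real.exp L →
    ∀ c d : Fin ℓ → ℤ, (∀ j, (|c j| : ℝ) ≤ Real.exp (Real.exp L)) →
      (∀ j, (|d j| : ℝ) ≤ Real.exp (Real.exp L)) →
      (∀ i j, i ≠ j → c i * d j - c j * d i ≠ 0) →
    ∀ S : Finset (ℤ × ℤ), (∀ q ∈ S, (q.1 ^ 2 + q.2 ^ 2).natAbs.Prime ∧
      (q.1 : ℝ) ^ 2 + (q.2 : ℝ) ^ 2 ≤ X ∧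
      ∀ j, (c j * q.1 + d j * q.2).natAbs ∈ sumTwoSquares) →
    (#S : ℝ) ≤ K * X * L ^ (3 * (ℓ + 1)) * Real.exp (-((ℓ + 1) / 2 * L)) := by
  obtain ⟨K, hK, h⟩ := exists_slice_bound ℓ hℓ
  refine ⟨3 * K, by positivity, ?_⟩
  filter_upwards [h, eventually_gt_atTop 0] with L hL hL0 X hX0 hXl hXu c d hc hd hdet S hS
  have hlogX0 : 0 < Real.log X := lt_of_lt_of_le (by positivity) hXl
  have hX1 : 1 ≤ √X := by
    rw [Real.one_le_sqrt]
    exact ((Real.log_pos_iff hX0.le).1 hlogX0).le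
  set V : Finset ℤ := S.image Prod.snd
  have hV : (#V : ℝ) ≤ 3 * √X := by
    have h1 : V ⊆ Icc (-(⌊√X⌋₊ : ℤ)) ⌊√X⌋₊ := by
      intro v hv
      obtain ⟨q, hq, rfl⟩ := mem_image.1 hv
      have h2 : (|q.2| : ℝ) ≤ √X := Real.abs_le_sqrt (by nlinarith [(hS q hq).2.1])
      have h3 : q.2.natAbs ≤ ⌊√X⌋₊ := Nat.le_floor (by rw [Nat.cast_natAbs]; exact_mod_cast h2)
      rw [mem_Icc]
      omega
    have h2 := card_le_card h1
    rw [Int.card_Icc] at h2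
    have h3 : #V ≤ 2 * ⌊√X⌋₊ + 1 := by omega
    have h4 : (#V : ℝ) ≤ 2 * ⌊√X⌋₊ + 1 := by exact_mod_cast h3
    have := Nat.floor_le (Real.sqrt_nonneg X)
    linarith
  have hslice : ∀ v ∈ V, (#{q ∈ S | q.2 = v} : ℝ) ≤
      K * √X * L ^ (3 * (ℓ + 1)) * Real.exp (-((ℓ + 1) / 2 * L)) := by
    intro v hv
    have e : #{q ∈ S | q.2 = v} = #(({q ∈ S | q.2 = v}).image Prod.fst) := by
      rw [card_image_of_injOn]
      intro q hq q' hq' h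
      rw [mem_coe, mem_filter] at hq hq'
      exact Prod.ext h (hq.2.trans hq'.2.symm)
    rw [e]
    obtain ⟨q₀, hq₀, rfl⟩ := mem_image.1 hv
    -- Here v ≠ 0, since u² is never prime.
    refine hL X hX0 hXl hXu c d hc hd hdet q₀.2 ?_ (by nlinarith [(hS q₀ hq₀).2.1]) _ ?_
    · intro h0
      have := (hS q₀ hq₀).1
      rw [h0, zero_pow two_ne_zero, add_zero, Int.natAbs_pow] at this
      exact Nat.Prime.not_prime_pow le_rfl this
    · intro u hu
      obtain ⟨q, hq, rfl⟩ := mem_image.1 hu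
      rw [mem_filter] at hq
      have := hS q hq.1
      rw [hq.2] at this
      exact ⟨this.1, by nlinarith [this.2.1], this.2.2⟩
  calc (#S : ℝ) = ∑ v ∈ V, (#{q ∈ S | q.2 = v} : ℝ) := by
        rw [card_eq_sum_card_image Prod.snd]; push_cast; rfl
    _ ≤ ∑ v ∈ V, K * √X * L ^ (3 * (ℓ + 1)) * Real.exp (-((ℓ + 1) / 2 * L)) :=
        sum_le_sum hslice
    _ = #V * (K * √X * L ^ (3 * (ℓ + 1)) * Real.exp (-((ℓ + 1) / 2 * L))) := by
        rw [sum_const, nsmul_eq_mul]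
    _ ≤ 3 * √X * (K * √X * L ^ (3 * (ℓ + 1)) * Real.exp (-((ℓ + 1) / 2 * L))) := by
        gcongr
    _ = 3 * K * (√X * √X) * L ^ (3 * (ℓ + 1)) * Real.exp (-((ℓ + 1) / 2 * L)) := by ring
    _ = _ := by rw [Real.mul_self_sqrt hX0.le]

/-! ### Primitive Gaussian integers of given norm -/

open Zsqrtd in
theorem GaussianInt.prime_of_norm_prime {w : GaussianInt} (h : w.norm.natAbs.Prime) :
    Prime w := by
  refine Irreducible.prime ⟨fun hu => ?_, fun a b hab => ?_⟩
  · rw [norm_eq_one_iff.2 hu] at h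
    exact Nat.not_prime_one h
  · rw [hab, norm_mul, Int.natAbs_mul] at h
    rcases Nat.prime_mul_iff.1 h with ⟨-, h1⟩ | ⟨-, h1⟩
    · exact Or.inr (norm_eq_one_iff.1 h1)
    · exact Or.inl (norm_eq_one_iff.1 h1)

open Zsqrtd in
/-- A primitive Gaussian integer whose norm is divisible by `q = p ^ e` with `p % 4 = 1` is
divisible by a fixed element of norm `q` or by its conjugate. -/
theorem exists_gaussianInt_of_isPrimePow {q : ℕ} (hq : IsPrimePow q) (h4 : q.minFac % 4 = 1) :
    ∃ w : GaussianInt, w.norm = q ∧ ∀ z : GaussianInt, IsCoprime z.re z.im →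
      (q : ℤ) ∣ z.norm → w ∣ z ∨ star w ∣ z := by
  obtain ⟨p, e, hp, he, rfl⟩ := (isPrimePow_nat_iff _).1 hq
  rw [hp.pow_minFac he.ne'] at h4
  have := Fact.mk hp
  obtain ⟨a, b, hab⟩ := Nat.Prime.sq_add_sq (p := p) (by omega)
  set w : GaussianInt := ⟨a, b⟩ with hw
  have hwn : w.norm = p := by
    rw [norm_def, hw, ← hab]; push_cast; ring
  have hwp : Prime w := GaussianInt.prime_of_norm_prime (by rw [hwn]; simpa using hp)
  have hwsp : Prime (star w) := GaussianInt.prime_of_norm_prime (by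
    rw [norm_conj, hwn]; simpa using hp)
  have hpw : ((p : ℤ) : GaussianInt) = w * star w := by rw [← hwn, norm_eq_mul_conj]
  -- p does not ramify: otherwise w̄ divides w + w̄ = 2a, whence p ∣ 4a² and p ∣ a, against 0 < a² <
  -- p.
  have hnd : ¬ star w ∣ w := by
    intro h
    have h1 : star w ∣ ((2 * a : ℤ) : GaussianInt) := by
      have h2 : w + star w = ((2 * a : ℤ) : GaussianInt) := by
        rw [hw]; ext <;> simp; ring
      rw [← h2]
      exact dvd_add h dvd_rfl
    obtain ⟨y, hy⟩ := h1
    have h2 := congrArg Zsqrtd.norm hy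
    rw [norm_mul, norm_conj, hwn, norm_intCast] at h2
    have h3 : (p : ℤ) ∣ (2 * a) * (2 * a) := ⟨_, h2⟩
    have h4' : p ∣ (2 * a) * (2 * a) := by exact_mod_cast h3
    have h5 : p ∣ 2 * a := by rcases hp.dvd_mul.1 h4' with h | h <;> exact h
    have h6 : p ∣ a := by
      rcases hp.dvd_mul.1 h5 with h | h
      · have := (Nat.prime_dvd_prime_iff_eq hp Nat.prime_two).1 h
        omega
      · exact h
    rcases Nat.eq_zero_or_pos a with h0 | h0
    · rw [h0, zero_pow two_ne_zero, zero_add] at hab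
      exact Nat.Prime.not_prime_pow le_rfl (hab ▸ hp)
    · have := Nat.le_of_dvd h0 h6
      have h2p := hp.two_le
      nlinarith
  refine ⟨w ^ e, ?_, fun z hz hqz => ?_⟩
  · have : ∀ n : ℕ, (w ^ n).norm = p ^ n := by
      intro n
      induction n with
      | zero => simp
      | succ n ih => rw [pow_succ, norm_mul, ih, hwn, pow_succ]
    rw [this]; push_cast; rfl
  have hzz : (w ^ e) * (star w) ^ e ∣ z * star z := by
    rw [← mul_pow, ← hpw, ← norm_eq_mul_conj]
    obtain ⟨y, hy⟩ := hqz
    rw [hy]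
    push_cast
    exact dvd_mul_right _ _
  have hstar : ∀ a b : GaussianInt, a ∣ star b → star a ∣ b := by
    rintro a b ⟨y, hy⟩
    refine ⟨star y, ?_⟩
    rw [← star_star b, hy, star_mul', mul_comm]
  -- w and w̄ cannot both divide z, since then p = w w̄ would divide both coordinates. Hence the
  -- whole power of one of them lies in z.
  by_cases hwz : w ∣ z
  · left
    have h1 : ¬ star w ∣ z := by
      intro h
      obtain ⟨y, rfl⟩ := hwz
      rcases hwsp.dvd_or_dvd h with h2 | h2
      · exact hnd h2
      · have h3 : ((p : ℤ) : GaussianInt) ∣ w * y := by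
          rw [hpw]; exact mul_dvd_mul_left _ h2
        have h4 := (intCast_dvd _ _).1 h3
        have := hz.isUnit_of_dvd' h4.1 h4.2
        exact (Nat.prime_iff_prime_int.1 hp).not_isUnit this
    have h2 : star w ^ e ∣ star z :=
      hwsp.pow_dvd_of_dvd_mul_left e h1 ((dvd_mul_left _ _).trans hzz)
    have := hstar _ _ h2
    rwa [star_pow, star_star] at this
  · right
    rw [star_pow]
    have h2 : w ^ e ∣ star z :=
      hwp.pow_dvd_of_dvd_mul_left e hwz ((dvd_mul_right _ _).trans hzz)
    have := hstar _ _ h2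
    rwa [star_pow] at this

theorem finite_primitive_norm_eq (m : ℕ) :
    {z : GaussianInt | z.norm = m ∧ IsCoprime z.re z.im}.Finite := by
  refine ((Set.finite_Icc (-(m : ℤ)) m).prod (Set.finite_Icc (-(m : ℤ)) m)).preimage
    (f := fun z : GaussianInt => (z.re, z.im)) ?_ |>.subset ?_
  · intro z _ z' _ h
    simp only [Prod.mk.injEq] at h
    exact Zsqrtd.ext h.1 h.2
  · rintro z ⟨hz, -⟩
    rw [Zsqrtd.norm_def] at hz
    have h1 : ∀ a : ℤ, a * a ≤ m → -(m : ℤ) ≤ a ∧ a ≤ m := by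
      intro a ha
      rw [← abs_le]
      rcases eq_or_ne a 0 with rfl | h0
      · simp
      · have := Int.one_le_abs h0
        have h2 := abs_mul_abs_self a
        nlinarith
    simp only [Set.mem_preimage, Set.mem_prod, Set.mem_Icc]
    exact ⟨h1 _ (by nlinarith [mul_self_nonneg z.im]), h1 _ (by nlinarith [mul_self_nonneg z.re])⟩

/-- The primitive Gaussian integers of norm `m`. -/
noncomputable def primitiveOfNorm (m : ℕ) : Finset GaussianInt :=
  (finite_primitive_norm_eq m).toFinset

theorem mem_primitiveOfNorm {m : ℕ} {z : GaussianInt} :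
    z ∈ primitiveOfNorm m ↔ z.norm = m ∧ IsCoprime z.re z.im := by
  simp [primitiveOfNorm]

open Zsqrtd in
theorem mem_primitiveOfNorm_of_mul {m q : ℕ} (hq : 0 < q) {α w : GaussianInt} (hw : w.norm = q)
    (h : w * α ∈ primitiveOfNorm (m * q)) : α ∈ primitiveOfNorm m := by
  rw [mem_primitiveOfNorm] at h ⊢
  refine ⟨?_, isCoprime_of_dvd_isCoprime h.2 (dvd_mul_left _ _)⟩
  have h1 := h.1
  rw [norm_mul, hw] at h1
  have hq' : (q : ℤ) ≠ 0 := by exact_mod_cast hq.ne'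
  apply mul_left_cancel₀ hq'
  rw [h1]; push_cast; ring

/-- Every element is w or w̄ times a primitive element of norm m. This replaces the exact formula
for the number of primitive representations. -/
theorem card_primitiveOfNorm_mul_le {m q : ℕ} (hq : IsPrimePow q) (h4 : q.minFac % 4 = 1) :
    (primitiveOfNorm (m * q)).card ≤ 2 * (primitiveOfNorm m).card := by
  classical
  obtain ⟨w, hw, h⟩ := exists_gaussianInt_of_isPrimePow hq h4
  have hsub : primitiveOfNorm (m * q) ⊆ (primitiveOfNorm m).image (w * ·) ∪
      (primitiveOfNorm m).image (star w * ·) := by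
    intro z hz
    have hz' := mem_primitiveOfNorm.1 hz
    rw [Finset.mem_union, Finset.mem_image, Finset.mem_image]
    rcases h z hz'.2 (by rw [hz'.1]; push_cast; exact dvd_mul_left _ _) with ⟨α, rfl⟩ | ⟨α, rfl⟩
    · exact Or.inl ⟨α, mem_primitiveOfNorm_of_mul hq.pos hw hz, rfl⟩
    · exact Or.inr ⟨α, mem_primitiveOfNorm_of_mul hq.pos (by rw [Zsqrtd.norm_conj, hw]) hz, rfl⟩
  calc _ ≤ _ := (Finset.card_le_card hsub).trans (Finset.card_union_le _ _)
    _ ≤ (primitiveOfNorm m).card + (primitiveOfNorm m).card :=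
      add_le_add Finset.card_image_le Finset.card_image_le
    _ = _ := by ring

/-- A primitive representation makes -1 a square modulo n; and if 4 divides the sum of two squares,
both are even. -/
theorem mod_four_of_mem_primitiveOfNorm {n : ℕ} {z : GaussianInt} (hz : z ∈ primitiveOfNorm n) :
    (∀ p ∈ n.primeFactors, p % 4 ≠ 3) ∧ ¬ 4 ∣ n := by
  obtain ⟨h1, h2⟩ := mem_primitiveOfNorm.1 hz
  have h3 : (n : ℤ) = z.re ^ 2 + z.im ^ 2 := by rw [← h1, Zsqrtd.norm_def]; ring
  constructor
  · intro p hp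
    refine Nat.mod_four_ne_three_of_mem_primeFactors_of_isSquare_neg_one hp ?_
    simpa using ZMod.isSquare_neg_one_of_eq_sq_add_sq_of_isCoprime h3 h2
  · intro h4
    have h5 : (4 : ℤ) ∣ z.re ^ 2 + z.im ^ 2 := by rw [← h3]; exact_mod_cast h4
    have h6 : ∀ a : ZMod 4, ∀ b : ZMod 4, a ^ 2 + b ^ 2 = 0 → 2 * a = 0 ∧ 2 * b = 0 := by decide
    have h7 := h6 z.re z.im (by
      have := (ZMod.intCast_zmod_eq_zero_iff_dvd (z.re ^ 2 + z.im ^ 2) 4).2 (by exact_mod_cast h5)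
      exact_mod_cast this)
    have h8 : ∀ a : ℤ, 2 * (a : ZMod 4) = 0 → (2 : ℤ) ∣ a := by
      intro a ha
      have := (ZMod.intCast_zmod_eq_zero_iff_dvd (2 * a) 4).1 (by push_cast; exact ha)
      omega
    have := h2.isUnit_of_dvd' (h8 _ h7.1) (h8 _ h7.2)
    exact absurd this (by decide)

theorem minFac_mod_four_of_dvd {n p : ℕ} {z : GaussianInt} (hz : z ∈ primitiveOfNorm n)
    (hp : p ∈ n.primeFactors) (hodd : Odd p) : p % 4 = 1 := by
  have := (mod_four_of_mem_primitiveOfNorm hz).1 p hp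
  have := Nat.odd_iff.1 hodd
  omega

theorem card_primitiveOfNorm_le_nine {n : ℕ} (hn : n ≤ 2) : (primitiveOfNorm n).card ≤ 9 := by
  have h : (primitiveOfNorm n).card ≤
      (Finset.Icc (-1 : ℤ) 1 ×ˢ Finset.Icc (-1 : ℤ) 1).card := by
    refine Finset.card_le_card_of_injOn (fun z => (z.re, z.im)) (fun z hz => ?_)
      fun z _ z' _ h => ?_
    · have h1 := (mem_primitiveOfNorm.1 hz).1
      rw [Zsqrtd.norm_def] at h1
      have hn' : (n : ℤ) ≤ 2 := by exact_mod_cast hn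
      simp only [Finset.coe_product, Set.mem_prod, Finset.coe_Icc, Set.mem_Icc]
      refine ⟨⟨?_, ?_⟩, ?_, ?_⟩ <;> nlinarith [mul_self_nonneg z.im, mul_self_nonneg z.re]
    · simp only [Prod.mk.injEq] at h
      exact Zsqrtd.ext h.1 h.2
  simpa using h

/-! ### Moments of the number of primitive representations -/

open Finset in
theorem sum_le_sum_of_injOn {α β : Type*} {s : Finset α} {t : Finset β} {f : α → ℝ} {g : β → ℝ}
    (φ : α → β) (hφ : ∀ a ∈ s, φ a ∈ t) (hinj : Set.InjOn φ s) (hfg : ∀ a ∈ s, f a ≤ g (φ a))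
    (hg : ∀ b ∈ t, 0 ≤ g b) : ∑ a ∈ s, f a ≤ ∑ b ∈ t, g b := by
  classical
  calc ∑ a ∈ s, f a ≤ ∑ a ∈ s, g (φ a) := sum_le_sum hfg
    _ = ∑ b ∈ s.image φ, g b := (sum_image hinj).symm
    _ ≤ ∑ b ∈ t, g b := sum_le_sum_of_subset_of_nonneg
        (fun b hb => by obtain ⟨a, ha, rfl⟩ := mem_image.1 hb; exact hφ a ha) fun b hb _ => hg b hb

/-- The odd prime factors of `n`. -/
def oddPrimeFactors (n : ℕ) : Finset ℕ := {p ∈ n.primeFactors | Odd p}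

/-- Splitting off the full power of an odd prime from an `n` that is a primitive norm. -/
theorem ordProj_spec {n p : ℕ} (hp : p ∈ oddPrimeFactors n)
    (hn : (primitiveOfNorm n).Nonempty) :
    IsPrimePow (ordProj[p] n) ∧ (ordProj[p] n).minFac = p ∧ p % 4 = 1 ∧ 0 < ordCompl[p] n ∧
      ordCompl[p] n * ordProj[p] n = n ∧ omegaStar (ordCompl[p] n) + 1 = omegaStar n := by
  obtain ⟨z, hz⟩ := hn
  rw [oddPrimeFactors, Finset.mem_filter] at hp
  obtain ⟨hp1, hodd⟩ := hp
  obtain ⟨hpp, hpn, hn0⟩ := Nat.mem_primeFactors.1 hp1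
  have he : n.factorization p ≠ 0 := (hpp.factorization_pos_of_dvd hn0 hpn).ne'
  refine ⟨hpp.isPrimePow.pow he, hpp.pow_minFac he, minFac_mod_four_of_dvd hz hp1 hodd,
    Nat.ordCompl_pos p hn0, ?_, ?_⟩
  · rw [mul_comm]; exact Nat.ordProj_mul_ordCompl_eq_self n p
  · have h : (ordCompl[p] n).primeFactors = n.primeFactors.erase p := by
      rw [← Nat.support_factorization, Nat.factorization_ordCompl, Finsupp.support_erase,
        Nat.support_factorization]
    rw [omegaStar, omegaStar, h, Finset.filter_erase]
    exact Finset.card_erase_add_one (Finset.mem_filter.2 ⟨hp1, hodd⟩)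

open Finset in
/-- The sum of `#(primitiveOfNorm m) ^ ℓ / m` over the `m ≤ N` with `j` odd prime factors. -/
noncomputable def normSum (ℓ N j : ℕ) : ℝ :=
  ∑ m ∈ Ioc 0 N with omegaStar m = j, (#(primitiveOfNorm m) : ℝ) ^ ℓ / m

open Finset in
/-- The sum of the reciprocals of the powers `q ≤ N` of primes that are `1` modulo `4`. -/
noncomputable def primePowSum (N : ℕ) : ℝ :=
  ∑ q ∈ Ioc 0 N with IsPrimePow q ∧ q.minFac % 4 = 1, 1 / (q : ℝ)

open Finset in
theorem primePowSum_nonneg (N : ℕ) : 0 ≤ primePowSum N := sum_nonneg fun _ _ => by positivity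

-- Uses 0^ℓ = 0, so ℓ ≥ 1 is essential.
open Finset in
theorem normSum_eq {ℓ : ℕ} (hℓ : 1 ≤ ℓ) (N j : ℕ) : normSum ℓ N j =
    ∑ m ∈ Ioc 0 N with omegaStar m = j ∧ (primitiveOfNorm m).Nonempty,
      (#(primitiveOfNorm m) : ℝ) ^ ℓ / m := by
  rw [normSum, ← filter_filter]
  refine (sum_filter_of_ne fun m _ hm => ?_).symm
  by_contra h
  rw [not_nonempty_iff_eq_empty] at h
  rw [h, card_empty, Nat.cast_zero, zero_pow (by omega), zero_div] at hm
  exact hm rfl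

-- Only m = 1 and m = 2 contribute: such an m is a power of 2 not divisible by 4.
open Finset in
theorem normSum_zero_le {ℓ : ℕ} (hℓ : 1 ≤ ℓ) (N : ℕ) : normSum ℓ N 0 ≤ 2 * 9 ^ ℓ := by
  have h : normSum ℓ N 0 ≤ ∑ m ∈ ({1, 2} : Finset ℕ), (9 : ℝ) ^ ℓ := by
    rw [normSum_eq hℓ]
    have hm2 : ∀ m ∈ {m ∈ Ioc 0 N | omegaStar m = 0 ∧ (primitiveOfNorm m).Nonempty},
        m = 1 ∨ m = 2 := by
      intro m hm
      simp only [mem_filter, mem_Ioc] at hm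
      obtain ⟨⟨hm0, -⟩, hm1, z, hz⟩ := hm
      have h4 := (mod_four_of_mem_primitiveOfNorm hz).2
      rw [omegaStar, card_eq_zero, filter_eq_empty_iff] at hm1
      have hm3 : ∀ {p : ℕ}, p.Prime → p ∣ m → p = 2 := fun {p} hp hpm => by
        have := hm1 (Nat.mem_primeFactors.2 ⟨hp, hpm, hm0.ne'⟩)
        rcases hp.eq_two_or_odd' with h | h
        · exact h
        · exact absurd h this
      have h5 := Nat.eq_prime_pow_of_unique_prime_dvd hm0.ne' hm3
      generalize m.primeFactorsList.length = k at h5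
      match k, h5 with
      | 0, h5 => left; simpa using h5
      | 1, h5 => right; simpa using h5
      | k + 2, h5 => exact absurd ⟨2 ^ k, by rw [h5, pow_add, mul_comm]; norm_num⟩ h4
    refine sum_le_sum_of_injOn id (fun m hm => ?_) (Set.injOn_id _) (fun m hm => ?_)
      fun _ _ => by positivity
    · simpa using hm2 m hm
    · have h1 : (1 : ℝ) ≤ m := by rcases hm2 m hm with h | h <;> rw [h] <;> norm_num
      refine (div_le_self (by positivity) h1).trans ?_
      gcongr
      exact_mod_cast card_primitiveOfNorm_le_nine (by rcases hm2 m hm with h | h <;> omega)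
  refine h.trans_eq ?_
  simp [two_mul]

-- The factor j + 1 counts the odd primes p of m. Removing the full power q of p gives an injection
-- (m, p) ↦ (m/q, q), and the number of primitive elements drops by at most a factor 2.
open Finset in
theorem normSum_succ_le {ℓ : ℕ} (hℓ : 1 ≤ ℓ) (N j : ℕ) :
    (j + 1) * normSum ℓ N (j + 1) ≤ 2 ^ ℓ * primePowSum N * normSum ℓ N j := by
  classical
  set M : Finset ℕ := {m ∈ Ioc 0 N | omegaStar m = j + 1 ∧ (primitiveOfNorm m).Nonempty}
  have e1 : (j + 1) * normSum ℓ N (j + 1) =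
      ∑ x ∈ M.sigma fun m => oddPrimeFactors m, (#(primitiveOfNorm x.1) : ℝ) ^ ℓ / x.1 := by
    rw [sum_sigma, normSum_eq hℓ, mul_sum]
    refine sum_congr rfl fun m hm => ?_
    have : #(oddPrimeFactors m) = j + 1 := (mem_filter.1 hm).2.1
    simp only [sum_const, this, nsmul_eq_mul]
    push_cast; rfl
  have e2 : 2 ^ ℓ * primePowSum N * normSum ℓ N j =
      ∑ y ∈ {m ∈ Ioc 0 N | omegaStar m = j} ×ˢ {q ∈ Ioc 0 N | IsPrimePow q ∧ q.minFac % 4 = 1},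
        2 ^ ℓ * ((#(primitiveOfNorm y.1) : ℝ) ^ ℓ / y.1) * (1 / y.2) := by
    rw [sum_product, normSum, primePowSum, mul_assoc, mul_comm (∑ q ∈ _, _), sum_mul_sum, mul_sum]
    refine sum_congr rfl fun m _ => ?_
    rw [mul_sum]
    exact sum_congr rfl fun q _ => by ring
  rw [e1, e2]
  have hspec : ∀ x ∈ M.sigma fun m => oddPrimeFactors m, 0 < x.1 ∧ x.1 ≤ N ∧
      omegaStar x.1 = j + 1 ∧ IsPrimePow (ordProj[x.2] x.1) ∧ (ordProj[x.2] x.1).minFac = x.2 ∧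
      x.2 % 4 = 1 ∧ 0 < ordCompl[x.2] x.1 ∧ ordCompl[x.2] x.1 * ordProj[x.2] x.1 = x.1 ∧
      omegaStar (ordCompl[x.2] x.1) + 1 = omegaStar x.1 := by
    intro x hx
    rw [mem_sigma, mem_filter, mem_Ioc] at hx
    exact ⟨hx.1.1.1, hx.1.1.2, hx.1.2.1, ordProj_spec hx.2 hx.1.2.2⟩
  refine sum_le_sum_of_injOn (fun x => (ordCompl[x.2] x.1, ordProj[x.2] x.1))
    (fun x hx => ?_) (fun x hx x' hx' h => ?_) (fun x hx => ?_) fun _ _ => by positivity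
  · obtain ⟨h1, h2, h3, h4, h5, h6, h7, h8, h9⟩ := hspec x hx
    simp only [mem_product, mem_filter, mem_Ioc]
    exact ⟨⟨⟨h7, (Nat.ordCompl_le _ _).trans h2⟩, by omega⟩,
      ⟨h4.pos, (Nat.ordProj_le _ (by omega)).trans h2⟩, h4, by rw [h5, h6]⟩
  · obtain ⟨-, -, -, -, h5, -, -, h8, -⟩ := hspec x hx
    obtain ⟨-, -, -, -, h5', -, -, h8', -⟩ := hspec x' hx'
    simp only [Prod.mk.injEq] at h
    have a1 : x.1 = x'.1 := by rw [← h8, ← h8', h.1, h.2]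
    have a2 : x.2 = x'.2 := by rw [← h5, ← h5', h.2]
    exact Sigma.ext a1 (heq_of_eq a2)
  · obtain ⟨h1, h2, h3, h4, h5, h6, h7, h8, h9⟩ := hspec x hx
    have hc := card_primitiveOfNorm_mul_le (m := ordCompl[x.2] x.1) h4 (by rw [h5, h6])
    rw [h8] at hc
    have hc' : (#(primitiveOfNorm x.1) : ℝ) ≤ 2 * #(primitiveOfNorm (ordCompl[x.2] x.1)) := by
      exact_mod_cast hc
    have h8' : (x.1 : ℝ) = (ordCompl[x.2] x.1 : ℕ) * (ordProj[x.2] x.1 : ℕ) := by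
      exact_mod_cast h8.symm
    calc (#(primitiveOfNorm x.1) : ℝ) ^ ℓ / x.1
        ≤ (2 * #(primitiveOfNorm (ordCompl[x.2] x.1))) ^ ℓ / x.1 := by gcongr
      _ = _ := by
        rw [h8', mul_pow, ← div_div]
        ring

theorem normSum_le {ℓ : ℕ} (hℓ : 1 ≤ ℓ) (N j : ℕ) :
    normSum ℓ N j ≤ 2 * 9 ^ ℓ * ((2 ^ ℓ * primePowSum N) ^ j / (j.factorial : ℝ)) := by
  induction j with
  | zero => simpa using normSum_zero_le hℓ N
  | succ j ih =>
    have h1 := normSum_succ_le hℓ N j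
    have hP := primePowSum_nonneg N
    have hj : (0 : ℝ) < j + 1 := by positivity
    have h2 : (j + 1) * normSum ℓ N (j + 1) ≤
        2 ^ ℓ * primePowSum N * (2 * 9 ^ ℓ * ((2 ^ ℓ * primePowSum N) ^ j / (j.factorial : ℝ))) :=
      h1.trans (mul_le_mul_of_nonneg_left ih (by positivity))
    rw [← le_div_iff₀' hj] at h2
    refine h2.trans_eq ?_
    rw [Nat.factorial_succ]
    push_cast
    field_simp
    ring

/-! ### Tuples of representations with a fixed cofactor -/

-- Λ ≥ 1/2 on prime powers, and ψ - θ is O(√x).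
open ArithmeticFunction Finset in
theorem exists_card_primePow_not_prime_le :
    ∃ c : ℝ, 0 < c ∧ ∀ x : ℝ, 0 ≤ x → (#{q ∈ Ioc 0 ⌊x⌋₊ | IsPrimePow q ∧ ¬ q.Prime} : ℝ) ≤ c * √x := by
  obtain ⟨C, hC⟩ := Chebyshev.psi_sub_theta_le_mul_sqrt
  refine ⟨2 * |C| + 1, by positivity, fun x hx => ?_⟩
  have h := hC x
  rw [Chebyshev.psi_sub_theta_eq_sum_not_prime] at h
  have h1 : (#{q ∈ Ioc 0 ⌊x⌋₊ | IsPrimePow q ∧ ¬ q.Prime} : ℝ) * (1 / 2) ≤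
      ∑ n ∈ Ioc 0 ⌊x⌋₊ with ¬ n.Prime, vonMangoldt n := by
    rw [← nsmul_eq_mul, ← sum_const]
    refine sum_le_sum_of_injOn id (fun q hq => ?_) (Set.injOn_id _) (fun q hq => ?_)
      fun _ _ => vonMangoldt_nonneg
    · rw [mem_filter] at hq ⊢
      exact ⟨hq.1, hq.2.2⟩
    · have hq' := (mem_filter.1 hq).2.1
      rw [id, vonMangoldt_apply, if_pos hq']
      have h2 : (2 : ℝ) ≤ q.minFac := by exact_mod_cast (Nat.minFac_prime hq'.ne_one).two_le
      have := Real.log_le_log (by norm_num) h2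
      have := Real.log_two_gt_d9
      linarith
  have h3 : C * √x ≤ |C| * √x := by gcongr; exact le_abs_self C
  nlinarith [Real.sqrt_nonneg x]

/-- A Gaussian integer of norm `q`, for `q` a power of a prime that is `1` modulo `4`. -/
noncomputable def gaussOfPrimePow (q : ℕ) : GaussianInt :=
  open Classical in
  if h : IsPrimePow q ∧ q.minFac % 4 = 1 then (exists_gaussianInt_of_isPrimePow h.1 h.2).choose
  else 0

theorem gaussOfPrimePow_spec {q : ℕ} (hq : IsPrimePow q) (h4 : q.minFac % 4 = 1) :
    (gaussOfPrimePow q).norm = q ∧ ∀ z : GaussianInt, IsCoprime z.re z.im →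
      (q : ℤ) ∣ z.norm → gaussOfPrimePow q ∣ z ∨ star (gaussOfPrimePow q) ∣ z := by
  rw [gaussOfPrimePow, dif_pos ⟨hq, h4⟩]
  exact (exists_gaussianInt_of_isPrimePow hq h4).choose_spec

/-- The pairs counted by `rStar sumTwoSquares n`. -/
noncomputable def starPairs (n : ℕ) : Finset (ℕ × ℕ) :=
  ((repPairs_finite sumTwoSquares n).subset (Set.sep_subset _ fun q => Nat.gcd q.1 q.2 = 1)).toFinset

theorem mem_starPairs {n : ℕ} {q : ℕ × ℕ} : q ∈ starPairs n ↔
    (q.2 ∈ sumTwoSquares ∧ q.1 ^ 2 + q.2 ^ 2 = n) ∧ Nat.gcd q.1 q.2 = 1 := by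
  simp [starPairs, repPairs]

theorem card_starPairs (n : ℕ) : (starPairs n).card = rStar sumTwoSquares n := by
  exact (Set.ncard_eq_toFinset_card _ _).symm

theorem mk_mem_primitiveOfNorm {n : ℕ} {q : ℕ × ℕ} (hq : q ∈ starPairs n) :
    (⟨q.1, q.2⟩ : GaussianInt) ∈ primitiveOfNorm n := by
  rw [mem_starPairs] at hq
  rw [mem_primitiveOfNorm, Zsqrtd.norm_def]
  refine ⟨?_, ?_⟩
  · rw [← hq.1.2]; push_cast; ring
  · exact Nat.isCoprime_iff_coprime.2 hq.2

theorem rStar_le_card (n : ℕ) : rStar sumTwoSquares n ≤ (primitiveOfNorm n).card := by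
  rw [← card_starPairs]
  refine Finset.card_le_card_of_injOn (fun q => ⟨q.1, q.2⟩)
    (fun q hq => mk_mem_primitiveOfNorm hq) fun q _ q' _ h => ?_
  simp only [Zsqrtd.mk.injEq, Nat.cast_inj] at h
  exact Prod.ext h.1 h.2

/-- The tuple `α`, multiplied by a Gaussian integer of norm `q` or its conjugate according to `δ`,
consists of `ℓ` distinct representations of the kind counted by `rStar sumTwoSquares`. -/
def Admissible {ℓ : ℕ} (m q : ℕ) (x : (Fin ℓ → GaussianInt) × (Fin ℓ → Bool)) : Prop :=
  ∃ f : Fin ℓ → ℕ × ℕ, Function.Injective f ∧ ∀ j, f j ∈ starPairs (m * q) ∧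
    (⟨(f j).1, (f j).2⟩ : GaussianInt) =
      (if x.2 j then gaussOfPrimePow q else star (gaussOfPrimePow q)) * x.1 j

-- The ℓ-subsets are overcounted by injections of `Fin ℓ`. An injection is recovered from its
-- cofactors α_j and the choices between w and w̄.
open Finset in
open Classical in
theorem choose_rStar_le {ℓ m q : ℕ} (hq : IsPrimePow q) (h4 : q.minFac % 4 = 1) :
    (rStar sumTwoSquares (m * q)).choose ℓ ≤
      #{x ∈ Fintype.piFinset (fun _ : Fin ℓ => primitiveOfNorm m) ×ˢ
        (univ : Finset (Fin ℓ → Bool)) | Admissible m q x} := by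
  have h1 : (rStar sumTwoSquares (m * q)).choose ℓ ≤
      Fintype.card (Fin ℓ ↪ starPairs (m * q)) := by
    rw [Fintype.card_embedding_eq, Fintype.card_fin, Fintype.card_coe, card_starPairs,
      Nat.descFactorial_eq_factorial_mul_choose]
    exact Nat.le_mul_of_pos_left _ (Nat.factorial_pos _)
  refine h1.trans ?_
  obtain ⟨hw, hdvd⟩ := gaussOfPrimePow_spec hq h4
  set w := gaussOfPrimePow q with hwdef
  have hex : ∀ s : starPairs (m * q), ∃ α : GaussianInt, ∃ δ : Bool, α ∈ primitiveOfNorm m ∧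
      (⟨s.1.1, s.1.2⟩ : GaussianInt) = (if δ then w else star w) * α := by
    intro s
    have hz := mk_mem_primitiveOfNorm s.2
    have hz' := mem_primitiveOfNorm.1 hz
    rcases hdvd _ hz'.2 (by rw [hz'.1]; push_cast; exact dvd_mul_left _ _) with ⟨α, hα⟩ | ⟨α, hα⟩
    · exact ⟨α, true, mem_primitiveOfNorm_of_mul hq.pos hw (hα ▸ hz), by simpa using hα⟩
    · exact ⟨α, false, mem_primitiveOfNorm_of_mul hq.pos (by rw [Zsqrtd.norm_conj, hw]) (hα ▸ hz),
        by simpa using hα⟩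
  choose α δ hα hαδ using hex
  rw [← card_univ]
  refine card_le_card_of_injOn (fun f => (fun j => α (f j), fun j => δ (f j)))
    (fun f _ => ?_) (fun f _ f' _ h => ?_)
  · simp only [coe_filter, mem_product, Fintype.mem_piFinset, mem_univ, and_true,
      Set.mem_ofPred_eq]
    exact ⟨fun j => hα _, fun j => (f j).1, fun i j h => f.injective (Subtype.ext h),
      fun j => ⟨(f j).2, hαδ _⟩⟩
  · simp only [Prod.mk.injEq] at h
    refine DFunLike.ext _ _ fun j => Subtype.ext ?_
    have h1 := hαδ (f j)
    have h2 := hαδ (f' j)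
    rw [congrFun h.1 j, congrFun h.2 j, ← h2] at h1
    simp only [Zsqrtd.mk.injEq, Nat.cast_inj] at h1
    exact Prod.ext h1.1 h1.2

/-- Lagrange's identity (ac + bd)² + (ad - cb)² = m² forces ac + bd = ±m, the equality case of
Cauchy–Schwarz. -/
theorem eq_or_eq_neg_of_det_eq_zero {a b c d m : ℤ} (h1 : a ^ 2 + b ^ 2 = m)
    (h2 : c ^ 2 + d ^ 2 = m) (hdet : a * d - c * b = 0) :
    (a = c ∧ b = d) ∨ (a = -c ∧ b = -d) := by
  have h3 : (a * c + b * d - m) * (a * c + b * d + m) = 0 := by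
    linear_combination (-1) * (a * d - c * b) * hdet + (c ^ 2 + d ^ 2) * h1 + m * h2
  rcases mul_eq_zero.1 h3 with h | h
  · left
    have h4 : (a - c) ^ 2 + (b - d) ^ 2 = 0 := by linear_combination h1 + h2 - 2 * h
    constructor <;> nlinarith [sq_nonneg (a - c), sq_nonneg (b - d)]
  · right
    have h4 : (a + c) ^ 2 + (b + d) ^ 2 = 0 := by linear_combination h1 + h2 + 2 * h
    constructor <;> nlinarith [sq_nonneg (a + c), sq_nonneg (b + d)]

open Finset Filter in
open Classical in
/-- For a fixed cofactor, the number of admissible primes. -/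
theorem exists_card_admissible_prime_le (ℓ : ℕ) (hℓ : 1 ≤ ℓ) :
    ∃ K : ℝ, 0 < K ∧ ∀ᶠ L : ℝ in atTop,
    ∀ X : ℝ, 0 < X → Real.exp L / L ^ 2 ≤ Real.log X → Real.log X ≤ Real.exp L →
    ∀ m : ℕ, (m : ℝ) ≤ Real.exp (Real.exp L) →
    ∀ x : (Fin ℓ → GaussianInt) × (Fin ℓ → Bool), (∀ j, x.1 j ∈ primitiveOfNorm m) →
    (#{q ∈ Ioc 0 ⌊X⌋₊ | q.Prime ∧ q % 4 = 1 ∧ Admissible m q x} : ℝ) ≤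
      K * X * L ^ (3 * (ℓ + 1)) * Real.exp (-((ℓ + 1) / 2 * L)) := by
  obtain ⟨K, hK, h⟩ := exists_sieve_bound ℓ hℓ
  refine ⟨K, hK, ?_⟩
  filter_upwards [h, eventually_gt_atTop 0] with L hL hL0 X hX0 hXl hXu m hm x hx
  set Q : Finset ℕ := {q ∈ Ioc 0 ⌊X⌋₊ | q.Prime ∧ q % 4 = 1 ∧ Admissible m q x} with hQ
  -- One admissible q₀ is needed to see that the forms are pairwise non-proportional.
  rcases Q.eq_empty_or_nonempty with hQe | ⟨q₀, hq₀⟩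
  · rw [hQe, card_empty, Nat.cast_zero]
    positivity
  have hnorm : ∀ q ∈ Q, (gaussOfPrimePow q).norm = q := fun q hq => by
    obtain ⟨-, h1, h2, -⟩ := mem_filter.1 hq
    exact (gaussOfPrimePow_spec h1.isPrimePow (by rwa [h1.minFac_eq])).1
  -- The coefficients of Im(wα) or Im(w̄α) as a form in Re w and Im w; conjugating w changes the
  -- sign of the second.
  set c : Fin ℓ → ℤ := fun j => (x.1 j).im with hc
  set d : Fin ℓ → ℤ := fun j => if x.2 j then (x.1 j).re else -(x.1 j).re with hd
  have hcd : ∀ j, c j ^ 2 + d j ^ 2 = m := by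
    intro j
    rw [← (mem_primitiveOfNorm.1 (hx j)).1, Zsqrtd.norm_def, hc, hd]
    dsimp only
    split_ifs <;> ring
  have him : ∀ (q : ℕ) (j : Fin ℓ),
      ((if x.2 j then gaussOfPrimePow q else star (gaussOfPrimePow q)) * x.1 j).im =
        c j * (gaussOfPrimePow q).re + d j * (gaussOfPrimePow q).im := by
    intro q j
    rw [hc, hd]
    dsimp only
    split_ifs <;> simp [Zsqrtd.im_mul] <;> ring
  have habs : ∀ a b : ℤ, a ^ 2 + b ^ 2 = m → (|a| : ℝ) ≤ Real.exp (Real.exp L) := by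
    intro a b hab
    refine le_trans ?_ hm
    have h1 : |a| ≤ (m : ℤ) := by
      rcases eq_or_ne a 0 with rfl | h0
      · simp
      · have := Int.one_le_abs h0
        have h2 := sq_abs a
        nlinarith [sq_nonneg b]
    exact_mod_cast h1
  -- Proportional forms are equal up to sign. As b_i and b_j are nonnegative they would coincide,
  -- hence so would a_i and a_j, against distinctness.
  have hdet : ∀ i j, i ≠ j → c i * d j - c j * d i ≠ 0 := by
    intro i j hij h0
    obtain ⟨f, hf, hfx⟩ := (mem_filter.1 hq₀).2.2.2
    have e : ∀ j, ((f j).2 : ℤ) = c j * (gaussOfPrimePow q₀).re + d j * (gaussOfPrimePow q₀).im := by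
      intro j
      rw [← him, ← (hfx j).2]
    have h2 : (f i).2 = (f j).2 := by
      have hi := e i
      have hj := e j
      rcases eq_or_eq_neg_of_det_eq_zero (hcd i) (hcd j) h0 with ⟨h1, h2⟩ | ⟨h1, h2⟩
      · rw [h1, h2, ← hj] at hi
        exact_mod_cast hi
      · rw [h1, h2] at hi
        have : ((f i).2 : ℤ) = -((f j).2 : ℤ) := by rw [hi, hj]; ring
        omega
    have hi := (mem_starPairs.1 (hfx i).1).1.2
    have hj := (mem_starPairs.1 (hfx j).1).1.2
    have h1 : (f i).1 = (f j).1 := by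
      rw [h2] at hi
      have : (f i).1 ^ 2 = (f j).1 ^ 2 := by omega
      exact Nat.pow_left_injective two_ne_zero this
    exact hij (hf (Prod.ext h1 h2))
  have hcard : #Q = #(Q.image fun q => ((gaussOfPrimePow q).re, (gaussOfPrimePow q).im)) := by
    rw [card_image_of_injOn]
    intro q hq q' hq' h
    simp only [Prod.mk.injEq] at h
    have h1 : gaussOfPrimePow q = gaussOfPrimePow q' := Zsqrtd.ext h.1 h.2
    have h2 := hnorm q hq
    rw [h1, hnorm q' hq'] at h2
    exact_mod_cast h2.symm
  rw [hcard]
  refine hL X hX0 hXl hXu c d (fun j => habs _ _ (hcd j))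
    (fun j => habs _ _ (by rw [add_comm]; exact hcd j)) hdet _ fun y hy => ?_
  obtain ⟨q, hq, rfl⟩ := mem_image.1 hy
  have hq1 := mem_filter.1 hq
  have hn : (gaussOfPrimePow q).re ^ 2 + (gaussOfPrimePow q).im ^ 2 = q := by
    rw [← hnorm q hq, Zsqrtd.norm_def]; ring
  refine ⟨?_, ?_, fun j => ?_⟩
  · dsimp only
    rw [hn]
    simpa using hq1.2.1
  · have h1 : ((gaussOfPrimePow q).re : ℝ) ^ 2 + ((gaussOfPrimePow q).im : ℝ) ^ 2 = q := by
      exact_mod_cast hn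
    dsimp only
    rw [h1]
    exact (Nat.cast_le.2 (mem_Ioc.1 hq1.1).2).trans (Nat.floor_le hX0.le)
  · obtain ⟨f, -, hfx⟩ := hq1.2.2.2
    dsimp only
    rw [← him, ← (hfx j).2]
    simpa using (mem_starPairs.1 (hfx j).1).1.1

open Finset Filter in
/-- For a fixed cofactor `m`, the contribution of the `n = m * q`. -/
theorem exists_sum_choose_rStar_le (ℓ : ℕ) (hℓ : 1 ≤ ℓ) :
    ∃ K : ℝ, 0 < K ∧ ∀ᶠ L : ℝ in atTop,
    ∀ X : ℝ, 0 < X → Real.exp L / L ^ 2 ≤ Real.log X → Real.log X ≤ Real.exp L →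
    ∀ m : ℕ, (m : ℝ) ≤ Real.exp (Real.exp L) →
    ∑ q ∈ Ioc 0 ⌊X⌋₊ with IsPrimePow q ∧ q.minFac % 4 = 1,
        ((rStar sumTwoSquares (m * q)).choose ℓ : ℝ) ≤
      2 ^ ℓ * (#(primitiveOfNorm m) : ℝ) ^ ℓ *
        (K * X * L ^ (3 * (ℓ + 1)) * Real.exp (-((ℓ + 1) / 2 * L))) := by
  classical
  obtain ⟨K, hK, h⟩ := exists_card_admissible_prime_le ℓ hℓ
  obtain ⟨c, hc, hcX⟩ := exists_card_primePow_not_prime_le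
  refine ⟨K + c, by positivity, ?_⟩
  filter_upwards [h, eventually_ge_atTop 1, eventually_mul_pow_le_exp (ℓ + 1) 3] with
    L hL hL1 hE X hX0 hXl hXu m hm
  set Q : Finset ℕ := {q ∈ Ioc 0 ⌊X⌋₊ | IsPrimePow q ∧ q.minFac % 4 = 1}
  set T : Finset ((Fin ℓ → GaussianInt) × (Fin ℓ → Bool)) :=
    Fintype.piFinset (fun _ : Fin ℓ => primitiveOfNorm m) ×ˢ (univ : Finset (Fin ℓ → Bool)) with hT
  have hTc : (#T : ℝ) = 2 ^ ℓ * (#(primitiveOfNorm m) : ℝ) ^ ℓ := by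
    rw [hT, card_product, Fintype.card_piFinset_const]
    simp
    ring
  set B : ℝ := X * L ^ (3 * (ℓ + 1)) * Real.exp (-((ℓ + 1) / 2 * L)) with hB
  have hsqrt : √X ≤ B := by
    have h1 : 1 ≤ √X * Real.exp (-((ℓ + 1) / 2 * L)) := by
      rw [Real.sqrt_eq_rpow, Real.rpow_def_of_pos hX0, ← Real.exp_add]
      refine Real.one_le_exp ?_
      have h2 : (ℓ + 1) * L ≤ Real.log X := by
        refine le_trans ?_ hXl
        rw [le_div_iff₀ (by positivity)]
        calc _ = (ℓ + 1) * L ^ 3 := by ring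
          _ ≤ _ := hE
      linarith
    have h2 : 1 ≤ L ^ (3 * (ℓ + 1)) := one_le_pow₀ hL1
    calc √X ≤ √X * (√X * Real.exp (-((ℓ + 1) / 2 * L))) :=
          le_mul_of_one_le_right (Real.sqrt_nonneg X) h1
      _ = (√X * √X) * 1 * Real.exp (-((ℓ + 1) / 2 * L)) := by ring
      _ ≤ (√X * √X) * L ^ (3 * (ℓ + 1)) * Real.exp (-((ℓ + 1) / 2 * L)) := by gcongr
      _ = B := by rw [Real.mul_self_sqrt hX0.le]
  have hx : ∀ x ∈ T, (#{q ∈ Q | Admissible m q x} : ℝ) ≤ (K + c) * B := by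
    intro x hx
    rw [hT, mem_product, Fintype.mem_piFinset] at hx
    have h1 := hL X hX0 hXl hXu m hm x hx.1
    have h2 := hcX X hX0.le
    -- The sieve handles prime q; proper prime powers are simply counted.
    have h3 : {q ∈ Q | Admissible m q x} ⊆
        {q ∈ Ioc 0 ⌊X⌋₊ | q.Prime ∧ q % 4 = 1 ∧ Admissible m q x} ∪
        {q ∈ Ioc 0 ⌊X⌋₊ | IsPrimePow q ∧ ¬ q.Prime} := by
      intro q hq
      obtain ⟨hq1, hq2⟩ := mem_filter.1 hq
      obtain ⟨hq3, hq4, hq5⟩ := mem_filter.1 hq1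
      rw [mem_union, mem_filter, mem_filter]
      by_cases hp : q.Prime
      · exact Or.inl ⟨hq3, hp, by rwa [hp.minFac_eq] at hq5, hq2⟩
      · exact Or.inr ⟨hq3, hq4, hp⟩
    have h4 : (#{q ∈ Q | Admissible m q x} : ℝ) ≤
        #{q ∈ Ioc 0 ⌊X⌋₊ | q.Prime ∧ q % 4 = 1 ∧ Admissible m q x} +
        #{q ∈ Ioc 0 ⌊X⌋₊ | IsPrimePow q ∧ ¬ q.Prime} := by
      exact_mod_cast (card_le_card h3).trans (card_union_le _ _)
    have h5 : c * √X ≤ c * B := by gcongr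
    have h6 : K * X * L ^ (3 * (ℓ + 1)) * Real.exp (-((ℓ + 1) / 2 * L)) = K * B := by
      rw [hB]; ring
    linarith
  calc ∑ q ∈ Q, ((rStar sumTwoSquares (m * q)).choose ℓ : ℝ)
      ≤ ∑ q ∈ Q, (#{x ∈ T | Admissible m q x} : ℝ) := by
        refine sum_le_sum fun q hq => ?_
        obtain ⟨-, hq4, hq5⟩ := mem_filter.1 hq
        exact_mod_cast choose_rStar_le hq4 hq5
    _ = ∑ x ∈ T, (#{q ∈ Q | Admissible m q x} : ℝ) := by
        simp only [card_filter]
        push_cast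
        exact sum_comm
    _ ≤ ∑ x ∈ T, (K + c) * B := sum_le_sum hx
    _ = _ := by rw [sum_const, nsmul_eq_mul, hTc, hB]; ring

/-! ### Splitting off a large prime power and conclusion -/

/-- A primitive norm is at most twice the product of its odd prime powers. -/
theorem le_two_mul_prod_ordProj {n : ℕ} (hn : n ≠ 0) (h : (primitiveOfNorm n).Nonempty) :
    n ≤ 2 * ∏ p ∈ oddPrimeFactors n, ordProj[p] n := by
  obtain ⟨z, hz⟩ := h
  have h1 : ∏ p ∈ n.primeFactors, ordProj[p] n = n := Nat.prod_factorization_pow_eq_self hn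
  rw [← Finset.prod_filter_mul_prod_filter_not n.primeFactors (fun p => Odd p)] at h1
  have h2 : ∏ p ∈ n.primeFactors with ¬ Odd p, ordProj[p] n ≤ 2 := by
    have h3 : {p ∈ n.primeFactors | ¬ Odd p} ⊆ {2} := by
      intro p hp
      obtain ⟨hp1, hp2⟩ := Finset.mem_filter.1 hp
      have := (Nat.prime_of_mem_primeFactors hp1).eq_two_or_odd'
      simp only [Finset.mem_singleton]
      tauto
    have h4 : n.factorization 2 ≤ 1 := by
      by_contra h
      refine (mod_four_of_mem_primitiveOfNorm hz).2 ((?_ : 4 ∣ ordProj[2] n).trans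
        (Nat.ordProj_dvd n 2))
      exact pow_dvd_pow 2 (by omega : 2 ≤ n.factorization 2)
    rcases Finset.subset_singleton_iff.1 h3 with h5 | h5 <;> rw [h5]
    · simp
    · rw [Finset.prod_singleton]
      calc 2 ^ n.factorization 2 ≤ 2 ^ 1 := Nat.pow_le_pow_right (by norm_num) h4
        _ = 2 := by norm_num
  calc n = _ := h1.symm
    _ ≤ (∏ p ∈ n.primeFactors with Odd p, ordProj[p] n) * 2 := Nat.mul_le_mul_left _ h2
    _ = _ := mul_comm _ _

/-- If all k odd prime powers were below Q, then n would be at most 2Q^k. -/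
theorem exists_large_ordProj {n k : ℕ} (hn : n ≠ 0) (h : (primitiveOfNorm n).Nonempty)
    (hk : omegaStar n = k) {Q : ℝ} (hQ : 2 * Q ^ k < n) :
    ∃ p ∈ oddPrimeFactors n, Q ≤ (ordProj[p] n : ℕ) := by
  by_contra! hcon
  have h1 : (n : ℝ) ≤ 2 * ∏ p ∈ oddPrimeFactors n, ((ordProj[p] n : ℕ) : ℝ) := by
    exact_mod_cast le_two_mul_prod_ordProj hn h
  have h2 : ∏ p ∈ oddPrimeFactors n, ((ordProj[p] n : ℕ) : ℝ) ≤ Q ^ k := by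
    rw [← hk]
    calc _ ≤ ∏ p ∈ oddPrimeFactors n, Q :=
          Finset.prod_le_prod (fun _ _ => by positivity) fun p hp => (hcon p hp).le
      _ = _ := by rw [Finset.prod_const]; rfl
  linarith

-- Rankin's trick: 1 ≤ y/n for n ≤ y.
open Finset in
theorem sum_choose_rStar_small_le (ℓ k N : ℕ) {y : ℝ} (hy : 0 ≤ y) :
    ∑ n ∈ Ioc 0 N with omegaStar n = k ∧ (n : ℝ) ≤ y,
      ((rStar sumTwoSquares n).choose ℓ : ℝ) ≤ y * normSum ℓ N k := by
  rw [normSum, mul_sum]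
  refine sum_le_sum_of_injOn id (fun n hn => ?_) (Set.injOn_id _) (fun n hn => ?_)
    fun _ _ => by positivity
  · rw [mem_filter] at hn ⊢
    exact ⟨hn.1, hn.2.1⟩
  · obtain ⟨h1, -, h2⟩ := mem_filter.1 hn
    have hn0 : (0 : ℝ) < n := by exact_mod_cast (mem_Ioc.1 h1).1
    have h3 : ((rStar sumTwoSquares n).choose ℓ : ℝ) ≤ (#(primitiveOfNorm n) : ℝ) ^ ℓ := by
      have := (Nat.choose_le_pow (rStar sumTwoSquares n) ℓ).trans
        (Nat.pow_le_pow_left (rStar_le_card n) ℓ)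
      exact_mod_cast this
    calc _ ≤ (#(primitiveOfNorm n) : ℝ) ^ ℓ := h3
      _ = n * ((#(primitiveOfNorm n) : ℝ) ^ ℓ / n) := by field_simp
      _ ≤ _ := by simp only [id]; gcongr

open Finset in
/-- Splitting off a large prime power from `n`. -/
theorem sum_choose_rStar_large_le {ℓ k : ℕ} (hℓ : 1 ≤ ℓ) {x y Q B : ℝ} (hx : 0 < x)
    (hB : 0 ≤ B) (hQy : 2 * Q ^ (k + 1) ≤ y)
    (h : ∀ m : ℕ, 0 < m → (m : ℝ) ≤ x → Q ≤ x / m →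
      ∑ q ∈ Ioc 0 ⌊x / m⌋₊ with IsPrimePow q ∧ q.minFac % 4 = 1,
        ((rStar sumTwoSquares (m * q)).choose ℓ : ℝ) ≤
      (#(primitiveOfNorm m) : ℝ) ^ ℓ * (B * (x / m))) :
    ∑ n ∈ Ioc 0 ⌊x⌋₊ with omegaStar n = k + 1 ∧ ¬ (n : ℝ) ≤ y,
      ((rStar sumTwoSquares n).choose ℓ : ℝ) ≤ B * x * normSum ℓ ⌊x⌋₊ k := by
  classical
  set F : Finset ℕ := {n ∈ Ioc 0 ⌊x⌋₊ | omegaStar n = k + 1 ∧ ¬ (n : ℝ) ≤ y} with hF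
  have hFsum : ∑ n ∈ F, ((rStar sumTwoSquares n).choose ℓ : ℝ) =
      ∑ n ∈ F with (primitiveOfNorm n).Nonempty, ((rStar sumTwoSquares n).choose ℓ : ℝ) := by
    refine (sum_filter_of_ne fun n _ hn => ?_).symm
    by_contra h
    rw [not_nonempty_iff_eq_empty] at h
    have h1 := rStar_le_card n
    rw [h, card_empty] at h1
    rw [Nat.le_zero.1 h1, Nat.choose_eq_zero_of_lt (by omega), Nat.cast_zero] at hn
    exact hn rfl
  have hex : ∀ n : ℕ, ∃ p : ℕ, n ∈ {n ∈ F | (primitiveOfNorm n).Nonempty} →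
      p ∈ oddPrimeFactors n ∧ Q ≤ (ordProj[p] n : ℕ) := by
    intro n
    by_cases hn : n ∈ {n ∈ F | (primitiveOfNorm n).Nonempty}
    · obtain ⟨h1, h2⟩ := mem_filter.1 hn
      obtain ⟨h3, h4, h5⟩ := mem_filter.1 h1
      obtain ⟨p, hp⟩ := exists_large_ordProj (mem_Ioc.1 h3).1.ne' h2 h4
        (hQy.trans_lt (not_le.1 h5))
      exact ⟨p, fun _ => hp⟩
    · exact ⟨0, fun h => absurd h hn⟩
  choose π hπ using hex
  set M : Finset ℕ := {m ∈ Ioc 0 ⌊x⌋₊ | omegaStar m = k ∧ Q ≤ x / m} with hM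
  set S : ℕ → Finset ℕ := fun m => {q ∈ Ioc 0 ⌊x / m⌋₊ | IsPrimePow q ∧ q.minFac % 4 = 1}
  have hspec : ∀ n ∈ {n ∈ F | (primitiveOfNorm n).Nonempty}, 0 < n ∧ (n : ℝ) ≤ x ∧
      omegaStar n = k + 1 ∧ Q ≤ (ordProj[π n] n : ℕ) ∧
      IsPrimePow (ordProj[π n] n) ∧ (ordProj[π n] n).minFac = π n ∧ π n % 4 = 1 ∧
      0 < ordCompl[π n] n ∧ ordCompl[π n] n * ordProj[π n] n = n ∧
      omegaStar (ordCompl[π n] n) + 1 = omegaStar n := by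
    intro n hn
    obtain ⟨h1, h2⟩ := mem_filter.1 hn
    obtain ⟨h3, h4, h5⟩ := mem_filter.1 h1
    obtain ⟨h6, h7⟩ := hπ n hn
    rw [mem_Ioc] at h3
    exact ⟨h3.1, (Nat.le_floor_iff hx.le).1 h3.2, h4, h7, ordProj_spec h6 h2⟩
  rw [hFsum]
  calc _ ≤ ∑ y ∈ M.sigma S, ((rStar sumTwoSquares (y.1 * y.2)).choose ℓ : ℝ) := by
        refine sum_le_sum_of_injOn (fun n => ⟨ordCompl[π n] n, ordProj[π n] n⟩)
          (fun n hn => ?_) (fun n hn n' hn' e => ?_) (fun n hn => ?_) fun _ _ => by positivity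
        · obtain ⟨h1, h2, h3, h4, h5, h6, h7, h8, h9, h10⟩ := hspec n hn
          have h8' : (0 : ℝ) < (ordCompl[π n] n : ℕ) := by exact_mod_cast h8
          have h11 : ((ordProj[π n] n : ℕ) : ℝ) ≤ x / (ordCompl[π n] n : ℕ) := by
            rw [le_div_iff₀ h8']
            refine le_trans (le_of_eq ?_) h2
            rw [mul_comm]
            exact_mod_cast h9
          simp only [S, mem_sigma, mem_filter, mem_Ioc, hM]
          refine ⟨⟨⟨h8, Nat.le_floor ?_⟩, by omega, h4.trans h11⟩,
            ⟨h5.pos, Nat.le_floor h11⟩, h5, by rw [h6, h7]⟩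
          exact (Nat.cast_le.2 (Nat.ordCompl_le _ _)).trans h2
        · obtain ⟨-, -, -, -, -, -, -, -, h9, -⟩ := hspec n hn
          obtain ⟨-, -, -, -, -, -, -, -, h9', -⟩ := hspec n' hn'
          simp only [Sigma.mk.injEq, heq_eq_eq] at e
          rw [← h9, ← h9', e.1, e.2]
        · obtain ⟨-, -, -, -, -, -, -, -, h9, -⟩ := hspec n hn
          dsimp only
          rw [h9]
    _ = ∑ m ∈ M, ∑ q ∈ S m, ((rStar sumTwoSquares (m * q)).choose ℓ : ℝ) := sum_sigma _ _ _
    _ ≤ ∑ m ∈ M, (#(primitiveOfNorm m) : ℝ) ^ ℓ * (B * (x / m)) := by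
        refine sum_le_sum fun m hm => ?_
        obtain ⟨h1, -, h3⟩ := mem_filter.1 hm
        rw [mem_Ioc] at h1
        exact h m h1.1 ((Nat.le_floor_iff hx.le).1 h1.2) h3
    _ = ∑ m ∈ M, B * x * ((#(primitiveOfNorm m) : ℝ) ^ ℓ / m) :=
        sum_congr rfl fun m _ => by ring
    _ ≤ ∑ m ∈ Ioc 0 ⌊x⌋₊ with omegaStar m = k, B * x * ((#(primitiveOfNorm m) : ℝ) ^ ℓ / m) := by
        refine sum_le_sum_of_subset_of_nonneg (fun m hm => ?_) fun _ _ _ => by positivity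
        obtain ⟨h1, h2, -⟩ := mem_filter.1 hm
        exact mem_filter.2 ⟨h1, h2⟩
    _ = _ := by rw [← mul_sum, normSum]

open Finset in
/-- There is no large primitive norm without odd prime factors. -/
theorem sum_choose_rStar_large_eq_zero {ℓ : ℕ} (hℓ : 1 ≤ ℓ) {N : ℕ} {y : ℝ} (hy : 2 ≤ y) :
    ∑ n ∈ Ioc 0 N with omegaStar n = 0 ∧ ¬ (n : ℝ) ≤ y,
      ((rStar sumTwoSquares n).choose ℓ : ℝ) = 0 := by
  refine sum_eq_zero fun n hn => ?_
  obtain ⟨h1, h2, h3⟩ := mem_filter.1 hn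
  rcases (primitiveOfNorm n).eq_empty_or_nonempty with h | h
  · have h4 := rStar_le_card n
    rw [h, card_empty] at h4
    rw [Nat.le_zero.1 h4, Nat.choose_eq_zero_of_lt (by omega), Nat.cast_zero]
  · exfalso
    have h4 := le_two_mul_prod_ordProj (mem_Ioc.1 h1).1.ne' h
    have h5 : oddPrimeFactors n = ∅ := card_eq_zero.1 h2
    rw [h5, prod_empty, mul_one] at h4
    have : (n : ℝ) ≤ 2 := by exact_mod_cast h4
    linarith

open Filter in
/-- Upper bound for `normSum` in terms of `L = log (log x)`. -/
theorem exists_normSum_le {ℓ : ℕ} (hℓ : 1 ≤ ℓ) {C : ℝ} (hC : 0 < C) : ∀ᶠ L : ℝ in atTop,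
    ∀ j : ℕ, (j : ℝ) ≤ C * L → normSum ℓ ⌊Real.exp (Real.exp L)⌋₊ j ≤
      2 * 9 ^ ℓ * L * ((2 ^ (ℓ - 1) * L) ^ j / (j.factorial : ℝ)) := by
  obtain ⟨c, hc⟩ := exists_sum_one_div_primePow_le
  filter_upwards [eventually_ge_atTop (2 : ℝ),
    eventually_ge_atTop (Real.exp (2 * |c| * C))] with L hL2 hLc j hj
  have hL0 : 0 < L := by linarith
  set N := ⌊Real.exp (Real.exp L)⌋₊ with hN
  have hexp : 3 ≤ Real.exp L := by linarith [Real.add_one_le_exp L]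
  have hN4 : 4 ≤ N := Nat.le_floor (by push_cast; linarith [Real.add_one_le_exp (Real.exp L)])
  have hN0 : (0 : ℝ) < N := by exact_mod_cast (by omega : 0 < N)
  have hlogN : Real.log N ≤ Real.exp L := by
    rw [Real.log_le_iff_le_exp hN0]
    exact Nat.floor_le (Real.exp_pos _).le
  have hlogN0 : 0 < Real.log N := Real.log_pos (by exact_mod_cast (by omega : 1 < N))
  have hP : primePowSum N ≤ 1 / 2 * L + |c| := by
    refine (hc N hN4).trans (add_le_add ?_ (le_abs_self c))
    have := Real.log_le_log hlogN0 hlogN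
    rw [Real.log_exp] at this
    linarith
  have h2 : (2 : ℝ) ^ ℓ = 2 ^ (ℓ - 1) * 2 := by
    rw [← pow_succ]; congr 1; omega
  have h3 : 2 ^ ℓ * primePowSum N ≤ 2 ^ (ℓ - 1) * L * (1 + 2 * |c| / L) := by
    calc _ ≤ 2 ^ ℓ * (1 / 2 * L + |c|) := by gcongr
      _ = _ := by rw [h2]; field_simp
  -- Bounded by a constant depending on C, because j ≤ CL; spending one factor L keeps the final
  -- constant independent of C.
  have h4 : (1 + 2 * |c| / L) ^ j ≤ L := by
    calc (1 + 2 * |c| / L) ^ j ≤ Real.exp (2 * |c| / L) ^ j := by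
          gcongr
          linarith [Real.add_one_le_exp (2 * |c| / L)]
      _ = Real.exp (j * (2 * |c| / L)) := (Real.exp_nat_mul _ _).symm
      _ ≤ Real.exp (2 * |c| * C) := by
          rw [Real.exp_le_exp]
          calc j * (2 * |c| / L) ≤ C * L * (2 * |c| / L) := by gcongr
            _ = _ := by field_simp
      _ ≤ L := hLc
  have hP0 := primePowSum_nonneg N
  refine (normSum_le hℓ N j).trans ?_
  calc 2 * 9 ^ ℓ * ((2 ^ ℓ * primePowSum N) ^ j / (j.factorial : ℝ))
      ≤ 2 * 9 ^ ℓ * ((2 ^ (ℓ - 1) * L * (1 + 2 * |c| / L)) ^ j / (j.factorial : ℝ)) := by gcongr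
    _ = 2 * 9 ^ ℓ * (1 + 2 * |c| / L) ^ j * ((2 ^ (ℓ - 1) * L) ^ j / (j.factorial : ℝ)) := by
        rw [mul_pow _ (1 + _)]; ring
    _ ≤ _ := by gcongr

open Finset Filter in
theorem mainTheorem1 (ℓ : ℕ) (hℓ : 1 ≤ ℓ) :
    ∃ A K : ℝ, 0 < A ∧ 0 < K ∧ ∀ C : ℝ, 0 < C → ∃ x₀ : ℝ, ∀ x : ℝ, x₀ < x → ∀ k : ℕ,
      (k : ℝ) ≤ C * Real.log (Real.log x) →
        ∑ n ∈ Finset.Icc 1 ⌊x⌋₊ with omegaStar n = k,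
            ((rStar sumTwoSquares n).choose ℓ : ℝ) ≤
          K * (x * Real.log (Real.log x) ^ A / √(Real.log x) ^ (ℓ + 1) *
            ((2 ^ (ℓ - 1) * Real.log (Real.log x)) ^ k / (Nat.factorial k : ℝ))) := by
  obtain ⟨K, hK, hmain⟩ := exists_sum_choose_rStar_le ℓ hℓ
  -- The exponent is 3(ℓ + 1) from the sieve, plus 1 from `exists_normSum_le`, plus 1 for passing
  -- from k to k + 1.
  refine ⟨((3 * (ℓ + 1) + 2 : ℕ) : ℝ), (2 ^ ℓ * K + 1) * (2 * 9 ^ ℓ), by positivity,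
    by positivity, fun C hC => ?_⟩
  have hev : ∀ᶠ L : ℝ in atTop, ∀ k : ℕ, (k : ℝ) ≤ C * L →
      ∑ n ∈ Ioc 0 ⌊Real.exp (Real.exp L)⌋₊ with omegaStar n = k,
        ((rStar sumTwoSquares n).choose ℓ : ℝ) ≤
      (2 ^ ℓ * K + 1) * (2 * 9 ^ ℓ) * (Real.exp (Real.exp L) * L ^ (3 * (ℓ + 1) + 2) *
        Real.exp (-((ℓ + 1) / 2 * L)) * ((2 ^ (ℓ - 1) * L) ^ k / (k.factorial : ℝ))) := by
    filter_upwards [hmain, exists_normSum_le hℓ hC, eventually_ge_atTop (4 : ℝ),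
      eventually_ge_atTop (4 * C), eventually_mul_pow_le_exp (ℓ + 1) 1] with
      L hL hS hL4 hLC hE k hk
    have hL0 : 0 < L := by linarith
    have hexp : 5 ≤ Real.exp L := by linarith [Real.add_one_le_exp L]
    set x := Real.exp (Real.exp L) with hx
    have hx0 : 0 < x := Real.exp_pos _
    set y := Real.exp (Real.exp L / 2) with hy
    have hy2 : 2 ≤ y := by linarith [Real.add_one_le_exp (Real.exp L / 2)]
    set g := Real.exp (-((ℓ + 1) / 2 * L)) with hg
    set W := (2 ^ (ℓ - 1) * L) ^ k / (k.factorial : ℝ) with hW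
    have hW0 : 0 ≤ W := by positivity
    have hyx : y ≤ x * g := by
      rw [hy, hx, hg, ← Real.exp_add, Real.exp_le_exp]
      linarith
    have hsplit : ∑ n ∈ Ioc 0 ⌊x⌋₊ with omegaStar n = k,
          ((rStar sumTwoSquares n).choose ℓ : ℝ) =
        ∑ n ∈ Ioc 0 ⌊x⌋₊ with omegaStar n = k ∧ (n : ℝ) ≤ y,
          ((rStar sumTwoSquares n).choose ℓ : ℝ) +
        ∑ n ∈ Ioc 0 ⌊x⌋₊ with omegaStar n = k ∧ ¬ (n : ℝ) ≤ y,
          ((rStar sumTwoSquares n).choose ℓ : ℝ) := by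
      rw [← filter_filter, ← filter_filter, sum_filter_add_sum_filter_not]
    have hsmall : ∑ n ∈ Ioc 0 ⌊x⌋₊ with omegaStar n = k ∧ (n : ℝ) ≤ y,
          ((rStar sumTwoSquares n).choose ℓ : ℝ) ≤ x * g * (2 * 9 ^ ℓ * L * W) := by
      refine (sum_choose_rStar_small_le ℓ k _ (by linarith)).trans ?_
      calc y * normSum ℓ ⌊x⌋₊ k ≤ y * (2 * 9 ^ ℓ * L * W) := by
            refine mul_le_mul_of_nonneg_left (hS k hk) (by linarith)
        _ ≤ _ := by gcongr
    have hlarge : ∑ n ∈ Ioc 0 ⌊x⌋₊ with omegaStar n = k ∧ ¬ (n : ℝ) ≤ y,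
          ((rStar sumTwoSquares n).choose ℓ : ℝ) ≤
        2 ^ ℓ * K * L ^ (3 * (ℓ + 1)) * g * x * (2 * 9 ^ ℓ * L * (L * W)) := by
      rcases k with _ | k
      · rw [sum_choose_rStar_large_eq_zero hℓ hy2]
        positivity
      · have hk' : (k : ℝ) + 1 ≤ C * L := by exact_mod_cast hk
        -- Q = x^(1/L²) and y = √x. Since k + 1 ≤ CL and L ≥ 4C, Q^(k+1) ≤ x^(1/4), which leaves
        -- room for the factor 2.
        have hlarge' := sum_choose_rStar_large_le (k := k) (x := x) (y := y)
          (Q := Real.exp (Real.exp L / L ^ 2)) (B := 2 ^ ℓ * K * L ^ (3 * (ℓ + 1)) * g)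
          hℓ hx0 (by positivity) ?_ ?_
        · refine hlarge'.trans (mul_le_mul_of_nonneg_left ?_ (by positivity))
          refine (hS k (by linarith)).trans ?_
          -- The ratio of consecutive terms costs (k + 1)/(2^(ℓ-1) L) ≤ C, which one factor L
          -- absorbs for large L.
          have h1 : (2 ^ (ℓ - 1) * L) ^ k / (k.factorial : ℝ) ≤ L * W := by
            have e : L * W = (2 ^ (ℓ - 1) * L) ^ k / (k.factorial : ℝ) *
                (2 ^ (ℓ - 1) * L * L / (k + 1)) := by
              rw [hW, Nat.factorial_succ, pow_succ]
              push_cast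
              field_simp
            rw [e]
            refine le_mul_of_one_le_right (by positivity) ?_
            rw [le_div_iff₀ (by positivity), one_mul]
            have h2 : (1 : ℝ) ≤ 2 ^ (ℓ - 1) := one_le_pow₀ (by norm_num)
            calc (k : ℝ) + 1 ≤ C * L := hk'
              _ ≤ 1 * L * L := by
                rw [one_mul]
                gcongr
                linarith
              _ ≤ 2 ^ (ℓ - 1) * L * L := by gcongr
          gcongr
        · have h1 : (2 : ℝ) ≤ Real.exp 1 := by linarith [Real.add_one_le_exp (1 : ℝ)]
          calc 2 * Real.exp (Real.exp L / L ^ 2) ^ (k + 1)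
              ≤ Real.exp 1 * Real.exp (Real.exp L / L ^ 2) ^ (k + 1) := by gcongr
            _ = Real.exp (1 + (k + 1) * (Real.exp L / L ^ 2)) := by
                rw [← Real.exp_nat_mul, ← Real.exp_add]
                push_cast; rfl
            _ ≤ y := by
                rw [hy, Real.exp_le_exp]
                have h2 : (k + 1) * (Real.exp L / L ^ 2) ≤ Real.exp L / 4 := by
                  calc (k + 1) * (Real.exp L / L ^ 2) ≤ (C * L) * (Real.exp L / L ^ 2) := by
                        gcongr
                    _ = (C / L) * Real.exp L := by field_simp
                    _ ≤ (1 / 4) * Real.exp L := by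
                        refine mul_le_mul_of_nonneg_right ?_ (by linarith)
                        rw [div_le_iff₀ hL0]
                        linarith
                    _ = _ := by ring
                linarith
        · intro m hm0 hmx hQ
          have hm0' : (0 : ℝ) < m := by exact_mod_cast hm0
          have hm1 : (1 : ℝ) ≤ m := by exact_mod_cast hm0
          have hX0 : 0 < x / m := by positivity
          have h1 := hL (x / m) hX0
            (by rw [Real.le_log_iff_exp_le hX0]; exact hQ)
            (by
              rw [Real.log_le_iff_le_exp hX0]
              exact div_le_self hx0.le hm1) m hmx
          refine h1.trans_eq ?_
          ring
    rw [hsplit]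
    have hLp : 1 ≤ L ^ (3 * (ℓ + 1) + 1) := one_le_pow₀ (by linarith)
    have hsmall' : x * g * (2 * 9 ^ ℓ * L * W) ≤
        x * g * (2 * 9 ^ ℓ * (L * L ^ (3 * (ℓ + 1) + 1)) * W) := by
      gcongr
      exact le_mul_of_one_le_right hL0.le hLp
    refine (add_le_add (hsmall.trans hsmall') hlarge).trans_eq ?_
    ring
  obtain ⟨L₀, hL₀⟩ := eventually_atTop.1 hev
  refine ⟨Real.exp (Real.exp L₀), fun x hx k hk => ?_⟩
  have hx0 : 0 < x := (Real.exp_pos _).trans hx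
  have h1 : Real.exp L₀ < Real.log x := (Real.lt_log_iff_exp_lt hx0).2 hx
  have h2 : 0 < Real.log x := (Real.exp_pos _).trans h1
  have h3 : L₀ < Real.log (Real.log x) := (Real.lt_log_iff_exp_lt h2).2 h1
  have h4 := hL₀ _ h3.le k hk
  rw [Real.exp_log h2, Real.exp_log hx0] at h4
  have h5 : √(Real.log x) ^ (ℓ + 1) = Real.exp ((ℓ + 1) / 2 * Real.log (Real.log x)) := by
    rw [Real.sqrt_eq_rpow, ← Real.rpow_natCast, ← Real.rpow_mul h2.le, Real.rpow_def_of_pos h2]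
    congr 1
    push_cast
    ring
  rw [Real.rpow_natCast, h5, div_eq_mul_inv, ← Real.exp_neg]
  exact h4
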